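/- Let $M$ be a smooth manifold (Hausdorff, paracompact, of dimension $m$) and let $\mathcal U=\{U_\alpha\}$ be a Leray cover of $M$: an open cover such that every $U_\alpha$ and every finite intersection $U_{\alpha_0\dots\alpha_p}=U_{\alpha_0}\cap\dots\cap U_{\alpha_p}$ is contractible or empty. Let $\mathbb C^\times_M$ be the sheaf of smooth $\mathbb C^\times$-valued functions, $\mathcal A^k$ the sheaf of smooth complex-valued $k$-forms, $\mathbb Z(3)=(2\pi i)^3\mathbb Z$ (constant sheaf), and consider the complexes of sheaves $$\mathbb C^\times(3)_M:\ \mathbb C^\times_M\xrightarrow{d\log}\mathcal A^1\xrightarrow{d}\mathcal A^2,\qquad \mathbb Z(3)_D^\infty:\ \mathbb Z(3)\hookrightarrow\mathcal A^0\xrightarrow{d}\mathcal A^1\xrightarrow{d}\mathcal A^2,$$ in degrees $0,1,2$ and $0,1,2,3$. Hypercohomology $\mathbb H^n(M,K)$ is the cohomology of $\Gamma(M,T^\bullet)$ for an injective resolution $K\to T^\bullet$. $\check C(\mathcal U,K)$ is the total complex of the Čech double complex $C^p(\mathcal U,K^q)=\prod_{\alpha_0,\dots,\alpha_p}K^q(U_{\alpha_0\dots\alpha_p})$,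 with differential $d+(-1)^q\delta$. A $B$-field given on $\mathcal U$ is a triple $(h,A,B)$ of functions $h_{\alpha\beta\gamma}\in\mathbb C^\times_M(U_{\alpha\beta\gamma})$, 1-forms $A_{\alpha\beta}\in\mathcal A^1(U_{\alpha\beta})$ and 2-forms $B_\alpha\in\mathcal A^2(U_\alpha)$, for all indices, such that $$B_\alpha-B_\beta=dA_{\alpha\beta},\quad A_{\alpha\beta}+A_{\beta\gamma}-A_{\alpha\gamma}=d\log h_{\alpha\beta\gamma},\quad h_{\alpha\beta\gamma}^{-1}h_{\alpha\beta\nu}h_{\alpha\gamma\nu}^{-1}h_{\beta\gamma\nu}=1 .$$ An isomorphism $(h,A,B)\to(h',A',B')$ consists of $f_{\alpha\beta}\in\mathbb C^\times_M(U_{\alpha\beta})$ and $a_\alpha\in\mathcal A^1(U_\alpha)$ with $$h'_{\alpha\beta\gamma}=h_{\alpha\beta\gamma}f_{\beta\gamma}f_{\alpha\gamma}^{-1}f_{\alpha\beta},\quad A'_{\alpha\beta}=A_{\alpha\beta}+d\log f_{\alpha\beta}+a_\alpha-a_\beta,\quad B'_\alpha=B_\alpha+da_\alpha .$$ Then: 1.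 $(h,A,B)\mapsto$ the Čech cochain with components $h,A,B$ in bidegrees $(p,q)=(2,0),(1,1),(0,2)$ is a bijection from the $B$-fields on $\mathcal U$ onto the 2-cocycles of $\check C(\mathcal U,\mathbb C^\times(3)_M)$. 2. The canonical map $\kappa:H^2\check C(\mathcal U,\mathbb C^\times(3)_M)\to\mathbb H^2(M,\mathbb C^\times_M\to\mathcal A^1\to\mathcal A^2)$ (it sends the class of a Čech cocycle $c$ to the class of a cocycle $t$ of $\Gamma(M,T^\bullet)$ if and only if $c$ and $t$ become cohomologous in $\check C(\mathcal U,T^\bullet)$) is an isomorphism of groups, and sending a $B$-field to $\kappa[(h,A,B)]$ induces a bijection from the isomorphism classes of $B$-fields on $\mathcal U$ onto $\mathbb H^2(M,\mathbb C^\times_M\to\mathcal A^1\to\mathcal A^2)$. 3. The morphism from $\mathbb Z(3)_D^\infty$ to $\mathbb C^\times(3)_M$ placed in degrees $1,2,3$, given by $f\mapsto\exp((2\pi i)^{-2}f)$ on $\mathcal A^0$ and by multiplication by $(2\pi i)^{-2}$ on $\mathcal A^1,\mathcal A^2$, induces an isomorphism of groups $\theta:\mathbb H^3(M,\mathbb Z(3)_D^\infty)\cong\mathbb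 H^2(M,\mathbb C^\times(3)_M)$. Consequently the isomorphism classes of $B$-fields on $\mathcal U$ are in bijection with $\mathbb H^3(M,\mathbb Z(3)_D^\infty)$, through $\theta^{-1}$ applied to the class in part 2. -/

import Mathlib

open CategoryTheory TopologicalSpace Opposite Limits
open scoped Manifold ContDiff

universe u v

set_option linter.unusedSectionVars false

noncomputable section

namespace BFieldClassification

/-- The model space `ℝ^m`. -/
abbrev Euc (m : ℕ) : Type := EuclideanSpace ℝ (Fin m)

lemma two_le_infty : minSmoothness ℝ 2 ≤ ∞ := by
  rw [minSmoothness_of_isRCLikeNormedField]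
  exact WithTop.coe_le_coe.2 le_top

section Forms

variable {m : ℕ} {M : Type u} [TopologicalSpace M] [ChartedSpace (Euc m) M]

/-- Complex-valued alternating `k`-forms on the tangent space at `x`. -/
abbrev AltForm (m k : ℕ) {M : Type u} [TopologicalSpace M] [ChartedSpace (Euc m) M] (x : M) : Type :=
  TangentSpace 𝓘(ℝ, Euc m) x [⋀^Fin k]→L[ℝ] ℂ

open Classical in
/-- The coordinate representation of a (not necessarily smooth) form `θ` on `V` in the preferred
chart `c` at `x`, i.e. the pullback of `θ` along `c⁻¹` (and zero outside the domain). -/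
def chartRep {k : ℕ} {V : Opens M} (θ : ∀ x : V, AltForm m k (x : M)) (x : M) :
    Euc m → Euc m [⋀^Fin k]→L[ℝ] ℂ := fun y =>
  if h : (chartAt (Euc m) x).symm y ∈ V then
    (θ ⟨(chartAt (Euc m) x).symm y, h⟩).compContinuousLinearMap
      (mfderiv 𝓘(ℝ, Euc m) 𝓘(ℝ, Euc m) (chartAt (Euc m) x).symm y)
  else 0

/-- Smoothness of a form, in the preferred charts. -/
def IsSmoothForm {k : ℕ} {V : Opens M} (θ : ∀ x : V, AltForm m k (x : M)) : Prop :=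
  ∀ x : V, ContDiffAt ℝ ∞ (chartRep θ (x : M)) (chartAt (Euc m) (x : M) x)

lemma chartRep_add {k : ℕ} {V : Opens M} (θ η : ∀ x : V, AltForm m k (x : M)) (x : M) :
    chartRep (θ + η) x = chartRep θ x + chartRep η x := by
  funext y
  by_cases h : (chartAt (Euc m) x).symm y ∈ V
  · simp only [chartRep, h, dif_pos, Pi.add_apply]
    ext v; rfl
  · simp [chartRep, h]

lemma chartRep_zero {k : ℕ} {V : Opens M} (x : M) :
    chartRep (0 : ∀ x : V, AltForm m k (x : M)) x = 0 := by
  funext y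
  by_cases h : (chartAt (Euc m) x).symm y ∈ V
  · simp only [chartRep, h, dif_pos, Pi.zero_apply]
    ext v; rfl
  · simp [chartRep, h]

lemma chartRep_smul {k : ℕ} {V : Opens M} (a : ℂ) (θ : ∀ x : V, AltForm m k (x : M)) (x : M) :
    chartRep (a • θ) x = a • chartRep θ x := by
  funext y
  by_cases h : (chartAt (Euc m) x).symm y ∈ V
  · simp only [chartRep, h, dif_pos, Pi.smul_apply]
    ext v; rfl
  · simp only [chartRep, h, dif_neg, Pi.smul_apply, not_false_eq_true]
    exact (smul_zero (A := Euc m [⋀^Fin k]→L[ℝ] ℂ) a).symm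

lemma symm_mem_nhds {V : Opens M} (x : M) {y : Euc m} (hy : y ∈ (chartAt (Euc m) x).target)
    (h : (chartAt (Euc m) x).symm y ∈ V) :
    ∀ᶠ z in nhds y, z ∈ (chartAt (Euc m) x).target ∧ (chartAt (Euc m) x).symm z ∈ V := by
  refine ((chartAt (Euc m) x).open_target.mem_nhds hy |> Filter.eventually_mem_set.2).and ?_
  exact ((chartAt (Euc m) x).continuousAt_symm hy).eventually (V.isOpen.mem_nhds h)

lemma symm_mem_nhds_self {V : Opens M} (x : V) :
    ∀ᶠ z in nhds (chartAt (Euc m) (x : M) x),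
      z ∈ (chartAt (Euc m) (x : M)).target ∧ (chartAt (Euc m) (x : M)).symm z ∈ V :=
  symm_mem_nhds _ (mem_chart_target _ _) (by simp)

lemma chartRep_res {k : ℕ} {V W : Opens M} (h : W ≤ V) (θ : ∀ x : V, AltForm m k (x : M))
    (x : W) :
    chartRep (fun y : W => θ ⟨y, h y.2⟩) (x : M) =ᶠ[nhds (chartAt (Euc m) (x : M) x)]
      chartRep θ (x : M) := by
  filter_upwards [symm_mem_nhds_self x] with z hz
  simp [chartRep, hz.2, h hz.2]

/-- The group of smooth complex-valued `k`-forms on the open set `V`. -/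
def Form (m k : ℕ) {M : Type u} [TopologicalSpace M] [ChartedSpace (Euc m) M] (V : Opens M) :
    AddSubgroup (∀ x : V, AltForm m k (x : M)) where
  carrier := {θ | IsSmoothForm θ}
  zero_mem' := fun x => by
    rw [chartRep_zero]; exact contDiffAt_const
  add_mem' := fun {a b} ha hb x => by
    rw [chartRep_add]; exact (ha x).add (hb x)
  neg_mem' := fun {a} ha x => by
    have : -a = (-1 : ℂ) • a := (neg_one_smul ℂ a).symm
    rw [this, chartRep_smul]
    exact ContDiffAt.const_smul (-1 : ℂ) (ha x)

lemma isSmoothForm_local {k : ℕ} {V : Opens M} (θ : ∀ x : V, AltForm m k (x : M))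
    (H : ∀ x : V, ∃ (W : Opens M) (_ : x.1 ∈ W) (i : W ≤ V),
      IsSmoothForm (fun y : W => θ ⟨y, i y.2⟩)) : IsSmoothForm θ := by
  intro x
  obtain ⟨W, hx, i, hW⟩ := H x
  exact (hW ⟨x, hx⟩).congr_of_eventuallyEq (chartRep_res i θ ⟨x, hx⟩).symm

/-- Restriction of forms. -/
def Form.res {k : ℕ} {V W : Opens M} (h : W ≤ V) : Form m k V →+ Form m k W where
  toFun θ := ⟨fun x => θ.1 ⟨x, h x.2⟩, fun x =>
    (θ.2 ⟨x, h x.2⟩).congr_of_eventuallyEq (chartRep_res h θ.1 x)⟩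
  map_zero' := rfl
  map_add' _ _ := rfl

/-- Multiplication of forms by a complex constant. -/
def Form.scale {k : ℕ} {V : Opens M} (a : ℂ) : Form m k V →+ Form m k V where
  toFun θ := ⟨a • θ.1, fun x => by
    rw [chartRep_smul]; exact ContDiffAt.const_smul a (θ.2 x)⟩
  map_zero' := Subtype.ext (smul_zero a)
  map_add' _ _ := Subtype.ext (smul_add a _ _)

/-- The exterior derivative: in the preferred chart at `x` it is the exterior derivative of the
coordinate representation, pulled back to the tangent space at `x`. -/
def extD {k : ℕ} {V : Opens M} (θ : ∀ x : V, AltForm m k (x : M)) (x : V) :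
    AltForm m (k + 1) (x : M) :=
  (extDeriv (chartRep θ (x : M)) (chartAt (Euc m) (x : M) x)).compContinuousLinearMap
    (mfderiv 𝓘(ℝ, Euc m) 𝓘(ℝ, Euc m) (chartAt (Euc m) (x : M)) (x : M))

variable [IsManifold 𝓘(ℝ, Euc m) ∞ M]

lemma chartRep_extD {k : ℕ} {V : Opens M} (θ : ∀ x : V, AltForm m k (x : M)) (hθ : IsSmoothForm θ)
    (x : M) {y : Euc m} (hy : y ∈ (chartAt (Euc m) x).target)
    (h : (chartAt (Euc m) x).symm y ∈ V) :
    chartRep (extD θ) x y = extDeriv (chartRep θ x) y := by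
  have : IsManifold 𝓘(ℝ, Euc m) 1 M := IsManifold.of_le (n := ∞) (by norm_cast)
  set c := chartAt (Euc m) x with hc
  set z := c.symm y with hz
  set c' := chartAt (Euc m) z with hc'
  have hzs : z ∈ c.source := c.map_target hy
  have hzs' : z ∈ c'.source := mem_chart_source _ _
  have hcz : c z = y := c.right_inv hy
  -- the transition map
  set τ : Euc m → Euc m := fun w => c' (c.symm w) with hτ
  have hτs : ContDiffAt ℝ ∞ τ y := by
    rw [← contMDiffAt_iff_contDiffAt]
    exact ContMDiffAt.comp y
      (contMDiffAt_of_mem_maximalAtlas (IsManifold.chart_mem_maximalAtlas _) hzs')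
      (contMDiffAt_symm_of_mem_maximalAtlas (IsManifold.chart_mem_maximalAtlas _) hy)
  have hev : ∀ᶠ w in nhds y, w ∈ c.target ∧ c.symm w ∈ V ∧ c.symm w ∈ c'.source := by
    filter_upwards [symm_mem_nhds x hy h,
      (c.continuousAt_symm hy).eventually (c'.open_source.mem_nhds hzs')] with w h1 h2
    exact ⟨h1.1, h1.2, h2⟩
  have hfd : ∀ w, w ∈ c.target → c.symm w ∈ c'.source →
      fderiv ℝ τ w = (mfderiv 𝓘(ℝ, Euc m) 𝓘(ℝ, Euc m) c' (c.symm w)).comp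
        (mfderiv 𝓘(ℝ, Euc m) 𝓘(ℝ, Euc m) c.symm w) := by
    intro w hw hw'
    rw [← mfderiv_eq_fderiv]
    exact mfderiv_comp w (mdifferentiableAt_atlas (chart_mem_atlas _ _) hw')
      (mdifferentiableAt_atlas_symm (chart_mem_atlas _ _) hw)
  have hrep : chartRep θ x =ᶠ[nhds y] fun w =>
      (chartRep θ z (τ w)).compContinuousLinearMap (fderiv ℝ τ w) := by
    filter_upwards [hev] with w hw
    have hcont : ContinuousAt τ w :=
      (c'.continuousAt hw.2.2).comp (c.continuousAt_symm hw.1)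
    have e1 : c'.symm (τ w) = c.symm w := c'.left_inv hw.2.2
    have hmem : c'.symm (τ w) ∈ V := by rw [e1]; exact hw.2.1
    have hd : mfderiv 𝓘(ℝ, Euc m) 𝓘(ℝ, Euc m) (fun w => c'.symm (τ w)) w =
        mfderiv 𝓘(ℝ, Euc m) 𝓘(ℝ, Euc m) c.symm w := by
      apply Filter.EventuallyEq.mfderiv_eq
      filter_upwards [c.open_target.mem_nhds hw.1,
        (c.continuousAt_symm hw.1).eventually (c'.open_source.mem_nhds hw.2.2)] with w' _ h2
      exact c'.left_inv h2
    have hd2 : mfderiv 𝓘(ℝ, Euc m) 𝓘(ℝ, Euc m) (fun w => c'.symm (τ w)) w =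
        (mfderiv 𝓘(ℝ, Euc m) 𝓘(ℝ, Euc m) c'.symm (τ w)).comp
          (mfderiv 𝓘(ℝ, Euc m) 𝓘(ℝ, Euc m) τ w) := by
      refine mfderiv_comp w (mdifferentiableAt_atlas_symm (chart_mem_atlas _ _)
        (c'.map_source hw.2.2)) ?_
      exact MDifferentiableAt.comp w (mdifferentiableAt_atlas (chart_mem_atlas _ _) hw.2.2)
        (mdifferentiableAt_atlas_symm (chart_mem_atlas _ _) hw.1)
    rw [← mfderiv_eq_fderiv]
    simp only [chartRep, ← hc, ← hc', hw.2.1, hmem, dif_pos]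
    have key : ∀ (p q : M) (hp : p ∈ V) (hq : q ∈ V), p = q →
        ∀ v : Fin k → Euc m, (θ ⟨p, hp⟩) v = (θ ⟨q, hq⟩) v := by
      rintro p q hp hq rfl v; rfl
    ext v
    refine (key _ _ _ hmem e1.symm _).trans ?_
    change (θ ⟨_, hmem⟩) _ = (θ ⟨_, hmem⟩) _
    congr 1
    funext i
    change (mfderiv 𝓘(ℝ, Euc m) 𝓘(ℝ, Euc m) c.symm w) (v i) = _
    rw [← hd, hd2]
    rfl
  rw [hrep.extDeriv_eq, extDeriv_pullback (r := ∞) _ hτs two_le_infty, hfd y hy hzs']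
  · simp only [chartRep, ← hc, ← hz, h, dif_pos, extD]
    rfl
  · exact (hθ ⟨z, h⟩).differentiableAt (by simp)

lemma extD_smooth {k : ℕ} {V : Opens M} (θ : ∀ x : V, AltForm m k (x : M)) (hθ : IsSmoothForm θ) :
    IsSmoothForm (extD θ) := by
  intro x
  have h1 : chartRep (extD θ) (x : M) =ᶠ[nhds (chartAt (Euc m) (x : M) x)]
      extDeriv (chartRep θ (x : M)) := by
    filter_upwards [symm_mem_nhds_self x] with z hz
    exact chartRep_extD θ hθ x hz.1 hz.2
  refine ContDiffAt.congr_of_eventuallyEq ?_ h1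
  have h2 : ContDiffAt ℝ ∞ (fderiv ℝ (chartRep θ (x : M))) (chartAt (Euc m) (x : M) x) :=
    (hθ x).fderiv_right (by simp)
  exact ((ContinuousAlternatingMap.alternatizeUncurryFinCLM ℝ (Euc m) ℂ).contDiff.contDiffAt).comp
    _ h2

/-- The exterior derivative `d : A^k(V) → A^{k+1}(V)`. -/
def Form.d {k : ℕ} {V : Opens M} : Form m k V →+ Form m (k + 1) V :=
  AddMonoidHom.mk' (fun θ => ⟨extD θ.1, extD_smooth θ.1 θ.2⟩) fun a b => by
    ext1; funext x
    simp only [extD, AddSubgroup.coe_add, chartRep_add]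
    rw [extDeriv_add ((a.2 x).differentiableAt (by simp)) ((b.2 x).differentiableAt (by simp))]
    rfl

lemma Form.d_res {k : ℕ} {V W : Opens M} (h : W ≤ V) (θ : Form m k V) :
    Form.d (Form.res h θ) = Form.res h (Form.d θ) := by
  ext1; funext x
  simp only [Form.d, Form.res, AddMonoidHom.coe_mk, ZeroHom.coe_mk, AddMonoidHom.mk'_apply, extD]
  rw [(chartRep_res h θ.1 x).extDeriv_eq]

lemma Form.d_d {k : ℕ} {V : Opens M} (θ : Form m k V) : Form.d (Form.d θ) = 0 := by
  ext1; funext x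
  have h1 : chartRep (extD θ.1) (x : M) =ᶠ[nhds (chartAt (Euc m) (x : M) x)]
      extDeriv (chartRep θ.1 (x : M)) := by
    filter_upwards [symm_mem_nhds_self x] with z hz
    exact chartRep_extD θ.1 θ.2 x hz.1 hz.2
  simp only [Form.d, AddMonoidHom.mk'_apply]
  rw [extD, h1.extDeriv_eq, extDeriv_extDeriv_apply (r := ∞) (θ.2 x) two_le_infty]
  rfl

lemma Form.d_scale {k : ℕ} {V : Opens M} (a : ℂ) (θ : Form m k V) :
    Form.d (Form.scale a θ) = Form.scale a (Form.d θ) := by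
  ext1; funext x
  simp only [Form.d, Form.scale, AddMonoidHom.coe_mk, ZeroHom.coe_mk, AddMonoidHom.mk'_apply, extD, chartRep_smul]
  have : extDeriv (a • chartRep θ.1 (x : M)) (chartAt (Euc m) (x : M) x) =
      a • extDeriv (chartRep θ.1 (x : M)) (chartAt (Euc m) (x : M) x) := by
    ext v
    rw [extDeriv, fderiv_const_smul ((θ.2 x).differentiableAt (by simp))]
    rw [ContinuousAlternatingMap.alternatizeUncurryFin_smul]; rfl
  rw [this]; rfl

/-- A complex function regarded as a (not necessarily smooth) `0`-form. -/
def zeroForm {V : Opens M} (f : V → ℂ) (x : V) : AltForm m 0 (x : M) :=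
  ContinuousAlternatingMap.constOfIsEmpty ℝ (TangentSpace 𝓘(ℝ, Euc m) (x : M)) (Fin 0) (f x)

open Classical in
/-- Extension of a function on `V` by zero. -/
def extendFun {V : Opens M} (f : V → ℂ) (x : M) : ℂ := if h : x ∈ V then f ⟨x, h⟩ else 0

lemma chartRep_zeroForm {V : Opens M} (f : V → ℂ) (x : M) :
    chartRep (zeroForm (m := m) f) x = fun y => ContinuousAlternatingMap.constOfIsEmpty ℝ (Euc m)
      (Fin 0) (extendFun f ((chartAt (Euc m) x).symm y)) := by
  funext y
  by_cases h : (chartAt (Euc m) x).symm y ∈ V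
  · simp only [chartRep, extendFun, h, dif_pos]; rfl
  · simp only [chartRep, extendFun, h, dif_neg, not_false_eq_true]; ext v; simp

lemma contMDiff_iff_extend {V : Opens M} (f : V → ℂ) :
    ContMDiff 𝓘(ℝ, Euc m) 𝓘(ℝ, ℂ) ∞ f ↔ ∀ x : V, ContDiffAt ℝ ∞
      (fun y => extendFun f ((chartAt (Euc m) (x : M)).symm y)) (chartAt (Euc m) (x : M) x) := by
  refine forall_congr' fun x => ?_
  have h0 : f = fun x : V => extendFun f (x : M) := by
    funext x; simp [extendFun]
  conv_lhs => rw [h0]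
  rw [contMDiffAt_subtype_iff, contMDiffAt_iff_source_of_mem_source (mem_chart_source _ _)]
  simp [contMDiffWithinAt_univ, contMDiffAt_iff_contDiffAt, Function.comp_def]
  

lemma isSmoothForm_zeroForm {V : Opens M} (f : V → ℂ) :
    IsSmoothForm (zeroForm (m := m) f) ↔ ContMDiff 𝓘(ℝ, Euc m) 𝓘(ℝ, ℂ) ∞ f := by
  rw [contMDiff_iff_extend]
  refine forall_congr' fun x => ?_
  rw [chartRep_zeroForm]
  exact (ContinuousAlternatingMap.constOfIsEmptyLIE ℝ (Euc m) ℂ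
    (Fin 0)).toContinuousLinearEquiv.comp_contDiffAt_iff

lemma extD_zeroForm {V : Opens M} (f : V → ℂ) (x : V) :
    extD (zeroForm (m := m) f) x = (ContinuousAlternatingMap.ofSubsingleton ℝ (Euc m) ℂ (0 : Fin 1)
      (fderiv ℝ (fun y => extendFun f ((chartAt (Euc m) (x : M)).symm y))
        (chartAt (Euc m) (x : M) x))).compContinuousLinearMap
      (mfderiv 𝓘(ℝ, Euc m) 𝓘(ℝ, Euc m) (chartAt (Euc m) (x : M)) (x : M)) := by
  rw [extD, chartRep_zeroForm, extDeriv_constOfIsEmpty]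

/-- The coordinates of a tangent vector at `x` in the preferred chart at `x`. -/
def tangentCoord {x : M} (v : TangentSpace 𝓘(ℝ, Euc m) x) : Euc m :=
  mfderiv 𝓘(ℝ, Euc m) 𝓘(ℝ, Euc m) (chartAt (Euc m) x) x v

lemma extD_zeroForm_apply {V : Opens M} (f : V → ℂ) (x : V)
    (v : Fin 1 → TangentSpace 𝓘(ℝ, Euc m) (x : M)) :
    extD (zeroForm (m := m) f) x v =
      fderiv ℝ (fun y => extendFun f ((chartAt (Euc m) (x : M)).symm y))
        (chartAt (Euc m) (x : M) x) (tangentCoord (v 0)) := by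
  rw [extD_zeroForm]; rfl

/-- The multiplicative group of smooth functions `V → ℂˣ`. -/
def CxFun (m : ℕ) {M : Type u} [TopologicalSpace M] [ChartedSpace (Euc m) M] (V : Opens M) :
    Subgroup (V → ℂˣ) where
  carrier := {f | ContMDiff 𝓘(ℝ, Euc m) 𝓘(ℝ, ℂ) ∞ fun x => (f x : ℂ)}
  one_mem' := contMDiff_const
  mul_mem' {f g} hf hg := by
    exact (contDiff_mul (𝕜 := ℝ) (𝔸 := ℂ)).contMDiff.comp (hf.prodMk_space hg)
  inv_mem' {f} hf x := by
    have : ContDiffAt ℝ ∞ (fun z : ℂ => z⁻¹) (f x : ℂ) := contDiffAt_inv ℝ (f x).ne_zero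
    simpa [Function.comp_def] using this.contMDiffAt.comp x (hf x)

/-- Restriction of functions. -/
def CxFun.res {V W : Opens M} (h : W ≤ V) : CxFun m V →* CxFun m W where
  toFun f := ⟨fun x => f.1 ⟨x, h x.2⟩, by
    have hf : ContMDiff 𝓘(ℝ, Euc m) 𝓘(ℝ, ℂ) ∞ fun x => (f.1 x : ℂ) := f.2
    exact hf.comp (contMDiff_inclusion h)⟩
  map_one' := rfl
  map_mul' _ _ := rfl

/-- The underlying complex-valued function. -/
def cxVal {V : Opens M} (f : CxFun m V) (x : V) : ℂ := (f.1 x : ℂ)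

lemma extendFun_val_ne_zero {V : Opens M} (f : CxFun m V) {x : M} (hx : x ∈ V) :
    extendFun (cxVal f) x ≠ 0 := by
  simp [extendFun, hx, cxVal]

lemma cxVal_contDiffAt {V : Opens M} (f : CxFun m V) (x : V) :
    ContDiffAt ℝ ∞ (fun y => extendFun (cxVal f) ((chartAt (Euc m) (x : M)).symm y))
      (chartAt (Euc m) (x : M) x) :=
  (contMDiff_iff_extend (cxVal f)).1 f.2 x

lemma dlog_local {F : Euc m → ℂ} {y₀ : Euc m} (hF : ContDiffAt ℝ ∞ F y₀) (h0 : F y₀ ≠ 0) :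
    ∃ G : Euc m → ℂ, ContDiffAt ℝ ∞ G y₀ ∧ ∀ᶠ y in nhds y₀,
      fderiv ℝ G y = (F y)⁻¹ • fderiv ℝ F y := by
  refine ⟨fun y => Complex.log (F y / F y₀), ?_, ?_⟩
  · have h1 : ContDiffAt ℝ ∞ Complex.log (F y₀ / F y₀) :=
      (Complex.contDiffAt_log (by rw [div_self h0]; simp)).restrict_scalars ℝ
    have h2 : ContDiffAt ℝ ∞ (fun y => F y / F y₀) y₀ := by
      simp only [div_eq_mul_inv]; exact hF.mul contDiffAt_const
    exact h1.comp y₀ h2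
  · have hd : ∀ᶠ y in nhds y₀, DifferentiableAt ℝ F y :=
      ((hF.of_le (m := 1) (by norm_cast)).eventually (by simp)).mono
        fun y hy => hy.differentiableAt (by simp)
    have hs : ∀ᶠ y in nhds y₀, F y / F y₀ ∈ Complex.slitPlane := by
      have : ContinuousAt (fun y => F y / F y₀) y₀ := hF.continuousAt.div_const _
      exact this.eventually (Complex.isOpen_slitPlane.mem_nhds (by simp [div_self h0]))
    filter_upwards [hd, hs] with y hy hsy
    have h3 : HasFDerivAt (fun y => F y / F y₀) ((F y₀)⁻¹ • fderiv ℝ F y) y := by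
      simp only [div_eq_mul_inv, mul_comm _ (F y₀)⁻¹]
      exact hy.hasFDerivAt.const_smul (F y₀)⁻¹
    have h4 := ((Complex.hasDerivAt_log hsy).hasFDerivAt.restrictScalars ℝ).comp y h3
    refine h4.fderiv.trans ?_
    have hy0 : F y ≠ 0 := by
      rintro h; rw [h, zero_div] at hsy; simp at hsy
    ext v
    simp
    field_simp

/-- The pointwise formula `f⁻¹ df`. -/
def dlogFun {V : Opens M} (f : CxFun m V) (x : V) : AltForm m 1 (x : M) :=
  (cxVal f x)⁻¹ • extD (zeroForm (m := m) (cxVal f)) x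

lemma chartRep_dlogFun {V : Opens M} (f : CxFun m V) (x : V) :
    chartRep (dlogFun f) (x : M) =ᶠ[nhds (chartAt (Euc m) (x : M) x)] fun y =>
      (extendFun (cxVal f) ((chartAt (Euc m) (x : M)).symm y))⁻¹ •
        ContinuousAlternatingMap.ofSubsingleton ℝ (Euc m) ℂ (0 : Fin 1)
          (fderiv ℝ (fun y => extendFun (cxVal f) ((chartAt (Euc m) (x : M)).symm y)) y) := by
  filter_upwards [symm_mem_nhds_self x] with y hy
  have h1 := chartRep_extD (zeroForm (m := m) (cxVal f)) ((isSmoothForm_zeroForm _).2 f.2) x hy.1 hy.2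
  rw [chartRep_zeroForm, extDeriv_constOfIsEmpty] at h1
  rw [← h1]
  simp only [chartRep, hy.2, dif_pos, dlogFun, extendFun]
  rfl

/-- Near each point `d log f` is the differential of a local branch of the logarithm. -/
lemma chartRep_dlogFun_local {V : Opens M} (f : CxFun m V) (x : V) :
    ∃ G : Euc m → ℂ, ContDiffAt ℝ ∞ G (chartAt (Euc m) (x : M) x) ∧
    chartRep (dlogFun f) (x : M) =ᶠ[nhds (chartAt (Euc m) (x : M) x)]
      extDeriv fun y => ContinuousAlternatingMap.constOfIsEmpty ℝ (Euc m) (Fin 0) (G y) := by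
  obtain ⟨G, hG, h⟩ := dlog_local (cxVal_contDiffAt f x)
    (by simpa using extendFun_val_ne_zero f x.2)
  refine ⟨G, hG, ?_⟩
  filter_upwards [chartRep_dlogFun f x, h] with y h1 h2
  rw [h1, extDeriv_constOfIsEmpty, h2]
  rfl

lemma contDiffAt_const_form {G : Euc m → ℂ} {y : Euc m} (hG : ContDiffAt ℝ ∞ G y) :
    ContDiffAt ℝ ∞ (fun y => ContinuousAlternatingMap.constOfIsEmpty ℝ (Euc m) (Fin 0) (G y)) y :=
  (ContinuousAlternatingMap.constOfIsEmptyLIE ℝ (Euc m) ℂ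
    (Fin 0)).toContinuousLinearEquiv.comp_contDiffAt_iff.2 hG

lemma contDiffAt_extDeriv {k : ℕ} {α : Euc m → Euc m [⋀^Fin k]→L[ℝ] ℂ} {y : Euc m}
    (h : ContDiffAt ℝ ∞ α y) : ContDiffAt ℝ ∞ (extDeriv α) y :=
  ContDiffAt.comp (g := ContinuousAlternatingMap.alternatizeUncurryFinCLM ℝ (Euc m) ℂ) y
    (ContinuousLinearMap.contDiff _).contDiffAt (h.fderiv_right (m := ∞) (by simp))

/-- The logarithmic derivative `d log : f ↦ f⁻¹ df`. -/
def dlog {V : Opens M} (f : CxFun m V) : Form m 1 V :=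
  ⟨dlogFun f, fun x => by
    obtain ⟨G, hG, h⟩ := chartRep_dlogFun_local f x
    exact (contDiffAt_extDeriv (contDiffAt_const_form hG)).congr_of_eventuallyEq h⟩

lemma dlog_mul {V : Opens M} (f g : CxFun m V) : dlog (f * g) = dlog f + dlog g := by
  ext1; funext x
  have hf := (cxVal_contDiffAt f x).differentiableAt (by simp)
  have hg := (cxVal_contDiffAt g x).differentiableAt (by simp)
  have hfg : (fun y => extendFun (cxVal (f * g)) ((chartAt (Euc m) (x : M)).symm y)) =
      fun y => extendFun (cxVal f) ((chartAt (Euc m) (x : M)).symm y) *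
        extendFun (cxVal g) ((chartAt (Euc m) (x : M)).symm y) := by
    funext y
    by_cases h : (chartAt (Euc m) (x : M)).symm y ∈ V
    · simp [extendFun, h, cxVal]
    · simp [extendFun, h]
  have h1 : cxVal f x ≠ 0 := (f.1 x).ne_zero
  have h2 : cxVal g x ≠ 0 := (g.1 x).ne_zero
  have h3 : cxVal (f * g) x = cxVal f x * cxVal g x := rfl
  have h4 : extendFun (cxVal f) (x : M) = cxVal f x := by simp [extendFun]
  have h5 : extendFun (cxVal g) (x : M) = cxVal g x := by simp [extendFun]
  ext v
  change (cxVal (f * g) x)⁻¹ * extD (zeroForm (cxVal (f * g))) x v =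
    (cxVal f x)⁻¹ * extD (zeroForm (cxVal f)) x v + (cxVal g x)⁻¹ * extD (zeroForm (cxVal g)) x v
  rw [extD_zeroForm_apply, extD_zeroForm_apply, extD_zeroForm_apply, hfg,
    fderiv_fun_mul hf hg, h3]
  simp [h4, h5]
  field_simp
  ring

lemma dlog_res {V W : Opens M} (h : W ≤ V) (f : CxFun m V) :
    dlog (CxFun.res h f) = Form.res h (dlog f) := by
  ext1; funext x
  have := congrArg (fun θ => θ.1 x) (Form.d_res h
    (⟨zeroForm (cxVal f), (isSmoothForm_zeroForm _).2 f.2⟩ : Form m 0 V))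
  exact congrArg (fun t => (cxVal f ⟨x, h x.2⟩)⁻¹ • t) this

lemma d_dlog {V : Opens M} (f : CxFun m V) : Form.d (dlog f) = 0 := by
  ext1; funext x
  obtain ⟨G, hG, h⟩ := chartRep_dlogFun_local f x
  change extD (dlogFun f) x = 0
  rw [extD, h.extDeriv_eq, extDeriv_extDeriv_apply (contDiffAt_const_form hG) two_le_infty]
  rfl

/-- The complex-valued function given by a `0`-form. -/
def formFn {V : Opens M} (θ : Form m 0 V) (x : V) : ℂ := θ.1 x 0

lemma zeroForm_formFn {V : Opens M} (θ : Form m 0 V) : zeroForm (formFn θ) = θ.1 := by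
  funext x; ext v
  change θ.1 x 0 = θ.1 x v
  congr 1; exact Subsingleton.elim _ _

lemma formFn_smooth {V : Opens M} (θ : Form m 0 V) :
    ContMDiff 𝓘(ℝ, Euc m) 𝓘(ℝ, ℂ) ∞ (formFn θ) := by
  rw [← isSmoothForm_zeroForm, zeroForm_formFn]; exact θ.2

/-- The smooth function `exp (a θ)` for a `0`-form `θ`, i.e. a complex-valued function. -/
def Form.exp {V : Opens M} (a : ℂ) (θ : Form m 0 V) : CxFun m V :=
  ⟨fun x => Units.mk0 (Complex.exp (a * formFn θ x)) (Complex.exp_ne_zero _), by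
    have h : ContDiff ℝ ∞ fun z : ℂ => Complex.exp (a * z) :=
      (Complex.contDiff_exp.comp (contDiff_const.mul contDiff_id))
    exact h.contMDiff.comp (formFn_smooth θ)⟩

lemma Form.exp_add {V : Opens M} (a : ℂ) (θ η : Form m 0 V) :
    Form.exp a (θ + η) = Form.exp a θ * Form.exp a η := by
  ext x
  simp [Form.exp, formFn, mul_add, Complex.exp_add]

lemma Form.dlog_exp {V : Opens M} (a : ℂ) (θ : Form m 0 V) :
    dlog (Form.exp a θ) = Form.scale a (Form.d θ) := by
  ext1; funext x
  change (cxVal (Form.exp a θ) x)⁻¹ • extD (zeroForm (cxVal (Form.exp a θ))) x = a • extD θ.1 x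
  rw [← zeroForm_formFn]
  have hθ := ((contMDiff_iff_extend _).1 (formFn_smooth θ) x).differentiableAt (by simp)
  have he : (fun y => extendFun (cxVal (Form.exp a θ)) ((chartAt (Euc m) (x : M)).symm y))
      =ᶠ[nhds (chartAt (Euc m) (x : M) x)]
      fun y => Complex.exp (a * extendFun (formFn θ) ((chartAt (Euc m) (x : M)).symm y)) := by
    filter_upwards [symm_mem_nhds_self x] with y hy
    simp only [extendFun, hy.2, dif_pos]; rfl
  have h1 := (hθ.hasFDerivAt.const_mul a).cexp.fderiv
  have h4 : extendFun (formFn θ) (x : M) = formFn θ x := by simp [extendFun]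
  have h5 : cxVal (Form.exp a θ) x = Complex.exp (a * formFn θ x) := rfl
  ext v
  change (cxVal (Form.exp a θ) x)⁻¹ * extD (zeroForm (cxVal (Form.exp a θ))) x v =
    a * extD (zeroForm (formFn θ)) x v
  rw [extD_zeroForm_apply, extD_zeroForm_apply, he.fderiv_eq, h1, h5]
  simp [h4]

end Forms
section Sheaves

variable {X : TopCat.{u}}

/-- A presheaf of abelian groups whose sections are the dependent functions satisfying a local
predicate is a sheaf. -/
lemma isSheaf_of_pred {T : X → Type} (P : TopCat.LocalPredicate T)
    (F : TopCat.Presheaf AddCommGrpCat.{u} X)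
    (e : F ⋙ forget AddCommGrpCat.{u} ≅ TopCat.subpresheafToTypes P.toPrelocalPredicate) :
    F.IsSheaf := by
  rw [TopCat.Presheaf.isSheaf_iff_isSheaf_comp (forget AddCommGrpCat.{u}) F]
  exact TopCat.Presheaf.isSheaf_of_iso e.symm (TopCat.subpresheafToTypes.isSheaf P)

variable (m : ℕ) (M : Type u) [TopologicalSpace M] [ChartedSpace (Euc m) M]

/-- Smoothness of forms as a local predicate. -/
def formPred (k : ℕ) : TopCat.LocalPredicate (X := TopCat.of M) fun x => AltForm m k (M := M) x where
  pred {_} θ := IsSmoothForm (M := M) θ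
  res {_ _} i θ hθ := (Form.res (M := M) i.le ⟨θ, hθ⟩).2
  locality {_} θ H := isSmoothForm_local θ fun x => by
    obtain ⟨W, hx, i, h⟩ := H x
    exact ⟨W, hx, i.le, h⟩

/-- The sheaf `A^k` of smooth complex-valued `k`-forms. -/
def formSheaf (k : ℕ) : TopCat.Sheaf AddCommGrpCat.{u} (TopCat.of M) where
  obj :=
    { obj := fun V => AddCommGrpCat.of (Form m k (M := M) V.unop)
      map := fun i => AddCommGrpCat.ofHom (Form.res (M := M) i.unop.le) }
  property := isSheaf_of_pred (formPred m M k) _ (NatIso.ofComponents (fun _ => Iso.refl _))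

end Sheaves

section SheafMorphisms

variable (m : ℕ) (M : Type u) [TopologicalSpace M] [ChartedSpace (Euc m) M]

/-- Smoothness of `ℂˣ`-valued functions as a local predicate. -/
def cxPred : TopCat.LocalPredicate (X := TopCat.of M) fun _ => ℂˣ where
  pred {V} f := f ∈ CxFun m (M := M) V
  res {_ _} i f hf := (CxFun.res (M := M) i.le ⟨f, hf⟩).2
  locality {V} f H := by
    intro x
    obtain ⟨W, hx, i, h⟩ := H x
    exact ((contDiffWithinAt_localInvariantProp (I := 𝓘(ℝ, Euc m)) (I' := 𝓘(ℝ, ℂ))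
      ∞).liftPropAt_iff_comp_inclusion (f := fun x => (f x : ℂ)) i.le ⟨x, hx⟩).2 (h ⟨x, hx⟩)

/-- The sheaf of smooth `ℂˣ`-valued functions (written additively). -/
def cxSheaf : TopCat.Sheaf AddCommGrpCat.{u} (TopCat.of M) where
  obj :=
    { obj := fun V => AddCommGrpCat.of (Additive (CxFun m (M := M) V.unop))
      map := fun i => AddCommGrpCat.ofHom (MonoidHom.toAdditive (CxFun.res (M := M) i.unop.le)) }
  property := isSheaf_of_pred (cxPred m M) _ (NatIso.ofComponents (fun _ => Iso.refl _))

/-- The group of locally constant functions on `V` with values in `ℤ(p) = (2πi)^p ℤ ⊆ ℂ`. -/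
def ZFun (p : ℕ) {M : Type u} [TopologicalSpace M] (V : Opens M) : AddSubgroup (V → ℂ) where
  carrier := {f | IsLocallyConstant f ∧
    ∀ x, f x ∈ AddSubgroup.zmultiples ((2 * Real.pi * Complex.I : ℂ) ^ p)}
  zero_mem' := ⟨IsLocallyConstant.const 0, fun _ => zero_mem _⟩
  add_mem' := fun hf hg => ⟨hf.1.add hg.1, fun x => add_mem (hf.2 x) (hg.2 x)⟩
  neg_mem' := fun hf => ⟨hf.1.neg, fun x => neg_mem (hf.2 x)⟩

/-- Restriction of locally constant functions. -/
def ZFun.res {p : ℕ} {M : Type u} [TopologicalSpace M] {V W : Opens M} (h : W ≤ V) :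
    ZFun p V →+ ZFun p W where
  toFun f := ⟨fun x => f.1 ⟨x, h x.2⟩,
    f.2.1.comp_continuous (continuous_inclusion h), fun x => f.2.2 ⟨x, h x.2⟩⟩
  map_zero' := rfl
  map_add' _ _ := rfl

/-- Being a locally constant `ℤ(p)`-valued function as a local predicate. -/
def zPred (p : ℕ) (M : Type u) [TopologicalSpace M] :
    TopCat.LocalPredicate (X := TopCat.of M) fun _ => ℂ where
  pred {V} f := f ∈ ZFun p (M := M) V
  res {_ _} i f hf := (ZFun.res (M := M) i.le ⟨f, hf⟩).2
  locality {V} f H := by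
    refine ⟨(IsLocallyConstant.iff_exists_open f).2 fun x => ?_, fun x => ?_⟩
    · obtain ⟨W, hx, i, h⟩ := H x
      obtain ⟨U, hU, hxU, hc⟩ := (IsLocallyConstant.iff_exists_open _).1 h.1 ⟨x, hx⟩
      refine ⟨Set.inclusion i.le '' U, ?_, ⟨⟨x, hx⟩, hxU, rfl⟩, ?_⟩
      · exact (Opens.isOpenEmbedding_of_le i.le).isOpenMap U hU
      · rintro _ ⟨y, hy, rfl⟩
        exact hc y hy
    · obtain ⟨W, hx, i, h⟩ := H x
      exact h.2 ⟨x, hx⟩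

/-- The constant sheaf `ℤ(p)`. -/
def zSheaf (p : ℕ) (M : Type u) [TopologicalSpace M] :
    TopCat.Sheaf AddCommGrpCat.{u} (TopCat.of M) where
  obj :=
    { obj := fun V => AddCommGrpCat.of (ZFun p (M := M) V.unop)
      map := fun i => AddCommGrpCat.ofHom (ZFun.res (M := M) i.unop.le) }
  property := isSheaf_of_pred (zPred p M) _ (NatIso.ofComponents (fun _ => Iso.refl _))

variable [IsManifold 𝓘(ℝ, Euc m) ∞ M]

variable {m M} in
lemma isSmoothForm_of_locConst {p : ℕ} {V : Opens M} (f : ZFun p V) (x : V) :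
    ∃ a : ℂ, chartRep (zeroForm (m := m) f.1) (x : M) =ᶠ[nhds (chartAt (Euc m) (x : M) x)]
      fun _ => ContinuousAlternatingMap.constOfIsEmpty ℝ (Euc m) (Fin 0) a := by
  obtain ⟨U, hU, hx, hc⟩ := (IsLocallyConstant.iff_exists_open _).1 f.2.1 x
  obtain ⟨U', hU', rfl⟩ := isOpen_induced_iff.1 hU
  refine ⟨f.1 x, ?_⟩
  rw [chartRep_zeroForm]
  have hcont := (chartAt (Euc m) (x : M)).continuousAt_symm (mem_chart_target _ (x : M))
  have hmem : U' ∈ nhds ((chartAt (Euc m) (x : M)).symm (chartAt (Euc m) (x : M) x)) := by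
    simpa using hU'.mem_nhds hx
  filter_upwards [symm_mem_nhds_self x, hcont.eventually hmem] with y hy hy'
  simp only [extendFun, hy.2, dif_pos]
  rw [hc ⟨_, hy.2⟩ hy']

/-- The inclusion `ℤ(p) → A^0` on sections. -/
def ZFun.toForm {p : ℕ} {V : Opens M} : ZFun p V →+ Form m 0 V :=
  AddMonoidHom.mk' (fun f => ⟨zeroForm f.1, fun x => by
    obtain ⟨a, ha⟩ := isSmoothForm_of_locConst (m := m) f x
    exact contDiffAt_const.congr_of_eventuallyEq ha⟩) fun f g => by
    ext1; funext x; ext v; rfl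

lemma ZFun.d_toForm {p : ℕ} {V : Opens M} (f : ZFun p V) : Form.d (ZFun.toForm m M f) = 0 := by
  ext1; funext x
  obtain ⟨a, ha⟩ := isSmoothForm_of_locConst (m := m) f x
  change extD (zeroForm f.1) x = 0
  rw [extD, ha.extDeriv_eq, extDeriv_constOfIsEmpty]
  ext v
  simp
  rfl

/-! ### Morphisms of sheaves -/

lemma sheafHom_ext {X : TopCat.{u}} {F G : TopCat.Sheaf AddCommGrpCat.{u} X} (f g : F ⟶ G)
    (h : ∀ (V : (Opens X)ᵒᵖ) (s : F.obj.obj V), f.hom.app V s = g.hom.app V s) : f = g :=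
  ObjectProperty.hom_ext _ (NatTrans.ext (funext fun V => by ext s; exact h V s))

/-- `d : A^k ⟶ A^{k+1}`. -/
def dHom (k : ℕ) : formSheaf m M k ⟶ formSheaf m M (k + 1) :=
  ObjectProperty.homMk
    { app := fun _ => AddCommGrpCat.ofHom Form.d
      naturality := fun _ _ i => by
        ext θ; exact Form.d_res i.unop.le θ }

/-- `d log : ℂˣ ⟶ A^1`. -/
def dlogHom : cxSheaf m M ⟶ formSheaf m M 1 :=
  ObjectProperty.homMk
    { app := fun V => AddCommGrpCat.ofHom
        (AddMonoidHom.mk' (fun f : Additive (CxFun m (M := M) V.unop) => dlog f.toMul)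
          fun f g => dlog_mul f.toMul g.toMul)
      naturality := fun _ _ i => by
        ext θ; exact dlog_res i.unop.le θ.toMul }

/-- The inclusion `ℤ(p) ⟶ A^0`. -/
def inclHom (p : ℕ) : zSheaf p M ⟶ formSheaf m M 0 :=
  ObjectProperty.homMk
    { app := fun _ => AddCommGrpCat.ofHom (ZFun.toForm m M)
      naturality := fun _ _ i => by
        ext θ; rfl }

/-- `f ↦ exp (a f) : A^0 ⟶ ℂˣ`. -/
def expHom (a : ℂ) : formSheaf m M 0 ⟶ cxSheaf m M :=
  ObjectProperty.homMk
    { app := fun V => AddCommGrpCat.ofHom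
        (AddMonoidHom.mk' (fun θ : Form m 0 (M := M) V.unop => Additive.ofMul (Form.exp a θ))
          fun f g => congrArg Additive.ofMul (Form.exp_add a f g))
      naturality := fun _ _ i => by
        ext θ; rfl }

/-- Multiplication by `a` on `A^k`. -/
def scaleHom (a : ℂ) (k : ℕ) : formSheaf m M k ⟶ formSheaf m M k :=
  ObjectProperty.homMk
    { app := fun _ => AddCommGrpCat.ofHom (Form.scale a)
      naturality := fun _ _ i => by
        ext θ; rfl }

lemma dHom_dHom (k : ℕ) : dHom m M k ≫ dHom m M (k + 1) = 0 := by
  refine sheafHom_ext _ _ fun V θ => ?_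
  exact Form.d_d θ

lemma dlogHom_dHom : dlogHom m M ≫ dHom m M 1 = 0 := by
  refine sheafHom_ext _ _ fun V θ => ?_
  exact d_dlog θ.toMul

lemma inclHom_dHom (p : ℕ) : inclHom m M p ≫ dHom m M 0 = 0 := by
  refine sheafHom_ext _ _ fun V θ => ?_
  exact ZFun.d_toForm m M θ

lemma expHom_dlogHom (a : ℂ) : expHom m M a ≫ dlogHom m M = dHom m M 0 ≫ scaleHom m M a 1 := by
  refine sheafHom_ext _ _ fun V θ => ?_
  exact Form.dlog_exp a θ

lemma scaleHom_dHom (a : ℂ) (k : ℕ) :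
    scaleHom m M a k ≫ dHom m M k = dHom m M k ≫ scaleHom m M a (k + 1) := by
  refine sheafHom_ext _ _ fun V θ => ?_
  exact Form.d_scale a θ

lemma inclHom_expHom (p : ℕ) (a : ℂ) 
    (h : a * (2 * Real.pi * Complex.I) ^ p = 2 * Real.pi * Complex.I) :
    inclHom m M p ≫ expHom m M a = 0 := by
  refine sheafHom_ext _ _ fun V f => ?_
  change Additive.ofMul (Form.exp a (ZFun.toForm m M f)) = 0
  change Form.exp a (ZFun.toForm m M f) = 1
  ext x
  obtain ⟨n, hn⟩ := AddSubgroup.mem_zmultiples_iff.1 (f.2.2 x)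
  change Complex.exp (a * f.1 x) = 1
  rw [← hn, zsmul_eq_mul, mul_left_comm, h]
  exact Complex.exp_int_mul_two_pi_mul_I n

/-! ### The complexes of sheaves -/

open ZeroObject

/-- The terms of the complex `ℂˣ → A^1 → A^2`. -/
def cxX : ℤ → TopCat.Sheaf AddCommGrpCat.{u} (TopCat.of M)
  | 0 => cxSheaf m M
  | 1 => formSheaf m M 1
  | 2 => formSheaf m M 2
  | _ => 0

/-- The differentials of the complex `ℂˣ → A^1 → A^2`. -/
def cxD : ∀ n : ℤ, cxX m M n ⟶ cxX m M (n + 1)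
  | 0 => dlogHom m M
  | 1 => dHom m M 1
  | _ => 0

/-- The complex of sheaves `ℂˣ → A^1 → A^2` in degrees `0, 1, 2`. -/
def cxComplex : CochainComplex (TopCat.Sheaf AddCommGrpCat.{u} (TopCat.of M)) ℤ :=
  CochainComplex.of (cxX m M) (cxD m M) fun n => by
    match n with
    | 0 => exact dlogHom_dHom m M
    | .ofNat 1 => exact comp_zero
    | .ofNat (n + 2) => exact zero_comp
    | .negSucc n => exact zero_comp

/-- The terms of the complex `ℤ(3) → A^0 → A^1 → A^2`. -/
def deligneX : ℤ → TopCat.Sheaf AddCommGrpCat.{u} (TopCat.of M)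
  | 0 => zSheaf 3 M
  | 1 => formSheaf m M 0
  | 2 => formSheaf m M 1
  | 3 => formSheaf m M 2
  | _ => 0

/-- The differentials of the complex `ℤ(3) → A^0 → A^1 → A^2`. -/
def deligneD : ∀ n : ℤ, deligneX m M n ⟶ deligneX m M (n + 1)
  | 0 => inclHom m M 3
  | 1 => dHom m M 0
  | 2 => dHom m M 1
  | _ => 0

/-- The smooth Deligne complex `ℤ(3) → A^0 → A^1 → A^2` in degrees `0, 1, 2, 3`. -/
def deligneComplex : CochainComplex (TopCat.Sheaf AddCommGrpCat.{u} (TopCat.of M)) ℤ :=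
  CochainComplex.of (deligneX m M) (deligneD m M) fun n => by
    match n with
    | 0 => exact inclHom_dHom m M 3
    | .ofNat 1 => exact dHom_dHom m M 0
    | .ofNat 2 => exact comp_zero
    | .ofNat (n + 3) => exact zero_comp
    | .negSucc n => exact zero_comp

instance : (cxComplex m M).IsStrictlyGE 0 := by
  rw [CochainComplex.isStrictlyGE_iff]
  intro i hi
  match i, hi with
  | .negSucc n, _ => exact Limits.isZero_zero _

instance : (deligneComplex m M).IsStrictlyGE 0 := by
  rw [CochainComplex.isStrictlyGE_iff]
  intro i hi
  match i, hi with
  | .negSucc n, _ => exact Limits.isZero_zero _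

end SheafMorphisms

section Shift

variable {C : Type*} [Category C] [Limits.HasZeroMorphisms C]

/-- Reindexing of a cochain complex by `a`, without signs in the differential. -/
def reindex (K : CochainComplex C ℤ) (a : ℤ) : CochainComplex C ℤ where
  X n := K.X (n + a)
  d i j := K.d (i + a) (j + a)
  shape i j h := K.shape _ _ fun h' => h (by simp only [ComplexShape.up_Rel] at *; lia)
  d_comp_d' _ _ _ _ _ := K.d_comp_d _ _ _

/-- Reindexing of a morphism of complexes. -/
def reindexMap {K L : CochainComplex C ℤ} (φ : K ⟶ L) (a : ℤ) : reindex K a ⟶ reindex L a where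
  f n := φ.f (n + a)
  comm' _ _ _ := φ.comm _ _

end Shift

section ExpMap

variable (m : ℕ) (M : Type u) [TopologicalSpace M] [ChartedSpace (Euc m) M]
  [IsManifold 𝓘(ℝ, Euc m) ∞ M]

/-- The components of `expMap`. -/
def expComponent : ∀ n : ℤ, (deligneComplex m M).X n ⟶ (reindex (cxComplex m M) (-1)).X n
  | 1 => expHom m M ((2 * Real.pi * Complex.I) ^ (-2 : ℤ))
  | 2 => scaleHom m M ((2 * Real.pi * Complex.I) ^ (-2 : ℤ)) 1
  | 3 => scaleHom m M ((2 * Real.pi * Complex.I) ^ (-2 : ℤ)) 2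
  | _ => 0

lemma twoPiI : ((2 * Real.pi * Complex.I : ℂ) ^ (-2 : ℤ)) * (2 * Real.pi * Complex.I) ^ 3 =
    2 * Real.pi * Complex.I := by
  have h : (2 * Real.pi * Complex.I : ℂ) ≠ 0 := Complex.two_pi_I_ne_zero
  field_simp

/-- The morphism from `ℤ(3) → A^0 → A^1 → A^2` to `ℂˣ → A^1 → A^2` placed in degrees `1, 2, 3`, given
by `f ↦ exp ((2πi)^(-2) f)` on functions and by multiplication by `(2πi)^(-2)` on 1- and 2-forms. -/
def expMap : deligneComplex m M ⟶ reindex (cxComplex m M) (-1) where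
  f := expComponent m M
  comm' i j hij := by
    obtain rfl : i + 1 = j := hij
    have h1 : (deligneComplex m M).d i (i + 1) = deligneD m M i := CochainComplex.of_d ..
    have h2 : (reindex (cxComplex m M) (-1)).d i (i + 1) =
      CochainComplex.of.d (cxX m M) (cxD m M) (i + (-1)) (i + 1 + (-1)) := rfl
    rw [h1, h2]
    have key : ∀ k : ℤ, CochainComplex.of.d (cxX m M) (cxD m M) k (k + 1) = cxD m M k :=
      fun k => CochainComplex.of_d _ _ k
    match i with
    | .negSucc n => exact zero_comp.trans zero_comp.symm
    | 0 =>
      refine zero_comp.trans ?_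
      exact (inclHom_expHom m M 3 _ twoPiI).symm
    | .ofNat 1 =>
      exact (congrArg (expHom m M _ ≫ ·) (key 0)).trans (expHom_dlogHom m M _)
    | .ofNat 2 =>
      exact (congrArg (scaleHom m M _ 1 ≫ ·) (key 1)).trans (scaleHom_dHom m M _ 1)
    | .ofNat 3 =>
      exact ((congrArg (scaleHom m M _ 2 ≫ ·) (key 2)).trans comp_zero).trans zero_comp.symm
    | .ofNat (n + 4) => exact zero_comp.trans zero_comp.symm

end ExpMap

section Cohomology

variable {X : TopCat.{u}}

/-- The group of sections of `F` over `V`. -/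
abbrev Sec (F : TopCat.Sheaf AddCommGrpCat.{u} X) (V : Opens X) : Type u := F.obj.obj (op V)

/-- Restriction of sections. -/
def secRes (F : TopCat.Sheaf AddCommGrpCat.{u} X) {V W : Opens X} (h : W ≤ V) :
    Sec F V →+ Sec F W := (F.obj.map (homOfLE h).op).hom

/-- A morphism of sheaves on sections. -/
def secMap {F G : TopCat.Sheaf AddCommGrpCat.{u} X} (φ : F ⟶ G) (V : Opens X) :
    Sec F V →+ Sec G V := (φ.hom.app (op V)).hom

/-! ### Hypercohomology -/

/-- The `n`-cocycles of the complex `Γ(X, T)` of global sections. -/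
def globalCocycles (T : CochainComplex (TopCat.Sheaf AddCommGrpCat.{u} X) ℤ) (n : ℤ) :
    AddSubgroup (Sec (T.X n) ⊤) := (secMap (T.d n (n + 1)) ⊤).ker

/-- The `n`-coboundaries of the complex `Γ(X, T)` of global sections. -/
def globalCoboundaries (T : CochainComplex (TopCat.Sheaf AddCommGrpCat.{u} X) ℤ) (n : ℤ) :
    AddSubgroup (Sec (T.X n) ⊤) := (secMap (T.d (n - 1) n) ⊤).range

/-- The cohomology `H^n(Γ(X, T))` of the complex of global sections. -/
abbrev GlobalCohomology (T : CochainComplex (TopCat.Sheaf AddCommGrpCat.{u} X) ℤ) (n : ℤ) : Type u :=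
  globalCocycles T n ⧸ (globalCoboundaries T n).addSubgroupOf (globalCocycles T n)

/-- A quasi-isomorphism `aug : K ⟶ T` into a complex of injective sheaves in degrees `≥ 0`. -/
structure InjRes (K : CochainComplex (TopCat.Sheaf AddCommGrpCat.{u} X) ℤ) where
  T : CochainComplex (TopCat.Sheaf AddCommGrpCat.{u} X) ℤ
  aug : K ⟶ T
  quasiIso : QuasiIso aug
  injective : ∀ n, Injective (T.X n)
  bounded : T.IsStrictlyGE 0

instance (K : CochainComplex (TopCat.Sheaf AddCommGrpCat.{u} X) ℤ) [K.IsStrictlyGE 0] :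
    Nonempty (InjRes K) := by
  obtain ⟨T, i, hi, hT, hb⟩ :=
    CochainComplex.Plus.modelCategoryQuillen.exists_quasiIso_injective K 0
  exact ⟨⟨T, i, hi, hT, hb⟩⟩

/-- A chosen injective resolution. -/
def injRes (K : CochainComplex (TopCat.Sheaf AddCommGrpCat.{u} X) ℤ) [K.IsStrictlyGE 0] :
    InjRes K := Classical.choice inferInstance

/-- The hypercohomology `ℍ^n(X, K)`: the cohomology of the global sections of an injective
resolution of `K`. -/
abbrev Hypercohomology (K : CochainComplex (TopCat.Sheaf AddCommGrpCat.{u} X) ℤ)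
    [K.IsStrictlyGE 0] (n : ℤ) : Type u :=
  GlobalCohomology (injRes K).T n

/-- `θ : ℍ^n(X, K) → ℍ^{n+a}(X, L)` is induced by the morphism of complexes `φ : K ⟶ L[a]`:
it is given on global sections by an extension `g` of `φ` to the injective resolutions. -/
def IsInducedBy {K L : CochainComplex (TopCat.Sheaf AddCommGrpCat.{u} X) ℤ}
    [K.IsStrictlyGE 0] [L.IsStrictlyGE 0] {a : ℤ} (φ : K ⟶ reindex L a) (n : ℤ)
    (θ : Hypercohomology K n → Hypercohomology L (n + a)) : Prop :=
  ∃ g : (injRes K).T ⟶ reindex (injRes L).T a,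
    Nonempty (Homotopy ((injRes K).aug ≫ g) (φ ≫ reindexMap (injRes L).aug a)) ∧
    ∀ (t : globalCocycles (injRes K).T n) (t' : globalCocycles (injRes L).T (n + a)),
      secMap (g.f n) ⊤ t.1 = t'.1 → θ (QuotientAddGroup.mk t) = QuotientAddGroup.mk t'

/-! ### The Čech complex of a complex of sheaves -/

variable {ι : Type v} (U : ι → Opens X)

/-- The intersection `U_{σ 0} ∩ ⋯ ∩ U_{σ p}`. -/
def cechOpen {p : ℕ} (σ : Fin (p + 1) → ι) : Opens X := ⨅ j, U (σ j)

lemma cechOpen_le {p : ℕ} (σ : Fin (p + 1) → ι) (j : Fin (p + 1)) : cechOpen U σ ≤ U (σ j) :=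
  iInf_le _ j

lemma cechOpen_single_le (α : ι) : cechOpen U ![α] ≤ U α := cechOpen_le U ![α] 0

lemma cechOpen_pair_le (α β : ι) : cechOpen U ![α, β] ≤ U α ⊓ U β :=
  le_inf (cechOpen_le U ![α, β] 0) (cechOpen_le U ![α, β] 1)

lemma cechOpen_triple_le (α β γ : ι) : cechOpen U ![α, β, γ] ≤ U α ⊓ U β ⊓ U γ :=
  le_inf (le_inf (cechOpen_le U ![α, β, γ] 0) (cechOpen_le U ![α, β, γ] 1))
    (cechOpen_le U ![α, β, γ] 2)

lemma cechOpen_face {p : ℕ} (σ : Fin (p + 2) → ι) (j : Fin (p + 2)) :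
    cechOpen U σ ≤ cechOpen U (σ ∘ j.succAbove) :=
  le_iInf fun _ => cechOpen_le U σ _

/-- The Čech differential
`(δ c)(α_0, …, α_{p+1}) = ∑_j (-1)^j c(α_0, …, α_{j-1}, α_{j+1}, …, α_{p+1})`. -/
def cechDelta (F : TopCat.Sheaf AddCommGrpCat.{u} X) {p : ℕ}
    (c : ∀ σ : Fin (p + 1) → ι, Sec F (cechOpen U σ)) (σ : Fin (p + 2) → ι) :
    Sec F (cechOpen U σ) :=
  ∑ j : Fin (p + 2), (-1 : ℤ) ^ (j : ℕ) • secRes F (cechOpen_face U σ j) (c (σ ∘ j.succAbove))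

/-- Families of elements of all the groups `C^p(U, K^q)` of the Čech double complex. -/
abbrev CechFamily (K : CochainComplex (TopCat.Sheaf AddCommGrpCat.{u} X) ℤ) : Type (max u v) :=
  ∀ (p : ℕ) (q : ℤ) (σ : Fin (p + 1) → ι), Sec (K.X q) (cechOpen U σ)

/-- The contribution of the Čech differential to the component of bidegree `(p, q)`. -/
def cechDeltaPart (K : CochainComplex (TopCat.Sheaf AddCommGrpCat.{u} X) ℤ) (c : CechFamily U K) :
    CechFamily U K
  | 0, _ => fun _ => 0
  | p + 1, q => cechDelta U (K.X q) (c p q)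

/-- The total differential of the Čech double complex, equal to `d + (-1)^q δ` on `C^p(U, K^q)`. -/
def totalD (K : CochainComplex (TopCat.Sheaf AddCommGrpCat.{u} X) ℤ) :
    CechFamily U K →+ CechFamily U K :=
  AddMonoidHom.mk' (fun c p q σ => secMap (K.d (q - 1) q) _ (c p (q - 1) σ) +
    (q.negOnePow : ℤ) • cechDeltaPart U K c p q σ) fun a b => by
      funext p q σ
      have h : cechDeltaPart U K (a + b) p q σ =
          cechDeltaPart U K a p q σ + cechDeltaPart U K b p q σ := by
        cases p with
        | zero => exact (add_zero _).symm
        | succ p =>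
          simp only [cechDeltaPart, cechDelta, Pi.add_apply, map_add, smul_add,
            Finset.sum_add_distrib]
      simp only [h, Pi.add_apply, map_add, smul_add]
      abel

/-- The cochains of total degree `n`. -/
def cechCochains (K : CochainComplex (TopCat.Sheaf AddCommGrpCat.{u} X) ℤ) (n : ℤ) :
    AddSubgroup (CechFamily U K) where
  carrier := {c | ∀ (p : ℕ) (q : ℤ), (p : ℤ) + q ≠ n → c p q = 0}
  zero_mem' := fun _ _ _ => rfl
  add_mem' := fun ha hb p q h => by
    rw [Pi.add_apply, Pi.add_apply, ha p q h, hb p q h, add_zero]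
  neg_mem' := fun ha p q h => by
    rw [Pi.neg_apply, Pi.neg_apply, ha p q h, neg_zero]

/-- The `n`-cocycles of the total Čech complex `Č(U, K)`. -/
def cechCocycles (K : CochainComplex (TopCat.Sheaf AddCommGrpCat.{u} X) ℤ) (n : ℤ) :
    AddSubgroup (CechFamily U K) := cechCochains U K n ⊓ (totalD U K).ker

/-- The `n`-coboundaries of the total Čech complex `Č(U, K)`. -/
def cechCoboundaries (K : CochainComplex (TopCat.Sheaf AddCommGrpCat.{u} X) ℤ) (n : ℤ) :
    AddSubgroup (CechFamily U K) := (cechCochains U K (n - 1)).map (totalD U K)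

/-- The Čech hypercohomology `H^n Č(U, K)`. -/
abbrev CechCohomology (K : CochainComplex (TopCat.Sheaf AddCommGrpCat.{u} X) ℤ) (n : ℤ) :
    Type (max u v) :=
  cechCocycles U K n ⧸ (cechCoboundaries U K n).addSubgroupOf (cechCocycles U K n)

/-- The map of Čech cochains induced by a morphism of complexes of sheaves. -/
def cechMap {K L : CochainComplex (TopCat.Sheaf AddCommGrpCat.{u} X) ℤ} (φ : K ⟶ L)
    (c : CechFamily U K) : CechFamily U L :=
  fun p q σ => secMap (φ.f q) _ (c p q σ)

/-- A global section of `T^n` regarded as a Čech cochain of bidegree `(0, n)`. -/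
def cechAug (T : CochainComplex (TopCat.Sheaf AddCommGrpCat.{u} X) ℤ) {n : ℤ}
    (t : Sec (T.X n) ⊤) : CechFamily U T :=
  fun p q _ => if p = 0 then
    secRes (T.X q) le_top ((Pi.single n t : ∀ q, Sec (T.X q) ⊤) q) else 0

/-- `κ` is the canonical map from Čech to sheaf hypercohomology: for an injective resolution
`K ⟶ T`, the class of a Čech cocycle `c` of `K` is sent to the class of a cocycle `t` of `Γ(X, T)`
exactly when `c` and `t` become cohomologous in `Č(U, T)`. -/
def IsCechComparison (K : CochainComplex (TopCat.Sheaf AddCommGrpCat.{u} X) ℤ) [K.IsStrictlyGE 0]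
    (n : ℤ) (κ : CechCohomology U K n → Hypercohomology K n) : Prop :=
  ∀ (c : cechCocycles U K n) (t : globalCocycles (injRes K).T n),
    κ (QuotientAddGroup.mk c) = QuotientAddGroup.mk t ↔
      cechMap U (injRes K).aug c.1 - cechAug U (injRes K).T t.1 ∈
        cechCoboundaries U (injRes K).T n

/-- A Leray cover: the members of the cover and all their non-empty finite intersections are
contractible. -/
structure IsLerayCover : Prop where
  iSup_eq_top : ⨆ i, U i = ⊤
  contractible : ∀ (p : ℕ) (σ : Fin (p + 1) → ι), (cechOpen U σ : Set X).Nonempty →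
    ContractibleSpace (cechOpen U σ)

end Cohomology

section BFields

variable {m : ℕ} {M : Type u} [TopologicalSpace M] [ChartedSpace (Euc m) M]
  [IsManifold 𝓘(ℝ, Euc m) ∞ M] {ι : Type v}

/-- A `B`-field on `M` given on the cover `U`: 2-forms `B α` on `U_α`, 1-forms `A α β` on
`U_αβ` and functions `h α β γ : U_αβγ → ℂˣ`, for all indices. -/
@[ext]
structure BField (m : ℕ) {M : Type u} [TopologicalSpace M] [ChartedSpace (Euc m) M]
    [IsManifold 𝓘(ℝ, Euc m) ∞ M] {ι : Type v} (U : ι → Opens M) where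
  h : ∀ α β γ, CxFun m (U α ⊓ U β ⊓ U γ)
  A : ∀ α β, Form m 1 (U α ⊓ U β)
  B : ∀ α, Form m 2 (U α)
  /-- `B_α - B_β = d A_αβ` on `U_αβ` -/
  curving : ∀ α β, Form.res inf_le_left (B α) - Form.res inf_le_right (B β) = Form.d (A α β)
  /-- `A_αβ + A_βγ - A_αγ = d log h_αβγ` on `U_αβγ` -/
  connection : ∀ α β γ,
    Form.res (W := U α ⊓ U β ⊓ U γ) (by order) (A α β) + Form.res (by order) (A β γ)
      - Form.res (by order) (A α γ) = dlog (h α β γ)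
  /-- `h_αβγ⁻¹ h_αβν h_αγν⁻¹ h_βγν = 1` on `U_αβγν` -/
  cocycle : ∀ α β γ ν,
    (CxFun.res (W := U α ⊓ U β ⊓ U γ ⊓ U ν) (by order) (h α β γ))⁻¹ *
      CxFun.res (by order) (h α β ν) * (CxFun.res (by order) (h α γ ν))⁻¹ *
      CxFun.res (by order) (h β γ ν) = 1

/-- An isomorphism of `B`-fields, given by functions `f α β : U_αβ → ℂˣ` and 1-forms `a α`. -/
def BField.Isomorphic {U : ι → Opens M} (b b' : BField m U) : Prop :=
  ∃ (f : ∀ α β, CxFun m (U α ⊓ U β)) (a : ∀ α, Form m 1 (U α)),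
    (∀ α β γ, b'.h α β γ = b.h α β γ * (CxFun.res (by order) (f β γ) *
      (CxFun.res (by order) (f α γ))⁻¹ * CxFun.res (by order) (f α β))) ∧
    (∀ α β, b'.A α β = b.A α β + dlog (f α β) + Form.res inf_le_left (a α)
      - Form.res inf_le_right (a β)) ∧
    ∀ α, b'.B α = b.B α + Form.d (a α)

lemma dlog_one {V : Opens M} : dlog (1 : CxFun m V) = 0 := by
  have := dlog_mul (1 : CxFun m V) 1
  rw [mul_one] at this
  exact left_eq_add.1 this

lemma dlog_inv {V : Opens M} (f : CxFun m V) : dlog f⁻¹ = -dlog f := by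
  have := dlog_mul f⁻¹ f
  rw [inv_mul_cancel, dlog_one] at this
  exact eq_neg_of_add_eq_zero_left this.symm

lemma comm_aux {G : Type*} [CommGroup G] (w x y z x' y' z' : G) :
    w * (x * y⁻¹ * z) * (x' * y'⁻¹ * z') = w * (x * x' * (y * y')⁻¹ * (z * z')) := by
  rw [mul_inv]; ac_rfl

/-- The isomorphism relation on `B`-fields. -/
def BField.setoid (m : ℕ) {M : Type u} [TopologicalSpace M] [ChartedSpace (Euc m) M]
    [IsManifold 𝓘(ℝ, Euc m) ∞ M] {ι : Type v} (U : ι → Opens M) : Setoid (BField m U) where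
  r := BField.Isomorphic
  iseqv :=
    { refl := fun b => ⟨fun _ _ => 1, fun _ => 0, by simp, by simp [dlog_one], by simp⟩
      symm := by
        rintro b b' ⟨f, a, h1, h2, h3⟩
        refine ⟨fun α β => (f α β)⁻¹, fun α => -a α, fun α β γ => ?_, fun α β => ?_, fun α => ?_⟩
        · rw [h1, map_inv, map_inv, map_inv, mul_assoc]
          simp only [← mul_inv, mul_inv_cancel, mul_one]
        · rw [h2, dlog_inv, map_neg, map_neg]; abel
        · rw [h3, map_neg]; abel
      trans := by
        rintro b b' b'' ⟨f, a, h1, h2, h3⟩ ⟨f', a', h1', h2', h3'⟩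
        refine ⟨fun α β => f α β * f' α β, fun α => a α + a' α, fun α β γ => ?_, fun α β => ?_,
          fun α => ?_⟩
        · rw [h1', h1, map_mul, map_mul, map_mul]
          exact comm_aux _ _ _ _ _ _ _
        · rw [h2', h2, dlog_mul, map_add, map_add]; abel
        · rw [h3', h3, map_add]; abel }

/-- The set of isomorphism classes of `B`-fields given on the cover `U`. -/
abbrev BField.IsoClass (m : ℕ) {M : Type u} [TopologicalSpace M] [ChartedSpace (Euc m) M]
    [IsManifold 𝓘(ℝ, Euc m) ∞ M] {ι : Type v} (U : ι → Opens M) : Type (max u v) :=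
  Quotient (BField.setoid m U)

/-- Sections of the degree `0` term of `ℂˣ → A^1 → A^2` are functions. -/
def cxSec (V : Opens M) (s : Sec (X := TopCat.of M) ((cxComplex m M).X 0) V) : CxFun m V :=
  Additive.toMul (α := CxFun m V) s

/-- Sections of the degree `1` term of `ℂˣ → A^1 → A^2` are 1-forms. -/
def oneSec (V : Opens M) (s : Sec (X := TopCat.of M) ((cxComplex m M).X 1) V) : Form m 1 V := s

/-- Sections of the degree `2` term of `ℂˣ → A^1 → A^2` are 2-forms. -/
def twoSec (V : Opens M) (s : Sec (X := TopCat.of M) ((cxComplex m M).X 2) V) : Form m 2 V := s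

/-- The components of the Čech family `c` in the bidegrees `(2, 0)`, `(1, 1)`, `(0, 2)` are the
functions `h`, the 1-forms `A` and the 2-forms `B` of the `B`-field `b`. -/
def BField.HasComponents {U : ι → Opens M} (b : BField m U)
    (c : CechFamily (X := TopCat.of M) U (cxComplex m M)) : Prop :=
  (∀ α β γ, cxSec _ (c 2 0 ![α, β, γ]) =
    CxFun.res (cechOpen_triple_le (X := TopCat.of M) U α β γ) (b.h α β γ)) ∧
  (∀ α β, oneSec _ (c 1 1 ![α, β]) =
    Form.res (cechOpen_pair_le (X := TopCat.of M) U α β) (b.A α β)) ∧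
  ∀ α, twoSec _ (c 0 2 ![α]) = Form.res (cechOpen_single_le (X := TopCat.of M) U α) (b.B α)

end BFields
end BFieldClassification

end

open BFieldClassification

set_option linter.unusedSectionVars false

noncomputable section

namespace BFieldClassification

universe w

/-! ### Alternating double sums -/

/-! The statement about cocycles is bookkeeping. The complex `ℂˣ → A¹ → A²` lives in degrees 0, 1,
2, so a Čech 2-cochain is exactly a triple (h, A, B). The components of its total differential are
the three equations of a B-field, and the total differential of a 1-cochain (f, a) is the change of
(h, A, B) under an isomorphism (`exists_bfield_equiv`, `BField.HasComponents.isomorphic_iff`).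

For the comparison with hypercohomology let K → T be the injective resolution. An injective sheaf is
a retract of a sheaf of arbitrary stalk-valued functions, so its augmented Čech complex is exact,
and Γ(M, T) computes the cohomology of Č(U, T) (`exists_aug_add_totalD`). On the other side the
mapping cone of K → T is an exact complex of sheaves. Its sections over V stay exact in degrees ≤ 2
as soon as H^k(V, K^i) = 0 for k ≥ 1 and i + k ≤ 2 (`coneExact_of_vanishes`). Solving on every
intersection, column by column, compares Č(U, K) with Č(U, T) (`exists_of_cone_cocycle`). Together
these show that "becoming cohomologous in Č(U, T)" is a correspondence inducing an isomorphism
(`exists_cech_comparison`).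

What remains is the vanishing, over a contractible open V, of H¹(A¹), H¹(ℂˣ) and H²(ℂˣ), where
cohomology means Ext out of the free abelian sheaf on V. Such a V is connected, hence second
countable, and smooth partitions of unity with Cartan's criterion `CechAcyclic.vanishes` dispose of
the sheaves of forms. The exponential sequence then reduces ℂˣ to H² and H³ of ℤ(3).

Here contractibility enters. The constant sheaf is resolved by normalized Alexander–Spanier
cochains, germs along the diagonal of functions of several points. These sheaves are Čech acyclic
because sections can be patched along a locally finite choice of indices. A contraction of V is cut
into steps so small that consecutive maps send a neighbourhood of each point into one set on which a
given cocycle is closed (`exists_small_steps`). The prism operators of consecutive maps then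
telescope to a primitive (`Prism.exists_primitive`), and dimension shifting gives the vanishing of
H² and H³.

For the last statement, the morphism `expMap` is an epimorphism in every degree, with kernel the
acyclic complex ℤ(3) = ℤ(3) in degrees 0, 1. It is therefore a quasi-isomorphism and extends to a
homotopy equivalence of injective resolutions. -/

lemma sum_sum_succAbove {G : Type*} [AddCommGroup G] {n : ℕ}
    (F : (Fin (n + 1) → Fin (n + 3)) → G) :
    ∑ j : Fin (n + 3), ∑ i : Fin (n + 2),
      ((-1 : ℤ) ^ (j : ℕ) * (-1) ^ (i : ℕ)) • F (j.succAbove ∘ i.succAbove) = 0 := by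
  rw [← Finset.sum_product']
  -- Removing two positions in either order gives the same face with opposite signs; this involution
  -- exchanges the two orders.
  refine Finset.sum_involution (fun x _ => (x.1.succAbove x.2, x.2.predAbove x.1)) ?_ ?_ ?_ ?_
  · rintro ⟨j, i⟩ -
    have h1 : (j.succAbove i).succAbove ∘ (i.predAbove j).succAbove =
        j.succAbove ∘ i.succAbove :=
      funext fun k => Fin.succAbove_succAbove_succAbove_predAbove j i k
    dsimp only
    rw [h1, ← add_smul]
    convert zero_smul ℤ _
    have h2 := Fin.neg_one_pow_succAbove_add_predAbove (R := ℤ) j i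
    rw [pow_add, pow_add] at h2
    rw [h2]; ring
  · rintro ⟨j, i⟩ - - h
    exact Fin.succAbove_ne j i (congrArg Prod.fst h)
  · simp
  · rintro ⟨j, i⟩ -
    refine Prod.ext ?_ ?_
    · exact Fin.succAbove_succAbove_predAbove j i
    · exact Fin.predAbove_predAbove_succAbove j i

/-! ### Sections of sheaves: restriction, locality and gluing -/

section Sections

variable {X : TopCat.{u}} {F G H : TopCat.Sheaf AddCommGrpCat.{u} X}

lemma secRes_secRes {V W Z : Opens X} (h : W ≤ V) (h' : Z ≤ W) (s : Sec F V) :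
    secRes F h' (secRes F h s) = secRes F (h'.trans h) s := by
  simp only [secRes]
  rw [← ConcreteCategory.comp_apply, ← F.obj.map_comp]
  rfl

lemma secRes_self {V : Opens X} (h : V ≤ V) (s : Sec F V) : secRes F h s = s := by
  have : (homOfLE h).op = 𝟙 (op V) := rfl
  simp only [secRes, this, F.obj.map_id]
  rfl

lemma secMap_secRes (φ : F ⟶ G) {V W : Opens X} (h : W ≤ V) (s : Sec F V) :
    secMap φ W (secRes F h s) = secRes G h (secMap φ V s) :=
  ConcreteCategory.congr_hom (φ.hom.naturality (homOfLE h).op) s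

lemma secMap_comp (φ : F ⟶ G) (ψ : G ⟶ H) (V : Opens X) (s : Sec F V) :
    secMap (φ ≫ ψ) V s = secMap ψ V (secMap φ V s) := rfl

lemma secMap_id (V : Opens X) (s : Sec F V) : secMap (𝟙 F) V s = s := rfl

lemma secMap_zero (V : Opens X) (s : Sec F V) : secMap (0 : F ⟶ G) V s = 0 := rfl

lemma secMap_add (φ ψ : F ⟶ G) (V : Opens X) (s : Sec F V) :
    secMap (φ + ψ) V s = secMap φ V s + secMap ψ V s := rfl

lemma secMap_neg (φ : F ⟶ G) (V : Opens X) (s : Sec F V) :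
    secMap (-φ) V s = -secMap φ V s := rfl

/-- Sections of a sheaf which agree locally are equal. -/
lemma sec_ext {V : Opens X} {s t : Sec F V}
    (h : ∀ x ∈ V, ∃ (W : Opens X) (i : W ≤ V), x ∈ W ∧ secRes F i s = secRes F i t) : s = t := by
  choose! W i hx hW using h
  refine F.eq_of_locally_eq' (fun x : V => W x) V (fun x => homOfLE (i x x.2)) ?_ s t
    fun x => hW x x.2
  intro x hxV
  exact Opens.mem_iSup.2 ⟨⟨x, hxV⟩, hx x hxV⟩

/-- Gluing of sections. -/
lemma sec_glue {ι : Type v} (U : ι → Opens X) (V : Opens X) (hU : ∀ i, U i ≤ V)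
    (hV : V ≤ ⨆ i, U i) (s : ∀ i, Sec F (U i))
    (hs : ∀ i j, secRes F inf_le_left (s i) = secRes F (inf_le_right (a := U i) (b := U j)) (s j)) :
    ∃ t : Sec F V, ∀ i, secRes F (hU i) t = s i := by
  have hc : ∀ x : V, ∃ i, x.1 ∈ U i := fun x => Opens.mem_iSup.1 (hV x.2)
  choose i hi using hc
  obtain ⟨t, ht, -⟩ := F.existsUnique_gluing' (fun x : V => U (i x)) V
    (fun x => homOfLE (hU (i x))) (fun x hx => Opens.mem_iSup.2 ⟨⟨x, hx⟩, hi ⟨x, hx⟩⟩)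
    (fun x => s (i x)) (fun x y => hs (i x) (i y))
  refine ⟨t, fun j => sec_ext fun x hx => ⟨U (i ⟨x, hU j hx⟩) ⊓ U j, inf_le_right,
    ⟨hi _, hx⟩, ?_⟩⟩
  rw [secRes_secRes, ← hs]
  have := ht ⟨x, hU j hx⟩
  rw [← this]
  exact (secRes_secRes (F := F) (hU _) inf_le_left t).symm

end Sections

/-! ### The Čech complex of a sheaf and its contraction by splittings -/

section Cech

variable {X : TopCat.{u}} {ι : Type v} (U : ι → Opens X)
  {F G : TopCat.Sheaf AddCommGrpCat.{u} X}

/-- A cochain only depends on its index. -/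
lemma cech_congr {p : ℕ} (c : ∀ σ : Fin (p + 1) → ι, Sec F (cechOpen U σ))
    {σ τ : Fin (p + 1) → ι} (h : σ = τ) {W : Opens X} (h1 : W ≤ cechOpen U σ)
    (h2 : W ≤ cechOpen U τ) : secRes F h1 (c σ) = secRes F h2 (c τ) := by
  subst h; rfl

lemma secRes_cechDelta {p : ℕ} (c : ∀ σ : Fin (p + 1) → ι, Sec F (cechOpen U σ))
    (σ : Fin (p + 2) → ι) {W : Opens X} (h : W ≤ cechOpen U σ) :
    secRes F h (cechDelta U F c σ) = ∑ j : Fin (p + 2), (-1 : ℤ) ^ (j : ℕ) •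
      secRes F (h.trans (cechOpen_face U σ j)) (c (σ ∘ j.succAbove)) := by
  simp only [cechDelta, map_sum, map_zsmul, secRes_secRes]

lemma cechOpen_le_comp {p q : ℕ} (σ : Fin (p + 1) → ι) (f : Fin (q + 1) → Fin (p + 1)) :
    cechOpen U σ ≤ cechOpen U (σ ∘ f) := le_iInf fun _ => cechOpen_le U σ _

lemma cechDelta_cechDelta {p : ℕ} (c : ∀ σ : Fin (p + 1) → ι, Sec F (cechOpen U σ)) :
    cechDelta U F (cechDelta U F c) = 0 := by
  funext σ
  change ∑ j : Fin (p + 3), (-1 : ℤ) ^ (j : ℕ) • secRes F _ (cechDelta U F c _) = 0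
  rw [← sum_sum_succAbove fun f => secRes F (cechOpen_le_comp U σ f) (c (σ ∘ f))]
  refine Finset.sum_congr rfl fun j _ => ?_
  rw [secRes_cechDelta, Finset.smul_sum]
  refine Finset.sum_congr rfl fun i _ => ?_
  rw [mul_smul]
  rfl

lemma cechDelta_secMap (φ : F ⟶ G) {p : ℕ} (c : ∀ σ : Fin (p + 1) → ι, Sec F (cechOpen U σ)) :
    cechDelta U G (fun σ => secMap φ _ (c σ)) = fun σ => secMap φ _ (cechDelta U F c σ) := by
  funext σ
  simp only [cechDelta, map_sum, map_zsmul, secMap_secRes]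

lemma cechDelta_add {p : ℕ} (c c' : ∀ σ : Fin (p + 1) → ι, Sec F (cechOpen U σ)) :
    cechDelta U F (c + c') = cechDelta U F c + cechDelta U F c' := by
  funext σ
  simp only [cechDelta, Pi.add_apply, map_add, smul_add, Finset.sum_add_distrib]

lemma cechDelta_zero {p : ℕ} :
    cechDelta U F (0 : ∀ σ : Fin (p + 1) → ι, Sec F (cechOpen U σ)) = 0 := by
  funext σ
  simp [cechDelta]

lemma cechDelta_neg {p : ℕ} (c : ∀ σ : Fin (p + 1) → ι, Sec F (cechOpen U σ)) :
    cechDelta U F (-c) = -cechDelta U F c := by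
  rw [eq_neg_iff_add_eq_zero, ← cechDelta_add, neg_add_cancel, cechDelta_zero]

lemma cechDelta_sub {p : ℕ} (c c' : ∀ σ : Fin (p + 1) → ι, Sec F (cechOpen U σ)) :
    cechDelta U F (c - c') = cechDelta U F c - cechDelta U F c' := by
  rw [sub_eq_add_neg, cechDelta_add, cechDelta_neg, sub_eq_add_neg]

/-- A `0`-cocycle of the Čech complex glues. -/
lemma exists_glue_of_cechDelta_eq_zero (c : ∀ σ : Fin 1 → ι, Sec F (cechOpen U σ))
    (hc : cechDelta U F c = 0) :
    ∃ t : Sec F (⨆ i, U i), ∀ σ, secRes F ((cechOpen_le U σ 0).trans (le_iSup U _)) t = c σ := by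
  have hU (i : ι) : U i ≤ cechOpen U fun _ : Fin 1 => i := le_iInf fun _ => le_rfl
  obtain ⟨t, ht⟩ := sec_glue (F := F) U _ (le_iSup U) le_rfl (fun i => secRes F (hU i) (c _))
    fun i j => by
      have h := congrFun hc ![i, j]
      have hle : U i ⊓ U j ≤ cechOpen U ![i, j] := le_iInf fun k => by
        fin_cases k
        · exact inf_le_left
        · exact inf_le_right
      replace h := congrArg (secRes F hle) h
      rw [secRes_cechDelta, Fin.sum_univ_two] at h
      simp only [Pi.zero_apply, map_zero, Fin.val_zero, pow_zero, one_smul, Fin.val_one, pow_one,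
        neg_smul, ← sub_eq_add_neg, sub_eq_zero] at h
      rw [secRes_secRes, secRes_secRes]
      refine (cech_congr U c ?_ _ (hle.trans (cechOpen_face U ![i, j] 1))).trans
        (h.symm.trans (cech_congr U c ?_ _ _))
      · funext k; fin_cases k; rfl
      · funext k; fin_cases k; rfl
  refine ⟨t, fun σ => ?_⟩
  have h1 := congrArg (secRes F (cechOpen_le U σ 0)) (ht (σ 0))
  rw [secRes_secRes, secRes_secRes] at h1
  rw [h1]
  have : (fun _ : Fin 1 => σ 0) = σ := by funext k; fin_cases k; rfl
  rw [cech_congr U c this _ le_rfl, secRes_self]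

/-- A natural way of writing sections as glued from sections on a cover. -/
structure CechSplitting (F : TopCat.Sheaf AddCommGrpCat.{u} X) where
  R (V : Opens X) (h : V ≤ ⨆ i, U i) : (∀ i, Sec F (U i ⊓ V)) →+ Sec F V
  res (V W : Opens X) (h : V ≤ ⨆ i, U i) (hW : W ≤ V) (s : ∀ i, Sec F (U i ⊓ V)) :
    secRes F hW (R V h s) =
      R W (hW.trans h) fun i => secRes F (inf_le_inf_left _ hW) (s i)
  R_res (V : Opens X) (h : V ≤ ⨆ i, U i) (s : Sec F V) :
    R V h (fun _ => secRes F inf_le_right s) = s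

/-- Splittings pass to retracts. -/
def CechSplitting.retract (S : CechSplitting U G) (i : F ⟶ G) (r : G ⟶ F) (h : i ≫ r = 𝟙 F) :
    CechSplitting U F where
  R V hV := (secMap r V).comp ((S.R V hV).comp (AddMonoidHom.pi fun j =>
    (secMap i _).comp (Pi.evalAddMonoidHom _ j)))
  res V W hV hW s := by
    simp only [AddMonoidHom.comp_apply]
    rw [← secMap_secRes, S.res]
    congr 2
    funext j
    exact (secMap_secRes i _ _).symm
  R_res V hV s := by
    have h1 : (AddMonoidHom.pi fun j => (secMap i (U j ⊓ V)).comp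
        (Pi.evalAddMonoidHom (fun j => Sec F (U j ⊓ V)) j))
        (fun _ => secRes F inf_le_right s) = fun _ => secRes G inf_le_right (secMap i V s) := by
      funext j
      exact secMap_secRes i _ _
    simp only [AddMonoidHom.comp_apply]
    rw [h1, S.R_res, ← secMap_comp, h, secMap_id]

lemma cechOpen_cons_le {p : ℕ} (i : ι) (σ : Fin (p + 1) → ι) :
    U i ⊓ cechOpen U σ ≤ cechOpen U (Fin.cons i σ : Fin (p + 2) → ι) := by
  refine le_iInf fun j => ?_
  refine Fin.cases ?_ (fun j => ?_) j
  · exact inf_le_left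
  · exact inf_le_right.trans (cechOpen_le U σ j)

/-- A splitting contracts the Čech complex in positive degrees. -/
lemma CechSplitting.exact (S : CechSplitting U F) {p : ℕ}
    (c : ∀ σ : Fin (p + 2) → ι, Sec F (cechOpen U σ)) (hc : cechDelta U F c = 0) :
    ∃ b : ∀ σ : Fin (p + 1) → ι, Sec F (cechOpen U σ), cechDelta U F b = c := by
  have hle {p : ℕ} (σ : Fin (p + 1) → ι) : cechOpen U σ ≤ ⨆ i, U i :=
    (cechOpen_le U σ 0).trans (le_iSup U _)
  -- The contracting homotopy: over the intersection for σ, glue the components of c at (i, σ) as i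
  -- varies.
  refine ⟨fun σ => S.R _ (hle σ) fun i => secRes F (cechOpen_cons_le U i σ) (c (Fin.cons i σ)), ?_⟩
  funext σ
  -- The cocycle condition at (i, σ), solved for the face that omits i.
  have h1 : ∀ i, secRes F inf_le_right (c σ) =
      ∑ j : Fin (p + 2), (-1 : ℤ) ^ (j : ℕ) • secRes F
        ((inf_le_inf_left _ (cechOpen_face U σ j)).trans (cechOpen_cons_le U i _))
        (c (Fin.cons i (σ ∘ j.succAbove) : Fin (p + 2) → ι)) := fun i => by
    have h2 := congrArg (secRes F (cechOpen_cons_le U i σ)) (congrFun hc (Fin.cons i σ))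
    rw [secRes_cechDelta, Fin.sum_univ_succ] at h2
    simp only [Pi.zero_apply, map_zero, Fin.val_zero, pow_zero, one_smul, Fin.val_succ, pow_succ,
      mul_neg, mul_one, neg_smul, Finset.sum_neg_distrib, add_neg_eq_zero] at h2
    refine (cech_congr U c ?_ _ _).trans (h2.trans (Finset.sum_congr rfl fun j _ => ?_))
    · funext k; rfl
    · congr 1
      refine cech_congr U c ?_ _ _
      funext k
      refine Fin.cases ?_ (fun k => ?_) k
      · simp
      · simp
  refine Eq.trans ?_ (S.R_res _ (hle σ) (c σ))
  simp only [h1]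
  rw [show (fun i => ∑ j : Fin (p + 2), (-1 : ℤ) ^ (j : ℕ) • secRes F
        ((inf_le_inf_left (U i) (cechOpen_face U σ j)).trans (cechOpen_cons_le U i _))
        (c (Fin.cons i (σ ∘ j.succAbove) : Fin (p + 2) → ι))) =
      ∑ j : Fin (p + 2), (-1 : ℤ) ^ (j : ℕ) • fun i => secRes F
        ((inf_le_inf_left (U i) (cechOpen_face U σ j)).trans (cechOpen_cons_le U i _))
        (c (Fin.cons i (σ ∘ j.succAbove) : Fin (p + 2) → ι)) by
    funext i; simp]
  rw [map_sum]
  refine Finset.sum_congr rfl fun j _ => ?_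
  rw [map_zsmul, S.res]
  congr 2
  funext i
  rw [secRes_secRes]

end Cech

/-! ### Godement embedding and splittings of injective sheaves -/

section Discontinuous

variable {X : TopCat.{u}} 

/-- A presheaf of abelian groups whose sections are all the dependent functions is a sheaf. -/
lemma isSheaf_of_functions (T : X → Type u) (F : TopCat.Presheaf AddCommGrpCat.{u} X)
    (e : F ⋙ forget AddCommGrpCat.{u} ≅ TopCat.presheafToTypes X T) : F.IsSheaf := by
  rw [TopCat.Presheaf.isSheaf_iff_isSheaf_comp (forget AddCommGrpCat.{u}) F]
  exact TopCat.Presheaf.isSheaf_of_iso e.symm (TopCat.Presheaf.toTypes_isSheaf X T)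

/-- Restriction of dependent functions. -/
def funRes (A : X → Type u) [∀ x, AddCommGroup (A x)] {V W : Opens X} (h : W ≤ V) :
    (∀ x : V, A x) →+ ∀ x : W, A x where
  toFun f x := f ⟨x, h x.2⟩
  map_zero' := rfl
  map_add' _ _ := rfl

/-- The sheaf of all sections of a family of groups. -/
def functionSheaf (A : X → Type u) [∀ x, AddCommGroup (A x)] :
    TopCat.Sheaf AddCommGrpCat.{u} X where
  obj :=
    { obj := fun V => AddCommGrpCat.of (∀ x : V.unop, A x)
      map := fun i => AddCommGrpCat.ofHom (funRes A i.unop.le) }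
  property := isSheaf_of_functions A _ (NatIso.ofComponents (fun _ => Iso.refl _))

/-- Sheaves of all sections of a family of groups have splittings for all covers. -/
def functionSheafSplitting (A : X → Type u) [∀ x, AddCommGroup (A x)] {ι : Type v}
    (U : ι → Opens X) : CechSplitting U (functionSheaf A) where
  R V h :=
    { toFun := fun s x =>
        let i := (Opens.mem_iSup.1 (h x.2)).choose
        (s i : ∀ x : ↑(U i ⊓ V), A x) ⟨x, (Opens.mem_iSup.1 (h x.2)).choose_spec, x.2⟩
      map_zero' := rfl
      map_add' := fun _ _ => rfl }
  -- The chosen index depends only on the point, not on the open set around it.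
  res _ _ _ _ _ := rfl
  R_res _ _ _ := rfl

variable (F : TopCat.Sheaf AddCommGrpCat.{u} X)

/-- The embedding of a sheaf into the sheaf of all sections of its stalks. -/
def toStalks : F ⟶ functionSheaf fun x => ((TopCat.Presheaf.stalk F.obj x : AddCommGrpCat.{u}) : Type u) :=
  ObjectProperty.homMk
    { app := fun V => AddCommGrpCat.ofHom (AddMonoidHom.mk'
        (fun s (x : V.unop) => TopCat.Presheaf.germ F.obj V.unop x.1 x.2 s) fun a b => by
          funext x; exact map_add _ _ _)
      naturality := fun V W i => by
        ext s; funext x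
        exact TopCat.Presheaf.germ_res_apply F.obj i.unop x.1 x.2 s }

lemma mono_of_injective {F G : TopCat.Sheaf AddCommGrpCat.{u} X} (φ : F ⟶ G)
    (h : ∀ V, Function.Injective (secMap φ V)) : Mono φ := by
  refine ⟨fun a b hab => sheafHom_ext _ _ fun V s => h V.unop ?_⟩
  exact ConcreteCategory.congr_hom (congrArg (fun ψ => ψ.hom.app V) hab) s

lemma injective_of_mono {F G : TopCat.Sheaf AddCommGrpCat.{u} X} (φ : F ⟶ G) [Mono φ]
    (V : Opens X) : Function.Injective (secMap φ V) := by
  have : Mono ((TopCat.Sheaf.forget _ _).map φ) := inferInstance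
  have h2 : Mono (φ.hom.app (op V)) := (NatTrans.mono_iff_mono_app _).1 this (op V)
  exact (AddCommGrpCat.mono_iff_injective _).1 h2

instance : Mono (toStalks F) :=
  mono_of_injective _ fun V s t h => TopCat.Presheaf.section_ext F V s t fun x hx =>
    congrFun h ⟨x, hx⟩

/-- Injective sheaves have splittings for all covers. -/
def injectiveSplitting [Injective F] {ι : Type v} (U : ι → Opens X) : CechSplitting U F :=
  (functionSheafSplitting _ U).retract U (toStalks F)
    (Injective.factorThru (𝟙 F) (toStalks F)) (Injective.comp_factorThru _ _)

end Discontinuous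

/-! ### Epimorphisms and exactness tested on sections -/

section Exact

variable {X : TopCat.{u}} {F G : TopCat.Sheaf AddCommGrpCat.{u} X}

lemma epi_iff_locally_surjective (φ : F ⟶ G) :
    Epi φ ↔ ∀ (V : Opens X) (s : Sec G V), ∀ x ∈ V, ∃ (W : Opens X) (i : W ≤ V) (t : Sec F W),
      x ∈ W ∧ secMap φ W t = secRes G i s := by
  rw [← TopCat.Sheaf.isLocallySurjective_iff_epi, TopCat.Presheaf.isLocallySurjective_iff]
  refine forall_congr' fun V => forall_congr' fun s => forall_congr' fun x => forall_congr' fun _ =>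
    ⟨?_, ?_⟩
  · rintro ⟨W, i, ⟨t, ht⟩, hx⟩
    exact ⟨W, i, t, hx, ht⟩
  · rintro ⟨W, i, t, hx, ht⟩
    exact ⟨W, i, ⟨t, ht⟩, hx⟩

lemma exact_sections {S : ShortComplex (TopCat.Sheaf AddCommGrpCat.{u} X)} (hS : S.Exact)
    [Mono S.f] {V : Opens X} (s : Sec S.X₂ V) (hs : secMap S.g V s = 0) : ∃ t, secMap S.f V t = s :=
  TopCat.Sheaf.sections_exact_of_left_exact hS inferInstance s hs

end Exact

/-! ### Čech acyclicity and short exact sequences -/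

section CechAcyclic

variable {X : TopCat.{u}}

/-- The Čech complexes of all families of open subsets of `V` are exact in positive degrees. -/
def CechAcyclic (F : TopCat.Sheaf AddCommGrpCat.{u} X) (V : Opens X) : Prop :=
  ∀ (ι : Type u) (U : ι → Opens X), (∀ i, U i ≤ V) → ∀ (p : ℕ)
    (c : ∀ σ : Fin (p + 2) → ι, Sec F (cechOpen U σ)), cechDelta U F c = 0 →
      ∃ b : ∀ σ : Fin (p + 1) → ι, Sec F (cechOpen U σ), cechDelta U F b = c

lemma cechAcyclic_of_injective (F : TopCat.Sheaf AddCommGrpCat.{u} X) [Injective F]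
    (V : Opens X) : CechAcyclic F V := fun _ U _ _ c hc => (injectiveSplitting F U).exact U c hc

variable {S : ShortComplex (TopCat.Sheaf AddCommGrpCat.{u} X)} (hS : S.ShortExact) {V : Opens X}

include hS in
-- The zigzag of the connecting homomorphism: δc is killed by `S.g`, so it comes from `S.X₁`, and
-- the lift is again a cocycle because `S.f` is injective on sections.
lemma exists_lift_of_cocycle {ι : Type v} (U : ι → Opens X) {p : ℕ}
    (c : ∀ σ : Fin (p + 1) → ι, Sec S.X₂ (cechOpen U σ))
    (hc : ∀ σ, secMap S.g _ (cechDelta U S.X₂ c σ) = 0) :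
    ∃ a : ∀ σ : Fin (p + 2) → ι, Sec S.X₁ (cechOpen U σ), cechDelta U S.X₁ a = 0 ∧
      ∀ σ, secMap S.f _ (a σ) = cechDelta U S.X₂ c σ := by
  have := hS.mono_f
  choose a ha using fun σ => exact_sections hS.exact _ (hc σ)
  refine ⟨a, ?_, ha⟩
  have := hS.mono_f
  funext σ
  apply injective_of_mono S.f
  rw [← congrFun (cechDelta_secMap U S.f a) σ, funext ha, cechDelta_cechDelta]
  exact (map_zero _).symm

include hS in
-- Local lifts of a section differ by a Čech 1-cocycle of `S.X₁`. It is the coboundary of some b,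
-- and subtracting the image of b makes the lifts agree on overlaps, so they glue.
lemma surjective_of_cechAcyclic (h1 : CechAcyclic S.X₁ V) {W : Opens X} (hW : W ≤ V) :
    Function.Surjective (secMap S.g W) := by
  intro s
  have := hS.epi_g
  -- The cover is indexed by the points of `W`, so its index type lies in the universe that
  -- `CechAcyclic` allows.
  choose W' hle t hx ht using fun x : W => (epi_iff_locally_surjective S.g).1 this W s x.1 x.2
  have hc : ∀ σ, secMap S.g _ (cechDelta W' S.X₂
      (fun σ : Fin 1 → W => secRes S.X₂ (cechOpen_le W' σ 0) (t (σ 0))) σ) = 0 := by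
    intro σ
    rw [← congrFun (cechDelta_secMap W' S.g _) σ]
    have h : (fun σ : Fin 1 → W => secMap S.g _ (secRes S.X₂ (cechOpen_le W' σ 0) (t (σ 0)))) =
        fun σ => secRes S.X₃ ((cechOpen_le W' σ 0).trans (hle _)) s := by
      funext σ
      rw [secMap_secRes, ht, secRes_secRes]
    rw [h]
    refine (Fin.sum_univ_two _).trans ?_
    simp only [secRes_secRes]
    simp
  obtain ⟨a, ha, ha'⟩ := exists_lift_of_cocycle hS W' _ hc
  obtain ⟨b, hb⟩ := h1 W W' (fun x => (hle x).trans hW) 0 a ha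
  obtain ⟨r, hr⟩ := exists_glue_of_cechDelta_eq_zero W'
    ((fun σ : Fin 1 → W => secRes S.X₂ (cechOpen_le W' σ 0) (t (σ 0))) -
      fun σ => secMap S.f _ (b σ)) (by
    rw [cechDelta_sub, cechDelta_secMap, hb]
    funext σ
    exact sub_eq_zero.2 (ha' σ).symm)
  refine ⟨secRes _ (fun x hx' => Opens.mem_iSup.2 ⟨⟨x, hx'⟩, hx ⟨x, hx'⟩⟩) r, sec_ext fun x hx' => ?_⟩
  have hi : W' ⟨x, hx'⟩ ≤ cechOpen W' fun _ : Fin 1 => ⟨x, hx'⟩ := le_iInf fun _ => le_rfl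
  refine ⟨W' ⟨x, hx'⟩, hle _, hx _, ?_⟩
  rw [← secMap_secRes, secRes_secRes, ← ht]
  have h2 := congrArg (secRes _ hi) (hr fun _ => ⟨x, hx'⟩)
  rw [secRes_secRes] at h2
  rw [h2]
  simp only [Pi.sub_apply, map_sub, secMap_secRes, secRes_secRes, ← secMap_comp, S.zero]
  rw [secMap_zero, map_zero, sub_zero, ← secMap_secRes, secRes_self]

include hS in
-- Long exact sequence of Čech cohomology: a cocycle lifts termwise to `S.X₂`, the defect of the
-- lift is a cocycle of `S.X₁` one degree higher, and correcting by a primitive of it yields a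
-- cocycle of `S.X₂`, which bounds.
lemma cechAcyclic_of_shortExact (h1 : CechAcyclic S.X₁ V) (h2 : CechAcyclic S.X₂ V) :
    CechAcyclic S.X₃ V := by
  intro ι U hU p c hc
  choose c' hc' using fun σ => surjective_of_cechAcyclic hS h1
    ((cechOpen_le U σ 0).trans (hU _)) (c σ)
  obtain ⟨a, ha, ha'⟩ := exists_lift_of_cocycle hS U c' fun σ => by
    rw [← congrFun (cechDelta_secMap U S.g c') σ, funext hc', hc]; rfl
  obtain ⟨b, hb⟩ := h1 ι U hU _ a ha
  obtain ⟨e, he⟩ := h2 ι U hU _ (c' - fun σ => secMap S.f _ (b σ)) (by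
    rw [cechDelta_sub, cechDelta_secMap, hb]
    funext σ
    exact sub_eq_zero.2 (ha' σ).symm)
  refine ⟨fun σ => secMap S.g _ (e σ), ?_⟩
  rw [cechDelta_secMap, he]
  funext σ
  simp only [Pi.sub_apply, map_sub, ← secMap_comp, S.zero, hc']
  rw [secMap_zero, sub_zero]

end CechAcyclic

/-! ### Sheaf cohomology as Ext from free sheaves; Cartan's criterion -/

section Ext

variable {X : TopCat.{u}}

instance : HasExt.{u} (TopCat.Sheaf AddCommGrpCat.{u} X) := hasExt_of_enoughInjectives _

/-- The free abelian presheaf on the open set `V`. -/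
abbrev freePresheaf (V : Opens X) : (Opens X)ᵒᵖ ⥤ AddCommGrpCat.{u} :=
  yoneda.obj V ⋙ AddCommGrpCat.free

/-- The free abelian sheaf on the open set `V`. -/
def freeSheaf (V : Opens X) : TopCat.Sheaf AddCommGrpCat.{u} X :=
  (presheafToSheaf (Opens.grothendieckTopology X) AddCommGrpCat.{u}).obj (freePresheaf V)

/-- The canonical section of the free abelian sheaf. -/
def freeSection (V : Opens X) : Sec (freeSheaf V) V :=
  (toSheafify (Opens.grothendieckTopology X) (freePresheaf V)).app (op V)
    (FreeAbelianGroup.of (𝟙 V))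

/-- The morphism of presheaves given by a section. -/
def freePresheafDesc {F : TopCat.Sheaf AddCommGrpCat.{u} X} {V : Opens X} (s : Sec F V) :
    freePresheaf V ⟶ F.obj where
  app W := AddCommGrpCat.ofHom (FreeAbelianGroup.lift fun i : W.unop ⟶ V => secRes F i.le s)
  naturality W W' i := by
    refine AddCommGrpCat.hom_ext (FreeAbelianGroup.lift_ext _ _ fun j => ?_)
    change FreeAbelianGroup.lift _ (FreeAbelianGroup.map _ (FreeAbelianGroup.of j)) =
      secRes F i.unop.le (FreeAbelianGroup.lift _ (FreeAbelianGroup.of j))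
    rw [FreeAbelianGroup.map_of_apply, FreeAbelianGroup.lift_apply_of,
      FreeAbelianGroup.lift_apply_of, secRes_secRes]

/-- Sheafification and freeness: a morphism out of the free sheaf on `V` is determined by where it
sends the tautological section. This identifies Hom out of `freeSheaf V` with sections, so that Ext
out of it is the cohomology of `V`. -/
lemma freeSheaf_bijective (F : TopCat.Sheaf AddCommGrpCat.{u} X) (V : Opens X) :
    Function.Bijective fun φ : freeSheaf V ⟶ F => secMap φ V (freeSection V) := by
  constructor
  · intro φ ψ h
    refine Sheaf.hom_ext (sheafify_hom_ext _ _ _ F.property ?_)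
    refine NatTrans.ext (funext fun W =>
      AddCommGrpCat.hom_ext (FreeAbelianGroup.lift_ext _ _ fun j => ?_))
    have key (φ : freeSheaf V ⟶ F) : (toSheafify (Opens.grothendieckTopology X)
        (freePresheaf V) ≫ φ.hom).app W (FreeAbelianGroup.of j) =
        secRes F j.le (secMap φ V (freeSection V)) := by
      have h1 : (FreeAbelianGroup.of j : (freePresheaf V).obj W) =
        (freePresheaf V).map j.op (FreeAbelianGroup.of (𝟙 V)) := by
          change _ = FreeAbelianGroup.map _ _
          rw [FreeAbelianGroup.map_of_apply]; rfl
      rw [h1]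
      exact ConcreteCategory.congr_hom ((toSheafify (Opens.grothendieckTopology X)
        (freePresheaf V) ≫ φ.hom).naturality j.op) _
    exact (key φ).trans ((congrArg (secRes F _) h).trans (key ψ).symm)
  · intro s
    refine ⟨⟨sheafifyLift (Opens.grothendieckTopology X) (freePresheafDesc s) F.property⟩, ?_⟩
    have h1 := ConcreteCategory.congr_hom (C := AddCommGrpCat.{u}) (NatTrans.congr_app
      (toSheafify_sheafifyLift (Opens.grothendieckTopology X) (freePresheafDesc s) F.property)
      (op V)) (FreeAbelianGroup.of (𝟙 V) : FreeAbelianGroup (V ⟶ V))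
    refine h1.trans ?_
    change FreeAbelianGroup.lift _ (FreeAbelianGroup.of (𝟙 V)) = s
    rw [FreeAbelianGroup.lift_apply_of, secRes_self]

/-- The vanishing of the cohomology of `F` on `V` in degree `n`. -/
def Vanishes (F : TopCat.Sheaf AddCommGrpCat.{u} X) (V : Opens X) (n : ℕ) : Prop :=
  ∀ x : Abelian.Ext (freeSheaf V) F n, x = 0

variable {S : ShortComplex (TopCat.Sheaf AddCommGrpCat.{u} X)} (hS : S.ShortExact) {V : Opens X}

open Abelian

include hS in
lemma Vanishes.X₃ {n : ℕ} (h2 : Vanishes S.X₂ V n) (h1 : Vanishes S.X₁ V (n + 1)) :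
    Vanishes S.X₃ V n := fun x => by
  obtain ⟨y, rfl⟩ := Ext.covariant_sequence_exact₃ _ hS x rfl (h1 _)
  rw [h2 y, Ext.zero_comp]

include hS in
lemma Vanishes.X₁ {n : ℕ} (h3 : Vanishes S.X₃ V n) (h2 : Vanishes S.X₂ V (n + 1)) :
    Vanishes S.X₁ V (n + 1) := fun x => by
  obtain ⟨y, rfl⟩ := Ext.covariant_sequence_exact₁ _ hS x (h2 _) rfl
  rw [h3 y, Ext.zero_comp]

include hS in
lemma Vanishes.surjective (h1 : Vanishes S.X₁ V 1) : Function.Surjective (secMap S.g V) := by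
  intro s
  obtain ⟨φ, hφ⟩ := (freeSheaf_bijective S.X₃ V).2 s
  obtain ⟨y, hy⟩ := Ext.covariant_sequence_exact₃ _ hS (Ext.mk₀ φ) (zero_add 1) (h1 _)
  obtain ⟨ψ, rfl⟩ := (Ext.mk₀_bijective _ _).2 y
  rw [Ext.mk₀_comp_mk₀] at hy
  have := (Ext.mk₀_bijective _ _).1 hy
  refine ⟨secMap ψ V (freeSection V), ?_⟩
  rw [← secMap_comp, this]
  exact hφ

include hS in
-- With H¹ of the middle term zero, every class of H¹ of `S.X₁` is the connecting image of a section
-- of `S.X₃`, and a section that lifts to `S.X₂` has zero image.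
lemma vanishes_one_of_surjective (h : Function.Surjective (secMap S.g V))
    (h2 : Vanishes S.X₂ V 1) : Vanishes S.X₁ V 1 := fun x => by
  obtain ⟨y, rfl⟩ := Ext.covariant_sequence_exact₁ _ hS x (h2 _) (zero_add 1)
  obtain ⟨φ, rfl⟩ := (Ext.mk₀_bijective _ _).2 y
  obtain ⟨t, ht⟩ := h (secMap φ V (freeSection V))
  obtain ⟨ψ, rfl⟩ := (freeSheaf_bijective S.X₂ V).2 t
  have : φ = ψ ≫ S.g := (freeSheaf_bijective S.X₃ V).1 ht.symm
  rw [this, ← Ext.mk₀_comp_mk₀, Ext.comp_assoc_of_second_deg_zero, hS.comp_extClass,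
    Ext.comp_zero]

lemma vanishes_of_injective (F : TopCat.Sheaf AddCommGrpCat.{u} X) [Injective F] (V : Opens X)
    (n : ℕ) : Vanishes F V (n + 1) := fun x => Ext.eq_zero_of_injective x

/-- Cartan's criterion. -/
lemma CechAcyclic.vanishes {F : TopCat.Sheaf AddCommGrpCat.{u} X} {V : Opens X}
    (h : CechAcyclic F V) (n : ℕ) : Vanishes F V (n + 1) := by
  induction n generalizing F with
  | zero =>
    have hS : (ShortComplex.mk (Injective.ι F) (cokernel.π _) (cokernel.condition _)).ShortExact :=
      { exact := ShortComplex.exact_cokernel _ }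
    exact vanishes_one_of_surjective hS (surjective_of_cechAcyclic hS h le_rfl)
      (vanishes_of_injective _ _ _)
  | succ n ih =>
    have hS : (ShortComplex.mk (Injective.ι F) (cokernel.π _) (cokernel.condition _)).ShortExact :=
      { exact := ShortComplex.exact_cokernel _ }
    -- Dimension shift: the cokernel of an embedding into an injective sheaf inherits Čech
    -- acyclicity.
    exact (ih (cechAcyclic_of_shortExact hS h (cechAcyclic_of_injective _ _))).X₁ hS
      (vanishes_of_injective _ _ _)

lemma vanishes_of_isZero {F : TopCat.Sheaf AddCommGrpCat.{u} X} (hF : IsZero F) (V : Opens X)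
    (n : ℕ) : Vanishes F V n := fun x => by
  rw [← Ext.comp_mk₀_id x, hF.eq_of_src (𝟙 F) 0, Ext.mk₀_zero, Ext.comp_zero]

lemma vanishes_biprod {F G : TopCat.Sheaf AddCommGrpCat.{u} X} {V : Opens X} {n : ℕ}
    (hF : Vanishes F V n) (hG : Vanishes G V n) : Vanishes (F ⊞ G) V n := fun x => by
  rw [← Ext.comp_mk₀_id x, ← biprod.total, Ext.mk₀_add, Ext.comp_add, ← Ext.mk₀_comp_mk₀,
    ← Ext.mk₀_comp_mk₀, ← Ext.comp_assoc_of_second_deg_zero, ← Ext.comp_assoc_of_second_deg_zero,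
    hF (x.comp _ _), hG (x.comp _ _), Ext.zero_comp, Ext.zero_comp, add_zero]

end Ext

/-! ### Acyclicity of the sheaves of smooth forms -/

section FormsAcyclic

variable {m : ℕ} {M : Type u} [TopologicalSpace M] [ChartedSpace (Euc m) M]
  [IsManifold 𝓘(ℝ, Euc m) ∞ M]

lemma isSmoothForm_congr {k : ℕ} {V : Opens M} {θ η : ∀ x : V, AltForm m k (x : M)}
    (hη : IsSmoothForm η) (h : ∀ x, θ x = η x) : IsSmoothForm θ :=
  (funext h : θ = η) ▸ hη

lemma isSmoothForm_smul {k : ℕ} {V : Opens M} {g : V → ℂ}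
    (hg : ContMDiff 𝓘(ℝ, Euc m) 𝓘(ℝ, ℂ) ∞ g) {θ : ∀ x : V, AltForm m k (x : M)}
    (hθ : IsSmoothForm θ) : IsSmoothForm (m := m) fun x : V => g x • θ x := by
  intro x
  have h1 : chartRep (fun x : V => g x • θ x) (x : M) = fun y =>
      extendFun g ((chartAt (Euc m) (x : M)).symm y) • chartRep θ (x : M) y := by
    funext y
    by_cases h : (chartAt (Euc m) (x : M)).symm y ∈ V
    · simp only [chartRep, h, dif_pos, extendFun]
      ext v; rfl
    · simp only [chartRep, h, dif_neg, extendFun, not_false_eq_true]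
      exact (zero_smul ℂ (0 : Euc m [⋀^Fin k]→L[ℝ] ℂ)).symm
  rw [h1]
  exact ((contMDiff_iff_extend g).1 hg x).smul (hθ x)

open Classical in
/-- Extension by zero of a form on `U ⊓ V` to `V`. -/
def extendForm {k : ℕ} {U V : Opens M} (θ : Form m k (U ⊓ V)) (x : V) : AltForm m k (x : M) :=
  if h : x.1 ∈ U then θ.1 ⟨x.1, h, x.2⟩ else 0

lemma extendForm_of_mem {k : ℕ} {U V : Opens M} (θ : Form m k (U ⊓ V)) (x : V) (h : x.1 ∈ U) :
    extendForm θ x = θ.1 ⟨x.1, h, x.2⟩ := dif_pos h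

lemma zero_smul_altForm {k : ℕ} {x : M} (θ : AltForm m k x) : (0 : ℂ) • θ = 0 := zero_smul ℂ θ

lemma extendForm_add {k : ℕ} {U V : Opens M} (θ η : Form m k (U ⊓ V)) (x : V) :
    extendForm (θ + η) x = extendForm θ x + extendForm η x := by
  by_cases h : x.1 ∈ U
  · simp only [extendForm, h, dif_pos]; rfl
  · simp only [extendForm, h, dif_neg, not_false_eq_true]
    exact (add_zero _).symm

/-- At points of the support of `g` the form is defined nearby; off the support, which is closed,
the product is zero nearby. -/
lemma isSmoothForm_smul_extendForm {k : ℕ} {U V : Opens M} {g : V → ℂ}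
    (hg : ContMDiff 𝓘(ℝ, Euc m) 𝓘(ℝ, ℂ) ∞ g) (θ : Form m k (U ⊓ V))
    (hU : ∀ x : V, x ∈ tsupport g → x.1 ∈ U) :
    IsSmoothForm fun x : V => g x • extendForm θ x := by
  refine isSmoothForm_local _ fun x => ?_
  by_cases hx : x ∈ tsupport g
  · refine ⟨U ⊓ V, ⟨hU x hx, x.2⟩, inf_le_right, ?_⟩
    have h1 : IsSmoothForm (m := m) fun y : ↑(U ⊓ V) => g ⟨y, y.2.2⟩ • θ.1 y :=
      isSmoothForm_smul (g := fun y : ↑(U ⊓ V) => g ⟨y, y.2.2⟩)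
        (hg.comp (contMDiff_inclusion inf_le_right)) θ.2
    refine isSmoothForm_congr h1 fun y => ?_
    rw [extendForm_of_mem θ ⟨y.1, y.2.2⟩ y.2.1]
  · let W : Opens M := ⟨Subtype.val '' (tsupport g)ᶜ,
      V.isOpen.isOpenMap_subtype_val _ (isClosed_tsupport g).isOpen_compl⟩
    refine ⟨W, ⟨x, hx, rfl⟩, ?_, ?_⟩
    · rintro _ ⟨y, -, rfl⟩; exact y.2
    · refine isSmoothForm_congr (0 : Form m k W).2 fun y => ?_
      obtain ⟨_, z, hz, rfl⟩ := y
      have : g z = 0 := image_eq_zero_of_notMem_tsupport hz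
      change g z • _ = _
      rw [this]
      exact zero_smul_altForm _

variable (m M) in
/-- A smooth partition of unity gives a splitting of the sheaf of forms. -/
def formSplitting {ι : Type v} (U : ι → Opens M) (k : ℕ)
    (f : SmoothPartitionOfUnity ι 𝓘(ℝ, Euc m) (↥(⨆ i, U i : Opens M)) Set.univ)
    (hf : f.IsSubordinate fun i => Subtype.val ⁻¹' (U i : Set M)) :
    CechSplitting (X := TopCat.of M) U (formSheaf m M k) where
  R V h := AddMonoidHom.mk' (fun s => (⟨fun x : (V : Opens M) =>
      ∑ i ∈ f.finsupport ⟨x, h x.2⟩, (f i ⟨x, h x.2⟩ : ℂ) •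
        extendForm (m := m) (k := k) (U := U i) (V := V) (s i) x, by
    refine isSmoothForm_local _ fun x => ?_
    have h0 := f.eventually_finsupport_subset ⟨x.1, h x.2⟩
    -- Near `x` the index set of the sum varies inside one finite set, so the sum agrees locally
    -- with a fixed finite sum.
    have h1 : ∀ᶠ y in nhds x, f.finsupport ⟨y.1, h y.2⟩ ⊆ f.fintsupport ⟨x.1, h x.2⟩ :=
      (continuous_inclusion (show (V : Set M) ⊆ ((⨆ i, U i : Opens M) : Set M) from h)).continuousAt
        (x := x) |>.eventually h0
    obtain ⟨t, ht, hto, hxt⟩ := eventually_nhds_iff.1 h1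
    refine ⟨⟨Subtype.val '' t, V.isOpen.isOpenMap_subtype_val _ hto⟩, ⟨x, hxt, rfl⟩, ?_, ?_⟩
    · rintro _ ⟨y, -, rfl⟩; exact y.2
    have hle : (⟨Subtype.val '' t, V.isOpen.isOpenMap_subtype_val _ hto⟩ : Opens M) ≤ V := by
      rintro _ ⟨y, -, rfl⟩; exact y.2
    have h2 : (∑ i ∈ f.fintsupport ⟨x.1, h x.2⟩, fun y : (V : Opens M) =>
        (f i ⟨y, h y.2⟩ : ℂ) • extendForm (m := m) (k := k) (U := U i) (V := V) (s i) y) ∈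
        Form m k (M := M) V := by
      refine sum_mem fun i _ => ?_
      refine isSmoothForm_smul_extendForm (g := fun y : (V : Opens M) => (f i ⟨y, h y.2⟩ : ℂ))
        ?_ _ ?_
      · exact Complex.ofRealCLM.contDiff.contMDiff.comp
          ((f i).contMDiff.comp (contMDiff_inclusion (M := M) h))
      · intro y hy
        have h3 : (⟨y, h y.2⟩ : ↥(⨆ i, U i : Opens M)) ∈ tsupport (f i) := by
          have h4 : tsupport (fun y : (V : Opens M) => (f i ⟨y, h y.2⟩ : ℂ)) ⊆
              (Set.inclusion (show (V : Set M) ⊆ ((⨆ i, U i : Opens M) : Set M) from h)) ⁻¹'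
                tsupport (f i) := by
            refine closure_minimal ?_ ((isClosed_tsupport _).preimage (continuous_inclusion _))
            intro z hz
            refine subset_tsupport _ ?_
            intro h5
            apply hz
            change ((f i ⟨z, h z.2⟩ : ℝ) : ℂ) = 0
            exact_mod_cast h5
          exact h4 hy
        exact hf i h3
    have h5 := (Form.res hle ⟨_, h2⟩ : Form m k _).2
    refine isSmoothForm_congr h5 fun y => ?_
    obtain ⟨_, z, hz, rfl⟩ := y
    simp only [Form.res, AddMonoidHom.coe_mk, ZeroHom.coe_mk, Finset.sum_apply]
    refine Finset.sum_subset (ht z hz) fun i _ hi => ?_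
    have : f i ⟨z.1, h z.2⟩ = 0 := by
      by_contra h6
      exact hi ((f.mem_finsupport _).2 h6)
    rw [this, Complex.ofReal_zero]
    exact zero_smul_altForm _⟩ : Form m k (M := M) V)) fun a b => by
      refine Subtype.ext (funext fun x => ?_)
      refine Eq.trans ?_ Finset.sum_add_distrib
      refine Finset.sum_congr rfl fun i _ => ?_
      refine Eq.trans ?_ (smul_add (_ : ℂ) _ _)
      exact congrArg _ (extendForm_add _ _ _)
  -- The partition of unity lives on the whole union of the cover and does not depend on `V`.
  res V W h hW s := rfl
  R_res V h s := by
    refine Subtype.ext (funext fun x => ?_)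
    have h1 : ∀ i ∈ f.finsupport ⟨x, h x.2⟩, (f i ⟨x, h x.2⟩ : ℂ) •
        extendForm (m := m) (k := k) (U := U i) (V := V)
          (Form.res (inf_le_right (a := U i)) s) x = (f i ⟨x, h x.2⟩ : ℂ) • s.1 x := by
      intro i hi
      have : (x : M) ∈ U i := hf i (subset_tsupport _ ((f.mem_finsupport _).1 hi))
      rw [extendForm_of_mem _ x this]
      rfl
    refine (Finset.sum_congr rfl h1).trans ?_
    rw [← Finset.sum_smul, ← Complex.ofReal_sum, f.sum_finsupport _ (Set.mem_univ _)]
    exact one_smul ℂ _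

/-- The union of the family inherits second countability from `V` and local compactness from the
manifold, so it carries a smooth partition of unity subordinate to the family. -/
lemma formSheaf_cechAcyclic [T2Space M] (k : ℕ) (V : Opens M)
    [SecondCountableTopology V] : CechAcyclic (X := TopCat.of M) (formSheaf m M k) V := by
  intro ι U hU p c hc
  have hle : (⨆ i, U i : Opens M) ≤ V := iSup_le hU
  have : SecondCountableTopology ↥(⨆ i, U i : Opens M) :=
    (Topology.IsEmbedding.inclusion hle).secondCountableTopology
  have : LocallyCompactSpace M := ChartedSpace.locallyCompactSpace (Euc m) M
  have : LocallyCompactSpace ↥(⨆ i, U i : Opens M) :=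
    (⨆ i, U i : Opens M).isOpen.locallyCompactSpace
  obtain ⟨f, hf⟩ := SmoothPartitionOfUnity.exists_isSubordinate 𝓘(ℝ, Euc m)
    (M := ↥(⨆ i, U i : Opens M)) isClosed_univ
    (fun i => Subtype.val ⁻¹' (U i : Set M))
    (fun i => (U i).isOpen.preimage continuous_subtype_val) fun x _ =>
      Set.mem_iUnion.2 (Opens.mem_iSup.1 x.2)
  exact (formSplitting m M U k f hf).exact _ c hc

end FormsAcyclic

/-! ### Alexander–Spanier cochains -/

section AlexanderSpanier

/-- Normalized functions of `p + 1` variables: they vanish if two consecutive arguments agree. -/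
def ASFun (X : Type u) (G : Type) [AddCommGroup G] (p : ℕ) :
    AddSubgroup ((Fin (p + 1) → X) → G) where
  carrier := {f | ∀ (x : Fin (p + 1) → X) (i : Fin p), x i.castSucc = x i.succ → f x = 0}
  zero_mem' := fun _ _ _ => rfl
  add_mem' := fun ha hb x i h => by rw [Pi.add_apply, ha x i h, hb x i h, add_zero]
  neg_mem' := fun ha x i h => by rw [Pi.neg_apply, ha x i h, neg_zero]

variable {X : Type u} {G : Type} [AddCommGroup G] {p : ℕ}

/-- The Alexander–Spanier differential on all functions. -/
def asDelta (f : (Fin (p + 1) → X) → G) (x : Fin (p + 2) → X) : G :=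
  ∑ j : Fin (p + 2), (-1 : ℤ) ^ (j : ℕ) • f (x ∘ j.succAbove)

lemma asDelta_add (f g : (Fin (p + 1) → X) → G) : asDelta (f + g) = asDelta f + asDelta g := by
  funext x
  simp only [asDelta, Pi.add_apply, smul_add, Finset.sum_add_distrib]

lemma asDelta_asDelta (f : (Fin (p + 1) → X) → G) : asDelta (asDelta f) = 0 := by
  funext x
  rw [Pi.zero_apply, ← sum_sum_succAbove fun h => f (x ∘ h)]
  refine Finset.sum_congr rfl fun j _ => ?_
  rw [asDelta, Finset.smul_sum]
  refine Finset.sum_congr rfl fun i _ => ?_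
  rw [mul_smul]
  rfl

/-- If two consecutive arguments agree, the two faces omitting one of them coincide and have
opposite signs, and every other face still has two equal consecutive arguments. -/
lemma asDelta_mem {f : (Fin (p + 1) → X) → G} (hf : f ∈ ASFun X G p) :
    asDelta f ∈ ASFun X G (p + 1) := by
  intro x i hx
  rw [asDelta, Finset.sum_eq_add i.castSucc i.succ (Fin.castSucc_lt_succ).ne]
  · have h1 : x ∘ i.castSucc.succAbove = x ∘ i.succ.succAbove := by
      funext k
      simp only [Function.comp_apply]
      rcases lt_trichotomy k i with h | rfl | h
      · rw [Fin.succAbove_of_castSucc_lt _ _ (by simpa using h),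
          Fin.succAbove_of_castSucc_lt _ _ (Fin.castSucc_lt_succ_iff.2 h.le)]
      · rw [Fin.succAbove_castSucc_self, Fin.succAbove_succ_self, hx]
      · rw [Fin.succAbove_of_le_castSucc _ _ (by simpa using h.le),
          Fin.succAbove_of_le_castSucc _ _ (Fin.succ_le_castSucc_iff.2 h)]
    rw [h1, ← add_smul, Fin.val_castSucc, Fin.val_succ, pow_succ]
    simp
  · rintro j - ⟨h1, h2⟩
    rw [show f (x ∘ j.succAbove) = 0 from ?_, smul_zero]
    -- The equal pair moves down by one position if the omitted index precedes it, and stays in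
    -- place otherwise.
    rcases lt_or_ge j i.castSucc with h | h
    · have hi : i ≠ 0 := by rintro rfl; simp at h
      obtain ⟨k, rfl⟩ := Fin.exists_succ_eq.2 hi
      refine hf _ k ?_
      simp only [Function.comp_apply]
      rw [Fin.succAbove_of_le_castSucc _ _ (by
          rw [Fin.lt_def] at h; rw [Fin.le_def]; simp at h ⊢; omega),
        Fin.succAbove_of_le_castSucc _ _ (by
          rw [Fin.lt_def] at h; rw [Fin.le_def]; simp at h ⊢; omega), ← hx]
      rfl
    · have h3 : i.succ < j := by
        rw [Fin.lt_def]; rw [Fin.le_def] at h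
        rw [Ne, Fin.ext_iff] at h1 h2
        simp at h h1 h2 ⊢
        omega
      have h4 : (i : ℕ) < p := by
        rw [Fin.lt_def] at h3
        have := j.2
        simp at h3
        omega
      refine hf _ ⟨i, h4⟩ ?_
      simp only [Function.comp_apply]
      rw [Fin.lt_def] at h3
      rw [Fin.succAbove_of_castSucc_lt _ _ (by rw [Fin.lt_def]; simp at h3 ⊢; omega),
        Fin.succAbove_of_castSucc_lt _ _ (by rw [Fin.lt_def]; simp at h3 ⊢; omega)]
      exact hx
  · simp
  · simp

/-- The Alexander–Spanier differential. -/
def ASFun.d : ASFun X G p →+ ASFun X G (p + 1) :=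
  AddMonoidHom.mk' (fun f => ⟨asDelta f.1, asDelta_mem f.2⟩) fun f g =>
    Subtype.ext (asDelta_add f.1 g.1)

lemma ASFun.d_d (f : ASFun X G p) : ASFun.d (ASFun.d f) = 0 :=
  Subtype.ext (asDelta_asDelta f.1)

variable [TopologicalSpace X]

/-- The functions which vanish near the point `(x, …, x)` of the diagonal. -/
def asZero (X : Type u) [TopologicalSpace X] (G : Type) [AddCommGroup G] (p : ℕ) (x : X) :
    AddSubgroup (ASFun X G p) where
  carrier := {f | ∃ N ∈ nhds x, ∀ y : Fin (p + 1) → X, (∀ i, y i ∈ N) → f.1 y = 0}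
  zero_mem' := ⟨Set.univ, Filter.univ_mem, fun _ _ => rfl⟩
  add_mem' := by
    rintro f g ⟨N, hN, hf⟩ ⟨N', hN', hg⟩
    refine ⟨N ∩ N', Filter.inter_mem hN hN', fun y hy => ?_⟩
    rw [AddSubgroup.coe_add, Pi.add_apply, hf y fun i => (hy i).1, hg y fun i => (hy i).2, add_zero]
  neg_mem' := by
    rintro f ⟨N, hN, hf⟩
    refine ⟨N, hN, fun y hy => ?_⟩
    rw [AddSubgroup.coe_neg, Pi.neg_apply, hf y hy, neg_zero]

/-- Germs of functions along the diagonal. -/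
abbrev ASStalk (X : Type u) [TopologicalSpace X] (G : Type) [AddCommGroup G] (p : ℕ) (x : X) :
    Type u := ASFun X G p ⧸ asZero X G p x

/-- The germ of a function along the diagonal. -/
abbrev asGerm (x : X) (f : ASFun X G p) : ASStalk X G p x := QuotientAddGroup.mk f

lemma asGerm_eq_zero {x : X} {f : ASFun X G p} : asGerm x f = 0 ↔
    ∃ N ∈ nhds x, ∀ y : Fin (p + 1) → X, (∀ i, y i ∈ N) → f.1 y = 0 :=
  QuotientAddGroup.eq_zero_iff f

lemma asGerm_eq {x : X} {f g : ASFun X G p} : asGerm x f = asGerm x g ↔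
    ∃ N ∈ nhds x, ∀ y : Fin (p + 1) → X, (∀ i, y i ∈ N) → f.1 y = g.1 y := by
  rw [← sub_eq_zero]
  refine (asGerm_eq_zero (f := f - g)).trans ?_
  simp only [AddSubgroup.coe_sub, Pi.sub_apply, sub_eq_zero]

/-- The differential on germs. -/
def asStalkD (x : X) : ASStalk X G p x →+ ASStalk X G (p + 1) x :=
  QuotientAddGroup.map _ _ ASFun.d (by
    rintro f ⟨N, hN, hf⟩
    refine ⟨N, hN, fun y hy => ?_⟩
    change asDelta f.1 y = 0
    rw [asDelta]
    refine Finset.sum_eq_zero fun j _ => ?_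
    rw [hf (y ∘ j.succAbove) fun i => hy _, smul_zero])

lemma asStalkD_germ (x : X) (f : ASFun X G p) :
    asStalkD x (asGerm x f) = asGerm x (ASFun.d f) := rfl

/-- The sections of the sheaf of Alexander–Spanier cochains. -/
def ASSec (X : Type u) [TopologicalSpace X] (G : Type) [AddCommGroup G] (p : ℕ) (V : Opens X) :
    AddSubgroup (∀ x : V, ASStalk X G p x) where
  carrier := {s | ∀ x : V, ∃ (W : Opens X) (f : ASFun X G p), x.1 ∈ W ∧
    ∀ y : V, y.1 ∈ W → s y = asGerm y.1 f}
  zero_mem' := fun x => ⟨⊤, 0, trivial, fun _ _ => rfl⟩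
  add_mem' := by
    intro s t hs ht x
    obtain ⟨W, f, hW, hf⟩ := hs x
    obtain ⟨W', g, hW', hg⟩ := ht x
    exact ⟨W ⊓ W', f + g, ⟨hW, hW'⟩, fun y hy => by
      rw [Pi.add_apply, hf y hy.1, hg y hy.2]; rfl⟩
  neg_mem' := by
    intro s hs x
    obtain ⟨W, f, hW, hf⟩ := hs x
    exact ⟨W, -f, hW, fun y hy => by rw [Pi.neg_apply, hf y hy]; rfl⟩

/-- Restriction of Alexander–Spanier cochains. -/
def ASSec.res {V W : Opens X} (h : W ≤ V) : ASSec X G p V →+ ASSec X G p W where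
  toFun s := ⟨fun x => s.1 ⟨x, h x.2⟩, fun x => by
    obtain ⟨O, f, hO, hf⟩ := s.2 ⟨x, h x.2⟩
    exact ⟨O, f, hO, fun y hy => hf ⟨y, h y.2⟩ hy⟩⟩
  map_zero' := rfl
  map_add' _ _ := rfl

/-- The differential of Alexander–Spanier cochains. -/
def ASSec.d {V : Opens X} : ASSec X G p V →+ ASSec X G (p + 1) V :=
  AddMonoidHom.mk' (fun s => ⟨fun x => asStalkD x.1 (s.1 x), fun x => by
    obtain ⟨O, f, hO, hf⟩ := s.2 x
    exact ⟨O, ASFun.d f, hO, fun y hy =>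
      congrArg (asStalkD y.1) (hf y hy)⟩⟩) fun s t => by
      ext1; funext x; exact map_add _ _ _

/-- The section given by a function. -/
def ASSec.ofFun (V : Opens X) (f : ASFun X G p) : ASSec X G p V :=
  ⟨fun x => asGerm x.1 f, fun _ => ⟨⊤, f, trivial, fun _ _ => rfl⟩⟩

lemma ASSec.d_ofFun (V : Opens X) (f : ASFun X G p) :
    ASSec.d (ASSec.ofFun V f) = ASSec.ofFun V (ASFun.d f) := rfl

lemma ASSec.d_d {V : Opens X} (s : ASSec X G p V) : ASSec.d (ASSec.d s) = 0 := by
  ext1; funext x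
  obtain ⟨f, hf⟩ := QuotientAddGroup.mk_surjective (s.1 x)
  change asStalkD x.1 (asStalkD x.1 (s.1 x)) = 0
  rw [← hf]
  exact congrArg (asGerm x.1) (ASFun.d_d f)

/-- Alexander–Spanier cochains form a local predicate. -/
def asPred (X : Type u) [TopologicalSpace X] (G : Type) [AddCommGroup G] (p : ℕ) :
    TopCat.LocalPredicate (X := TopCat.of X) fun x => ASStalk X G p x where
  pred {V} s := s ∈ ASSec X G p V
  res {_ _} i s hs := (ASSec.res (X := X) i.le ⟨s, hs⟩).2
  locality {V} s H := fun x => by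
    obtain ⟨W, hx, i, h⟩ := H x
    obtain ⟨O, f, hO, hf⟩ := h ⟨x, hx⟩
    exact ⟨O ⊓ W, f, ⟨hO, hx⟩, fun y hy => hf ⟨y, hy.2⟩ hy.1⟩

/-- A presheaf of abelian groups whose sections are the dependent functions satisfying a local
predicate is a sheaf. -/
lemma isSheaf_of_localPredicate {X : TopCat.{u}} {T : X → Type u} (P : TopCat.LocalPredicate T)
    (F : TopCat.Presheaf AddCommGrpCat.{u} X)
    (e : F ⋙ forget AddCommGrpCat.{u} ≅ TopCat.subpresheafToTypes P.toPrelocalPredicate) :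
    F.IsSheaf := by
  rw [TopCat.Presheaf.isSheaf_iff_isSheaf_comp (forget AddCommGrpCat.{u}) F]
  exact TopCat.Presheaf.isSheaf_of_iso e.symm (TopCat.subpresheafToTypes.isSheaf P)

/-- The sheaf of Alexander–Spanier cochains. -/
def asSheaf (X : Type u) [TopologicalSpace X] (G : Type) [AddCommGroup G] (p : ℕ) :
    TopCat.Sheaf AddCommGrpCat.{u} (TopCat.of X) where
  obj :=
    { obj := fun V => AddCommGrpCat.of (ASSec X G p V.unop)
      map := fun i => AddCommGrpCat.ofHom (ASSec.res (X := X) i.unop.le) }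
  property := isSheaf_of_localPredicate (asPred X G p) _
    (NatIso.ofComponents (fun _ => Iso.refl _))

/-- The differential of the complex of Alexander–Spanier cochains. -/
def asHom (X : Type u) [TopologicalSpace X] (G : Type) [AddCommGroup G] (p : ℕ) :
    asSheaf X G p ⟶ asSheaf X G (p + 1) :=
  ObjectProperty.homMk
    { app := fun _ => AddCommGrpCat.ofHom ASSec.d
      naturality := fun _ _ i => by ext s; rfl }

lemma asHom_asHom (p : ℕ) : asHom X G p ≫ asHom X G (p + 1) = 0 :=
  sheafHom_ext _ _ fun _ s => ASSec.d_d s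

/-- The complex of Alexander–Spanier cochains is locally exact. -/
lemma asHom_locally_exact {V : Opens X} (s : ASSec X G (p + 1) V) (hs : ASSec.d s = 0)
    (x : X) (hx : x ∈ V) : ∃ (W : Opens X) (i : W ≤ V) (t : ASSec X G p W), x ∈ W ∧
      ASSec.d t = ASSec.res i s := by
  obtain ⟨W, f, hW, hf⟩ := s.2 ⟨x, hx⟩
  have h1 : asGerm x (ASFun.d f) = 0 := by
    rw [← asStalkD_germ, ← hf ⟨x, hx⟩ hW]
    exact congrFun (congrArg Subtype.val hs) ⟨x, hx⟩
  obtain ⟨N, hN, hf'⟩ := asGerm_eq_zero.1 h1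
  -- Cone with apex `x`: the cocycle condition at (x, z) says that δg(z) = f(z) for z near `x`.
  let g : ASFun X G p := ⟨fun y => f.1 (Fin.cons x y), fun y i hy => by
    refine f.2 _ i.succ ?_
    rw [← Fin.succ_castSucc, Fin.cons_succ, Fin.cons_succ]
    exact hy⟩
  refine ⟨⟨interior N, isOpen_interior⟩ ⊓ (W ⊓ V), inf_le_right.trans inf_le_right,
    ASSec.ofFun _ g, ⟨mem_interior_iff_mem_nhds.2 hN, hW, hx⟩, ?_⟩
  rw [ASSec.d_ofFun]
  ext1; funext y
  refine Eq.trans ?_ (hf ⟨y, y.2.2.2⟩ y.2.2.1).symm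
  refine asGerm_eq.2 ⟨interior N, isOpen_interior.mem_nhds y.2.1, fun z hz => ?_⟩
  have h2 := hf' (Fin.cons x z) fun i => by
    refine Fin.cases ?_ (fun i => ?_) i
    · exact mem_of_mem_nhds hN
    · exact interior_subset (hz i)
  change asDelta f.1 _ = 0 at h2
  rw [asDelta, Fin.sum_univ_succ] at h2
  simp only [Fin.val_zero, pow_zero, one_smul, Fin.val_succ, pow_succ, mul_neg, mul_one, neg_smul,
    Finset.sum_neg_distrib, add_neg_eq_zero] at h2
  refine Eq.trans ?_ h2.symm
  change asDelta g.1 z = _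
  rw [asDelta]
  refine Finset.sum_congr rfl fun j _ => ?_
  congr 1
  refine congrArg f.1 (funext fun k => ?_)
  refine Fin.cases ?_ (fun k => ?_) k
  · simp
  · simp

end AlexanderSpanier

/-! ### Locally finite choices of indices on paracompact open sets -/

section Patching

variable {X : Type u} [TopologicalSpace X]

open Filter Topology

/-- For an open cover of a paracompact open set there is a choice of indices which near each
point takes only finitely many values, all of which are indices of neighbourhoods of the point. -/
lemma exists_locally_finite_choice [T2Space X] {ι : Type v} (U : ι → Opens X) (W : Opens X)
    [ParacompactSpace W] (hW : W ≤ ⨆ i, U i) :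
    ∃ i : X → Option ι, ∀ y ∈ W, ∃ J : Set ι, J.Finite ∧ (∀ j ∈ J, y ∈ U j) ∧
      ∀ᶠ z in 𝓝 y, ∃ j ∈ J, i z = some j := by
  classical
  obtain ⟨v, hvo, hvU, hvf, hvs⟩ := precise_refinement (X := W)
    (fun i => Subtype.val ⁻¹' (U i : Set X)) (fun i => (U i).isOpen.preimage continuous_subtype_val)
    (Set.eq_univ_of_forall fun x => Set.mem_iUnion.2 (Opens.mem_iSup.1 (hW x.2)))
  -- Shrinking to closed sets ensures that points near `y` lie only in those members that contain
  -- `y` itself.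
  obtain ⟨c, hcU, hc⟩ := exists_iUnion_eq_closed_subset hvo (fun x => hvf.point_finite x) hvU
  have hcf : LocallyFinite c := hvf.subset hc.2
  have hex : ∀ x : W, ∃ i, x ∈ c i := fun x => Set.mem_iUnion.1 (hcU ▸ Set.mem_univ x)
  choose i hi using hex
  refine ⟨fun x => if h : x ∈ W then some (i ⟨x, h⟩) else none, fun y hy =>
    ⟨{j | (⟨y, hy⟩ : W) ∈ c j}, hcf.point_finite _, fun j hj => hvs j (hc.2 j hj), ?_⟩⟩
  have h1 := hcf.iInter_compl_mem_nhds hc.1 ⟨y, hy⟩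
  rw [nhds_subtype_eq_comap, mem_comap] at h1
  obtain ⟨t, ht, hts⟩ := h1
  filter_upwards [ht, W.isOpen.mem_nhds hy] with z hz hzW
  refine ⟨i ⟨z, hzW⟩, ?_, dif_pos (show z ∈ W from hzW)⟩
  by_contra h2
  have h3 := hts (show (⟨z, hzW⟩ : W) ∈ Subtype.val ⁻¹' t from hz)
  exact Set.mem_iInter₂.1 h3 _ h2 (hi _)

end Patching

/-! ### Čech acyclicity of Alexander–Spanier sheaves -/

section ASAcyclic

open Filter Topology

variable {X : Type u} [TopologicalSpace X] {G : Type} [AddCommGroup G] {p : ℕ} {ι : Type v}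

/-- The function which agrees with `g j` where the first argument has index `j`. -/
def asComb (i : X → Option ι) (g : ι → ASFun X G p) : ASFun X G p :=
  ⟨fun z => ((i (z 0)).elim 0 g).1 z, fun z k h => ((i (z 0)).elim 0 g).2 z k h⟩

/-- Near `y` only the finitely many indices in `J` occur, so their neighbourhoods of agreement can
be intersected. -/
lemma asGerm_comb_eq {i : X → Option ι} {y : X} {J : Set ι} (hJ : J.Finite)
    (hi : ∀ᶠ z in 𝓝 y, ∃ j ∈ J, i z = some j) {g g' : ι → ASFun X G p}
    (h : ∀ j ∈ J, asGerm y (g j) = asGerm y (g' j)) :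
    asGerm y (asComb i g) = asGerm y (asComb i g') := by
  choose! N hN hg using fun j hj => asGerm_eq.1 (h j hj)
  refine asGerm_eq.2 ⟨_, inter_mem hi ((biInter_mem hJ).2 hN), fun z hz => ?_⟩
  obtain ⟨j, hj, hij⟩ := (hz 0).1
  simp only [asComb, hij, Option.elim_some]
  exact hg j hj z fun k => Set.mem_iInter₂.1 (hz k).2 j hj

lemma asGerm_comb_const {i : X → Option ι} {y : X} {J : Set ι}
    (hi : ∀ᶠ z in 𝓝 y, ∃ j ∈ J, i z = some j) (g : ASFun X G p) :
    asGerm y (asComb i fun _ => g) = asGerm y g := by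
  refine asGerm_eq.2 ⟨_, hi, fun z hz => ?_⟩
  obtain ⟨j, hj, hij⟩ := hz 0
  simp only [asComb, hij, Option.elim_some]

/-- The combination of germs. -/
def asCombGerm (i : X → Option ι) (y : X) (a : ι → ASStalk X G p y) : ASStalk X G p y :=
  asGerm y (asComb i fun j => (a j).out)

lemma asCombGerm_eq {i : X → Option ι} {y : X} {J : Set ι} (hJ : J.Finite)
    (hi : ∀ᶠ z in 𝓝 y, ∃ j ∈ J, i z = some j) {a : ι → ASStalk X G p y} {g : ι → ASFun X G p}
    (h : ∀ j ∈ J, asGerm y (g j) = a j) : asCombGerm i y a = asGerm y (asComb i g) :=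
  asGerm_comb_eq hJ hi fun j hj => (QuotientAddGroup.out_eq' (a j)).trans (h j hj).symm

lemma asCombGerm_add {i : X → Option ι} {y : X} {J : Set ι} (hJ : J.Finite)
    (hi : ∀ᶠ z in 𝓝 y, ∃ j ∈ J, i z = some j) (a b : ι → ASStalk X G p y) :
    asCombGerm i y (a + b) = asCombGerm i y a + asCombGerm i y b := by
  rw [asCombGerm_eq hJ hi (g := fun j => (a j).out + (b j).out) fun j _ => by
    rw [Pi.add_apply, ← QuotientAddGroup.out_eq' (a j), ← QuotientAddGroup.out_eq' (b j)]
    simp only [QuotientAddGroup.out_eq']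
    exact congrArg₂ (· + ·) (QuotientAddGroup.out_eq' (a j)) (QuotientAddGroup.out_eq' (b j))]
  refine (congrArg (asGerm y) (Subtype.ext (funext fun z => ?_))).trans
    (QuotientAddGroup.mk_add _ _ _)
  simp only [asComb, AddSubgroup.coe_add, Pi.add_apply]
  cases i (z 0) with
  | none => simp
  | some j => simp

open Classical in
/-- Extension by zero of an Alexander–Spanier cochain. -/
def asExtend {V : Opens X} (s : ASSec X G p V) (y : X) : ASStalk X G p y :=
  if h : y ∈ V then s.1 ⟨y, h⟩ else 0

lemma asExtend_of_mem {V : Opens X} (s : ASSec X G p V) {y : X} (h : y ∈ V) :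
    asExtend s y = s.1 ⟨y, h⟩ := dif_pos h

lemma asExtend_of_notMem {V : Opens X} (s : ASSec X G p V) {y : X} (h : y ∉ V) :
    asExtend s y = 0 := dif_neg h

lemma asExtend_add {V : Opens X} (s t : ASSec X G p V) (y : X) :
    asExtend (s + t) y = asExtend s y + asExtend t y := by
  by_cases h : y ∈ V
  · simp only [asExtend_of_mem _ h]; rfl
  · simp only [asExtend_of_notMem _ h, add_zero]

/-- Around each point finitely many indices matter. One representing function for each of them,
combined according to the index of the first argument, represents the combined section on a whole
neighbourhood. -/
lemma asCombGerm_mem (U : ι → Opens X) (i : X → Option ι) (V : Opens X)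
    (hi : ∀ y ∈ V, ∃ J : Set ι, J.Finite ∧ (∀ j ∈ J, y ∈ U j) ∧
      ∀ᶠ z in 𝓝 y, ∃ j ∈ J, i z = some j) (s : ∀ j, ASSec X G p (U j ⊓ V)) :
    (fun y : V => asCombGerm i y.1 fun j => asExtend (s j) y) ∈ ASSec X G p V := by
  intro x
  obtain ⟨J, hJ, hJU, hJi⟩ := hi x x.2
  choose! W f hW hf using fun (j : ι) (hj : j ∈ J) => (s j).2 ⟨x, hJU j hj, x.2⟩
  have hO : (⋂ j ∈ J, ((W j ⊓ U j : Opens X) : Set X)) ∈ 𝓝 x.1 :=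
    (biInter_mem hJ).2 fun j hj => (W j ⊓ U j).isOpen.mem_nhds ⟨hW j hj, hJU j hj⟩
  -- The set `J` attached to `x` must serve at all nearby points `y` too, hence the iterated
  -- "eventually".
  obtain ⟨O, hO1, hO2, hO3⟩ := eventually_nhds_iff.1
    ((eventually_eventually_nhds.2 hJi).and (eventually_mem_set.2 hO))
  refine ⟨⟨O, hO2⟩, asComb i f, hO3, fun y hy => asCombGerm_eq hJ (hO1 y hy).1 fun j hj => ?_⟩
  have h1 := Set.mem_iInter₂.1 (hO1 y hy).2 j hj
  rw [asExtend_of_mem _ (show y.1 ∈ U j ⊓ V from ⟨h1.2, y.2⟩)]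
  exact (hf j hj ⟨y, h1.2, y.2⟩ h1.1).symm

/-- A locally finite choice of indices gives a splitting of the sheaves of Alexander–Spanier
cochains. -/
def asSplitting (U : ι → Opens X) (i : X → Option ι)
    (hi : ∀ y ∈ (⨆ j, U j : Opens X), ∃ J : Set ι, J.Finite ∧ (∀ j ∈ J, y ∈ U j) ∧
      ∀ᶠ z in 𝓝 y, ∃ j ∈ J, i z = some j) :
    CechSplitting (X := TopCat.of X) U (asSheaf X G p) where
  R V h := AddMonoidHom.mk' (fun s => (⟨_, asCombGerm_mem U i V (fun y hy => hi y (h hy)) s⟩ :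
      ASSec X G p V)) fun s t => by
    refine Subtype.ext (funext fun y => ?_)
    obtain ⟨J, hJ, -, hJi⟩ := hi y (h y.2)
    exact (congrArg (asCombGerm i y.1) (funext fun j => asExtend_add (V := U j ⊓ V) (s j) (t j) y)).trans
      (asCombGerm_add hJ hJi _ _)
  res V W h hW s := by
    refine Subtype.ext (funext fun y => congrArg (asCombGerm i y.1) (funext fun j => ?_))
    by_cases hy : y.1 ∈ U j
    · refine (asExtend_of_mem (V := U j ⊓ V) (s j) ⟨hy, hW y.2⟩).trans ?_
      exact (asExtend_of_mem (V := U j ⊓ W) (ASSec.res (inf_le_inf_left (U j) hW) (s j))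
        ⟨hy, y.2⟩).symm
    · refine (asExtend_of_notMem (V := U j ⊓ V) (s j) fun h => hy h.1).trans ?_
      exact (asExtend_of_notMem (V := U j ⊓ W) (ASSec.res (inf_le_inf_left (U j) hW) (s j))
        fun h => hy h.1).symm
  R_res V h s := by
    refine Subtype.ext (funext fun y => ?_)
    obtain ⟨J, hJ, hJU, hJi⟩ := hi y (h y.2)
    obtain ⟨f, hf⟩ := QuotientAddGroup.mk_surjective ((s : ASSec X G p V).1 y)
    refine (asCombGerm_eq hJ hJi (g := fun _ => f) fun j hj => ?_).trans
      ((asGerm_comb_const hJi f).trans hf)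
    exact hf.trans (asExtend_of_mem (V := U j ⊓ V) (ASSec.res inf_le_right s) ⟨hJU j hj, y.2⟩).symm

lemma asSheaf_cechAcyclic [T2Space X] [LocallyCompactSpace X] (V : Opens X)
    [SecondCountableTopology V] :
    CechAcyclic (X := TopCat.of X) (asSheaf X G p) V := by
  intro ι U hU p c hc
  have hle : (⨆ i, U i : Opens X) ≤ V := iSup_le hU
  have : SecondCountableTopology ↥(⨆ i, U i : Opens X) :=
    (Topology.IsEmbedding.inclusion hle).secondCountableTopology
  have : LocallyCompactSpace ↥(⨆ i, U i : Opens X) :=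
    (⨆ i, U i : Opens X).isOpen.locallyCompactSpace
  obtain ⟨i, hi⟩ := exists_locally_finite_choice (X := X) U (⨆ i, U i) le_rfl
  exact (asSplitting U i hi).exact _ c hc

/-- On a paracompact open set every Alexander–Spanier cochain is given by a function. -/
lemma exists_ofFun_eq [T2Space X] (V : Opens X) [ParacompactSpace V] (s : ASSec X G p V) :
    ∃ f, ASSec.ofFun V f = s := by
  choose W f hW hf using s.2
  obtain ⟨i, hi⟩ := exists_locally_finite_choice W V fun x hx =>
    Opens.mem_iSup.2 ⟨⟨x, hx⟩, hW ⟨x, hx⟩⟩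
  refine ⟨asComb i f, Subtype.ext (funext fun y => ?_)⟩
  obtain ⟨J, hJ, hJW, hJi⟩ := hi y y.2
  obtain ⟨g, hg⟩ := QuotientAddGroup.mk_surjective (s.1 y)
  refine (asGerm_comb_eq hJ hJi (g' := fun _ => g) fun j hj => ?_).trans
    ((asGerm_comb_const hJi g).trans hg)
  exact (hf j y (hJW j hj)).symm.trans hg.symm

end ASAcyclic

/-! ### Cutting a contraction into small steps -/

section Contraction

open Filter Topology

variable {Y : Type u} [TopologicalSpace Y]

/-- A Lebesgue number with parameter: compactness of [0, 1] yields one `ε` and one neighbourhood of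
`x` valid for all times. -/
lemma exists_uniform_step {ι : Type v} {O : ι → Set Y} (hO : ∀ i, IsOpen (O i))
    (hc : ∀ y, ∃ i, y ∈ O i) {F : ℝ → Y → Y} (hF : Continuous fun q : ℝ × Y => F q.1 q.2) (x : Y) :
    ∃ ε > 0, ∃ N ∈ 𝓝 x, ∀ t ∈ Set.Icc (0 : ℝ) 1, ∃ i, ∀ t', |t' - t| < ε → ∀ y ∈ N,
      F t' y ∈ O i := by
  refine isCompact_Icc.induction_on (p := fun s => ∃ ε > 0, ∃ N ∈ 𝓝 x, ∀ t ∈ s, ∃ i, ∀ t',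
    |t' - t| < ε → ∀ y ∈ N, F t' y ∈ O i) ?_ ?_ ?_ ?_
  · exact ⟨1, one_pos, Set.univ, univ_mem, by simp⟩
  · rintro s t hst ⟨ε, hε, N, hN, h⟩
    exact ⟨ε, hε, N, hN, fun a ha => h a (hst ha)⟩
  · rintro s t ⟨ε, hε, N, hN, h⟩ ⟨ε', hε', N', hN', h'⟩
    refine ⟨min ε ε', lt_min hε hε', N ∩ N', inter_mem hN hN', ?_⟩
    rintro a (ha | ha)
    · obtain ⟨i, hi⟩ := h a ha
      exact ⟨i, fun b hb y hy => hi b (hb.trans_le (min_le_left _ _)) y hy.1⟩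
    · obtain ⟨i, hi⟩ := h' a ha
      exact ⟨i, fun b hb y hy => hi b (hb.trans_le (min_le_right _ _)) y hy.2⟩
  · intro t _
    obtain ⟨i, hi⟩ := hc (F t x)
    have h1 : ∀ᶠ q : ℝ × Y in 𝓝 (t, x), F q.1 q.2 ∈ O i :=
      hF.continuousAt.eventually ((hO i).mem_nhds hi)
    rw [nhds_prod_eq] at h1
    obtain ⟨s, hs, N, hN, h2⟩ := mem_prod_iff.1 h1
    obtain ⟨ε, hε, hb⟩ := Metric.mem_nhds_iff.1 hs
    -- Half the radius, so that a time within ε/2 of a time in this ball is within ε of `t`.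
    refine ⟨Metric.ball t (ε / 2), mem_nhdsWithin_of_mem_nhds (Metric.ball_mem_nhds _ (by positivity)),
      ε / 2, by positivity, N, hN, fun a ha => ⟨i, fun b hba y hy => ?_⟩⟩
    refine h2 (show (b, y) ∈ s ×ˢ N from ⟨hb ?_, hy⟩)
    rw [Metric.mem_ball, Real.dist_eq] at ha ⊢
    calc |b - t| = |(b - a) + (a - t)| := by ring_nf
      _ ≤ |b - a| + |a - t| := abs_add_le _ _
      _ < ε := by linarith

/-- A contractible paracompact space is contracted by maps which move points in small steps. -/
lemma exists_small_steps [T2Space Y] [ParacompactSpace Y] [ContractibleSpace Y] {ι : Type v}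
    {O : ι → Set Y} (hO : ∀ i, IsOpen (O i)) (hc : ∀ y, ∃ i, y ∈ O i) :
    ∃ (γ : ℕ → Y → Y) (y₀ : Y), (∀ y, γ 0 y = y₀) ∧ ∀ x,
      (∃ K, ∀ᶠ y in 𝓝 x, ∀ k ≥ K, γ k y = y) ∧
      ∃ N ∈ 𝓝 x, ∀ k, ∃ i, ∀ y ∈ N, γ k y ∈ O i ∧ γ (k + 1) y ∈ O i := by
  obtain ⟨y₀, ⟨H⟩⟩ := id_nullhomotopic Y
  let F : ℝ → Y → Y := fun t y => H.symm (Set.projIcc 0 1 zero_le_one t, y)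
  have hF : Continuous fun q : ℝ × Y => F q.1 q.2 := by
    refine H.symm.continuous.comp ?_
    exact ((continuous_projIcc (h := zero_le_one)).comp continuous_fst).prodMk continuous_snd
  have hF0 : ∀ y, F 0 y = y₀ := fun y => by
    change H.symm (Set.projIcc 0 1 zero_le_one 0, y) = _
    rw [Set.projIcc_left]
    exact H.symm.apply_zero y
  have hF1 : ∀ y, F 1 y = y := fun y => by
    change H.symm (Set.projIcc 0 1 zero_le_one 1, y) = _
    rw [Set.projIcc_right]
    exact H.symm.apply_one y
  let P : Y → Set ℝ := fun x => {ε | 0 < ε ∧ ∃ N ∈ 𝓝 x, ∀ t ∈ Set.Icc (0 : ℝ) 1, ∃ i, ∀ t',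
    |t' - t| < ε → ∀ y ∈ N, F t' y ∈ O i}
  -- The admissible step sizes at a point form an interval and can locally be chosen constant, so
  -- paracompactness provides a continuous choice.
  obtain ⟨ε, hε⟩ := exists_continuous_forall_mem_convex_of_local_const (t := P) (fun x => by
    refine Set.OrdConnected.convex ⟨?_⟩
    rintro a ⟨ha, -⟩ b ⟨-, N, hN, hb⟩ c ⟨hac, hcb⟩
    refine ⟨ha.trans_le hac, N, hN, fun t ht => ?_⟩
    obtain ⟨i, hi⟩ := hb t ht
    exact ⟨i, fun t' ht' => hi t' (ht'.trans_le hcb)⟩) fun x => by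
    obtain ⟨e, he, N, hN, h⟩ := exists_uniform_step hO hc hF x
    refine ⟨e, ?_⟩
    filter_upwards [eventually_mem_nhds_iff.2 hN] with y hy
    exact ⟨he, N, hy, h⟩
  -- Times advance by a third of the admissible size. Near `x` the drift of `τ k` stays below ε(x)/3
  -- and one step is below ε(x)/2, so together they remain below ε(x).
  let τ : ℕ → Y → ℝ := fun k y => min 1 (k * (ε y / 3))
  have hτ : ∀ k, Continuous (τ k) := fun k => by fun_prop
  refine ⟨fun k y => F (τ k y) y, y₀, fun y => ?_, fun x => ?_⟩
  · have : τ 0 y = 0 := by simp [τ]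
    exact (congrArg (fun t => F t y) this).trans (hF0 y)
  obtain ⟨he, N, hN, h⟩ := hε x
  -- Near `x` one has ε(y) > ε(x)/2, so K · ε(y)/3 exceeds 1 and the contraction is finished after K
  -- steps.
  obtain ⟨K, hK⟩ := exists_nat_gt (6 / ε x)
  have hK' : 6 < K * ε x := by rwa [div_lt_iff₀ he] at hK
  have h1 : ∀ᶠ y in 𝓝 x, ∀ k ≥ K, τ k y = 1 := by
    filter_upwards [ε.continuous.continuousAt.eventually (lt_mem_nhds (half_lt_self he))]
      with y hy k hk
    refine min_eq_left ?_
    have : (K : ℝ) ≤ k := by exact_mod_cast hk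
    nlinarith
  refine ⟨⟨K, h1.mono fun y hy k hk =>
    (congrArg (fun t => F t y) (hy k hk)).trans (hF1 y)⟩, ?_⟩
  -- Continuity is needed only for finitely many k: from K on, both times are equal to 1.
  have h2 : ∀ᶠ y in 𝓝 x, ∀ k ∈ Finset.range K, |τ k y - τ k x| < ε x / 3 := by
    rw [Filter.eventually_all_finset]
    intro k _
    have := (hτ k).continuousAt.eventually (Metric.ball_mem_nhds (τ k x) (ε := ε x / 3)
      (by positivity))
    exact this
  have h3 : ∀ᶠ y in 𝓝 x, ε y < 3 / 2 * ε x :=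
    ε.continuous.continuousAt.eventually (gt_mem_nhds (by linarith))
  refine ⟨_, inter_mem hN (h1.and (h2.and h3)), fun k => ?_⟩
  have hx1 : ∀ k ≥ K, τ k x = 1 := h1.self_of_nhds
  have hτ01 : τ k x ∈ Set.Icc (0 : ℝ) 1 := ⟨le_min zero_le_one (by positivity), min_le_left _ _⟩
  obtain ⟨i, hi⟩ := h (τ k x) hτ01
  refine ⟨i, fun y hy => ?_⟩
  obtain ⟨hyN, hy1, hy2, hy3⟩ := hy
  have hd : |τ k y - τ k x| < ε x / 3 := by
    by_cases hk : k < K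
    · exact hy2 k (Finset.mem_range.2 hk)
    · rw [hy1 k (not_lt.1 hk), hx1 k (not_lt.1 hk)]
      simpa using he
  have hs : |τ (k + 1) y - τ k y| ≤ ε y / 3 := by
    have hpos : 0 < ε y := (hε y).1
    have h5 : ((k + 1 : ℕ) : ℝ) * (ε y / 3) = k * (ε y / 3) + ε y / 3 := by push_cast; ring
    refine (abs_min_sub_min_le_max _ _ _ _).trans ?_
    rw [sub_self, abs_zero, h5, add_sub_cancel_left, abs_of_pos (by positivity)]
    exact max_le (by positivity) le_rfl
  refine ⟨hi _ (hd.trans (by linarith)) y hyN, hi _ ?_ y hyN⟩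
  calc |τ (k + 1) y - τ k x| = |(τ (k + 1) y - τ k y) + (τ k y - τ k x)| := by ring_nf
    _ ≤ |τ (k + 1) y - τ k y| + |τ k y - τ k x| := abs_add_le _ _
    _ < ε x := by linarith

end Contraction

/-! ### Prism operators for Alexander–Spanier cochains -/

section Prism

open Filter Topology

variable {Y : Type u} {G : Type} [AddCommGroup G]

lemma asDelta_one (g : (Fin 2 → Y) → G) (z : Fin 3 → Y) :
    asDelta g z = g ![z 1, z 2] - g ![z 0, z 2] + g ![z 0, z 1] := by
  have h0 : z ∘ Fin.succAbove (0 : Fin 3) = ![z 1, z 2] := by ext i; fin_cases i <;> rfl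
  have h1 : z ∘ Fin.succAbove (1 : Fin 3) = ![z 0, z 2] := by ext i; fin_cases i <;> rfl
  have h2 : z ∘ Fin.succAbove (2 : Fin 3) = ![z 0, z 1] := by ext i; fin_cases i <;> rfl
  refine (Fin.sum_univ_three _).trans ?_
  rw [h0, h1, h2]
  simp [sub_eq_add_neg]

lemma asDelta_two (g : (Fin 3 → Y) → G) (z : Fin 4 → Y) :
    asDelta g z = g ![z 1, z 2, z 3] - g ![z 0, z 2, z 3] + g ![z 0, z 1, z 3] -
      g ![z 0, z 1, z 2] := by
  have h0 : z ∘ Fin.succAbove (0 : Fin 4) = ![z 1, z 2, z 3] := by ext i; fin_cases i <;> rfl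
  have h1 : z ∘ Fin.succAbove (1 : Fin 4) = ![z 0, z 2, z 3] := by ext i; fin_cases i <;> rfl
  have h2 : z ∘ Fin.succAbove (2 : Fin 4) = ![z 0, z 1, z 3] := by ext i; fin_cases i <;> rfl
  have h3 : z ∘ Fin.succAbove (3 : Fin 4) = ![z 0, z 1, z 2] := by ext i; fin_cases i <;> rfl
  refine (Fin.sum_univ_four _).trans ?_
  rw [h0, h1, h2, h3]
  simp [sub_eq_add_neg, pow_succ]

lemma asDelta_three (g : (Fin 4 → Y) → G) (z : Fin 5 → Y) :
    asDelta g z = g ![z 1, z 2, z 3, z 4] - g ![z 0, z 2, z 3, z 4] + g ![z 0, z 1, z 3, z 4] -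
      g ![z 0, z 1, z 2, z 4] + g ![z 0, z 1, z 2, z 3] := by
  have h0 : z ∘ Fin.succAbove (0 : Fin 5) = ![z 1, z 2, z 3, z 4] := by
    ext i; fin_cases i <;> rfl
  have h1 : z ∘ Fin.succAbove (1 : Fin 5) = ![z 0, z 2, z 3, z 4] := by
    ext i; fin_cases i <;> rfl
  have h2 : z ∘ Fin.succAbove (2 : Fin 5) = ![z 0, z 1, z 3, z 4] := by
    ext i; fin_cases i <;> rfl
  have h3 : z ∘ Fin.succAbove (3 : Fin 5) = ![z 0, z 1, z 2, z 4] := by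
    ext i; fin_cases i <;> rfl
  have h4 : z ∘ Fin.succAbove (4 : Fin 5) = ![z 0, z 1, z 2, z 3] := by
    ext i; fin_cases i <;> rfl
  refine (Fin.sum_univ_five _).trans ?_
  rw [h0, h1, h2, h3, h4]
  simp [sub_eq_add_neg, pow_succ]

/-- A prism operator for `f`: a natural homotopy between the pullbacks of `f` along two maps. -/
structure Prism {p : ℕ} (f : ASFun Y G (p + 1)) where
  P (a b : Y → Y) : ASFun Y G p
  eq_zero (a b : Y → Y) (z : Fin (p + 1) → Y) (ha : ∀ i, a (z i) = z i) (hb : ∀ i, b (z i) = z i) :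
    (P a b).1 z = 0
  delta (a b : Y → Y) (z : Fin (p + 2) → Y) (h : ∀ w : Fin (p + 3) → Y,
    (∀ j, ∃ i, w j = a (z i) ∨ w j = b (z i)) → asDelta f.1 w = 0) :
    asDelta (P a b).1 z = f.1 (b ∘ z) - f.1 (a ∘ z)

/-- The prism operator in degree `2`. -/
def prismOne (f : ASFun Y G 2) : Prism f where
  P a b := ⟨fun z => f.1 ![a (z 0), b (z 0), b (z 1)] - f.1 ![a (z 0), a (z 1), b (z 1)], by
    intro z i hz
    have hz : z 0 = z 1 := by fin_cases i; exact hz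
    dsimp only
    rw [f.2 ![a (z 0), b (z 0), b (z 1)] 1 (congrArg b hz),
      f.2 ![a (z 0), a (z 1), b (z 1)] 0 (congrArg a hz), sub_zero]⟩
  eq_zero a b z ha hb := by
    dsimp only
    rw [f.2 ![a (z 0), b (z 0), b (z 1)] 0 ((ha 0).trans (hb 0).symm),
      f.2 ![a (z 0), a (z 1), b (z 1)] 1 ((ha 1).trans (hb 1).symm), sub_zero]
  delta a b z h := by
    -- The prism over a triangle is cut into three tetrahedra; the alternating sum of the cocycle
    -- conditions on them is the homotopy formula.
    have e1 := h ![a (z 0), b (z 0), b (z 1), b (z 2)] fun j => by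
      fin_cases j <;> first | exact ⟨_, Or.inl rfl⟩ | exact ⟨_, Or.inr rfl⟩
    have e2 := h ![a (z 0), a (z 1), b (z 1), b (z 2)] fun j => by
      fin_cases j <;> first | exact ⟨_, Or.inl rfl⟩ | exact ⟨_, Or.inr rfl⟩
    have e3 := h ![a (z 0), a (z 1), a (z 2), b (z 2)] fun j => by
      fin_cases j <;> first | exact ⟨_, Or.inl rfl⟩ | exact ⟨_, Or.inr rfl⟩
    rw [asDelta_two] at e1 e2 e3
    simp only [Matrix.cons_val] at e1 e2 e3
    have ea : a ∘ z = ![a (z 0), a (z 1), a (z 2)] := by ext i; fin_cases i <;> rfl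
    have eb : b ∘ z = ![b (z 0), b (z 1), b (z 2)] := by ext i; fin_cases i <;> rfl
    rw [ea, eb, asDelta_one]
    simp only [Matrix.cons_val]
    rw [← sub_eq_zero]
    have key : ∀ x y w : G, x = 0 → y = 0 → w = 0 → -(x - y + w) = 0 := by
      rintro x y w rfl rfl rfl; simp
    rw [← key _ _ _ e1 e2 e3]
    abel

/-- The prism operator in degree `3`. -/
def prismTwo (f : ASFun Y G 3) : Prism f where
  P a b := ⟨fun z => f.1 ![a (z 0), b (z 0), b (z 1), b (z 2)] -
      f.1 ![a (z 0), a (z 1), b (z 1), b (z 2)] + f.1 ![a (z 0), a (z 1), a (z 2), b (z 2)], by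
    intro z i hz
    dsimp only
    fin_cases i
    · have hz : z 0 = z 1 := hz
      rw [f.2 ![a (z 0), b (z 0), b (z 1), b (z 2)] 1 (congrArg b hz),
        f.2 ![a (z 0), a (z 1), b (z 1), b (z 2)] 0 (congrArg a hz),
        f.2 ![a (z 0), a (z 1), a (z 2), b (z 2)] 0 (congrArg a hz), sub_zero, add_zero]
    · have hz : z 1 = z 2 := hz
      rw [f.2 ![a (z 0), b (z 0), b (z 1), b (z 2)] 2 (congrArg b hz),
        f.2 ![a (z 0), a (z 1), b (z 1), b (z 2)] 2 (congrArg b hz),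
        f.2 ![a (z 0), a (z 1), a (z 2), b (z 2)] 1 (congrArg a hz), sub_zero, add_zero]⟩
  eq_zero a b z ha hb := by
    dsimp only
    rw [f.2 ![a (z 0), b (z 0), b (z 1), b (z 2)] 0 ((ha 0).trans (hb 0).symm),
      f.2 ![a (z 0), a (z 1), b (z 1), b (z 2)] 1 ((ha 1).trans (hb 1).symm),
      f.2 ![a (z 0), a (z 1), a (z 2), b (z 2)] 2 ((ha 2).trans (hb 2).symm), sub_zero, add_zero]
  delta a b z h := by
    -- The prism over a tetrahedron is cut into four 4-simplices, again with alternating signs.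
    have e1 := h ![a (z 0), b (z 0), b (z 1), b (z 2), b (z 3)] fun j => by
      fin_cases j <;> first | exact ⟨_, Or.inl rfl⟩ | exact ⟨_, Or.inr rfl⟩
    have e2 := h ![a (z 0), a (z 1), b (z 1), b (z 2), b (z 3)] fun j => by
      fin_cases j <;> first | exact ⟨_, Or.inl rfl⟩ | exact ⟨_, Or.inr rfl⟩
    have e3 := h ![a (z 0), a (z 1), a (z 2), b (z 2), b (z 3)] fun j => by
      fin_cases j <;> first | exact ⟨_, Or.inl rfl⟩ | exact ⟨_, Or.inr rfl⟩
    have e4 := h ![a (z 0), a (z 1), a (z 2), a (z 3), b (z 3)] fun j => by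
      fin_cases j <;> first | exact ⟨_, Or.inl rfl⟩ | exact ⟨_, Or.inr rfl⟩
    rw [asDelta_three] at e1 e2 e3 e4
    simp only [Matrix.cons_val] at e1 e2 e3 e4
    have ea : a ∘ z = ![a (z 0), a (z 1), a (z 2), a (z 3)] := by ext i; fin_cases i <;> rfl
    have eb : b ∘ z = ![b (z 0), b (z 1), b (z 2), b (z 3)] := by ext i; fin_cases i <;> rfl
    rw [ea, eb, asDelta_two]
    simp only [Matrix.cons_val]
    rw [← sub_eq_zero]
    have key : ∀ x y w t : G, x = 0 → y = 0 → w = 0 → t = 0 → -(x - y + w - t) = 0 := by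
      rintro x y w t rfl rfl rfl rfl; simp
    rw [← key _ _ _ _ e1 e2 e3 e4]
    abel

/-- The sum of the prisms between consecutive maps of the contraction has a telescoping
differential, leaving f at the final map minus f at the initial one. The final map is locally the
identity; the initial map is constant, so that normalization of `f` kills its term. -/
lemma Prism.exists_primitive [TopologicalSpace Y] [T2Space Y] [ParacompactSpace Y]
    [ContractibleSpace Y] {p : ℕ} {f : ASFun Y G (p + 1)} (P : Prism f) {ι : Type v} {O : ι → Set Y}
    (hO : ∀ i, IsOpen (O i)) (hc : ∀ y, ∃ i, y ∈ O i)
    (hf : ∀ i (w : Fin (p + 3) → Y), (∀ j, w j ∈ O i) → asDelta f.1 w = 0) :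
    ∃ g : ASFun Y G p, ∀ x, ∃ N ∈ 𝓝 x, ∀ z : Fin (p + 2) → Y, (∀ j, z j ∈ N) →
      asDelta g.1 z = f.1 z := by
  obtain ⟨γ, y₀, hγ0, hγ⟩ := exists_small_steps hO hc
  have hK : ∀ x, ∃ K, ∀ k ≥ K, γ k x = x := fun x => by
    obtain ⟨K, hK⟩ := (hγ x).1
    exact ⟨K, hK.self_of_nhds⟩
  choose K hK using hK
  -- The number of terms depends on the tuple. Prisms between maps that fix the tuple vanish, so any
  -- larger bound gives the same sum, and near `x` a common bound `L` works.
  refine ⟨⟨fun z => ∑ k ∈ Finset.range (Finset.univ.sup fun i => K (z i)),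
    (P.P (γ k) (γ (k + 1))).1 z, fun z i hz =>
      Finset.sum_eq_zero fun k _ => (P.P (γ k) (γ (k + 1))).2 z i hz⟩, fun x => ?_⟩
  obtain ⟨⟨L, hL⟩, N, hN, h⟩ := hγ x
  refine ⟨_, inter_mem hL hN, fun z hz => ?_⟩
  have hsum : ∀ w : Fin (p + 1) → Y, (∀ i, ∀ k ≥ L, γ k (w i) = w i) →
      ∑ k ∈ Finset.range (Finset.univ.sup fun i => K (w i)), (P.P (γ k) (γ (k + 1))).1 w =
      ∑ k ∈ Finset.range L, (P.P (γ k) (γ (k + 1))).1 w := by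
    intro w hw
    have aux : ∀ n, (∀ i, ∀ k ≥ n, γ k (w i) = w i) → ∀ n' ≥ n,
        ∑ k ∈ Finset.range n', (P.P (γ k) (γ (k + 1))).1 w =
        ∑ k ∈ Finset.range n, (P.P (γ k) (γ (k + 1))).1 w := by
      intro n hn n' hn'
      refine (Finset.sum_subset (Finset.range_mono hn') fun k _ hk => ?_).symm
      have hk : n ≤ k := by simpa using hk
      exact P.eq_zero _ _ _ (fun i => hn i k hk) fun i => hn i (k + 1) (by omega)
    rw [← aux _ (fun i k hk => hK (w i) k ((Finset.le_sup (f := fun i => K (w i))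
      (Finset.mem_univ i)).trans hk)) _ (le_max_left _ L), aux L hw _ (le_max_right _ L)]
  have h1 : asDelta (fun z : Fin (p + 1) → Y => ∑ k ∈ Finset.range (Finset.univ.sup fun i => K (z i)),
      (P.P (γ k) (γ (k + 1))).1 z) z =
      ∑ k ∈ Finset.range L, asDelta (P.P (γ k) (γ (k + 1))).1 z := by
    simp only [asDelta]
    rw [Finset.sum_comm]
    refine Finset.sum_congr rfl fun j _ => ?_
    rw [hsum (z ∘ j.succAbove) fun i => (hz _).1, Finset.smul_sum]
  refine h1.trans ?_
  have h2 : ∀ k, asDelta (P.P (γ k) (γ (k + 1))).1 z =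
      f.1 (γ (k + 1) ∘ z) - f.1 (γ k ∘ z) := fun k => by
    obtain ⟨i, hi⟩ := h k
    -- The step is small: all vertices of the prism lie in one set on which `f` is closed.
    refine P.delta _ _ _ fun w hw => hf i w fun j => ?_
    obtain ⟨l, hl | hl⟩ := hw j
    · rw [hl]; exact (hi _ (hz l).2).1
    · rw [hl]; exact (hi _ (hz l).2).2
  simp only [h2]
  rw [Finset.sum_range_sub fun k => f.1 (γ k ∘ z)]
  have h3 : γ L ∘ z = z := funext fun j => (hz j).1 L le_rfl
  have h4 : f.1 (γ 0 ∘ z) = 0 := f.2 _ 0 ((hγ0 _).trans (hγ0 _).symm)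
  rw [h3, h4, sub_zero]

end Prism

/-! ### Alexander–Spanier cocycles on contractible open sets -/

section Vanishing

open Filter Topology

variable {X : Type u} [TopologicalSpace X] {G : Type} [AddCommGroup G] {p : ℕ}

/-- Alexander–Spanier cocycles on a contractible open set are coboundaries. -/
lemma exists_asd_eq [T2Space X] (V : Opens X) [ParacompactSpace V] [ContractibleSpace V]
    (P : ∀ f : ASFun V G (p + 1), Nonempty (Prism f)) (s : ASSec X G (p + 1) V)
    (hs : ASSec.d s = 0) : ∃ t : ASSec X G p V, ASSec.d t = s := by
  classical
  obtain ⟨f, rfl⟩ := exists_ofFun_eq V s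
  let f' : ASFun V G (p + 1) := ⟨fun z => f.1 fun i => z i, fun z i hz =>
    f.2 _ i (congrArg Subtype.val hz)⟩
  have h1 : ∀ y : V, ∃ O : Set V, IsOpen O ∧ y ∈ O ∧ ∀ w : Fin (p + 3) → V, (∀ j, w j ∈ O) →
      asDelta f'.1 w = 0 := fun y => by
    obtain ⟨N, hN, h⟩ := asGerm_eq_zero.1 (congrFun (congrArg Subtype.val hs) y)
    refine ⟨Subtype.val ⁻¹' interior N, isOpen_interior.preimage continuous_subtype_val,
      mem_interior_iff_mem_nhds.2 hN, fun w hw => ?_⟩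
    exact h (fun j => w j) fun j => interior_subset (hw j)
  choose O hO hmem h using h1
  obtain ⟨P⟩ := P f'
  obtain ⟨g, hg⟩ := P.exists_primitive hO (fun y => ⟨y, hmem y⟩) h
  -- Extension by zero is harmless, since the germs at points of `V` only see tuples in `V`.
  let g' : ASFun X G p := ⟨fun z => if hz : ∀ i, z i ∈ V then g.1 fun i => ⟨z i, hz i⟩ else 0,
    fun z i hz => by
      dsimp only
      split_ifs with h'
      · exact g.2 _ i (Subtype.ext hz)
      · rfl⟩
  refine ⟨ASSec.ofFun V g', ?_⟩
  rw [ASSec.d_ofFun]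
  refine Subtype.ext (funext fun x => asGerm_eq.2 ?_)
  obtain ⟨N, hN, hgN⟩ := hg x
  refine ⟨Subtype.val '' N, V.isOpenEmbedding'.isOpenMap.image_mem_nhds hN, fun z hz => ?_⟩
  choose w hw hwz using hz
  obtain rfl : (fun i => (w i : X)) = z := funext hwz
  refine Eq.trans ?_ (hgN w hw)
  change asDelta g'.1 _ = _
  rw [asDelta, asDelta]
  refine Finset.sum_congr rfl fun j _ => ?_
  congr 1
  exact dif_pos fun i => (w _).2

end Vanishing

/-! ### Cutting exact sequences into short exact ones -/

section Exactness

variable {C : Type*} [Category C] [Abelian C] {Z A B D : C} (i : Z ⟶ A) (f : A ⟶ B) (g : B ⟶ D)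
  (w : i ≫ f = 0) (w' : f ≫ g = 0)

/-- The sequence `Z ⟶ A ⟶ ker g` given by `Z ⟶ A ⟶ B ⟶ D`. -/
def kernelSequence : ShortComplex C where
  X₁ := Z
  X₂ := A
  X₃ := kernel g
  f := i
  g := kernel.lift g f w'
  zero := by rw [← cancel_mono (kernel.ι g), Category.assoc, kernel.lift_ι, w, zero_comp]

variable {i f g w w'}

lemma kernelSequence_shortExact [Mono i] (h : (ShortComplex.mk i f w).Exact)
    (h' : (ShortComplex.mk f g w').Exact) : (kernelSequence i f g w w').ShortExact where
  exact := by
    have : Mono (kernelSequence i f g w w').f := ‹Mono i›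
    refine ShortComplex.exact_of_f_is_kernel _ (KernelFork.IsLimit.ofι' _ _ fun {T} k hk => ?_)
    refine ⟨h.lift k ?_, h.lift_f k _⟩
    have h2 : kernel.lift g f w' ≫ kernel.ι g = f := kernel.lift_ι ..
    change k ≫ f = 0
    refine (congrArg (k ≫ ·) h2.symm).trans ?_
    exact (Category.assoc _ _ _).symm.trans ((congrArg (· ≫ kernel.ι g) hk).trans zero_comp)
  mono_f := ‹Mono i›
  epi_g := h'.epi_kernelLift

variable {X : TopCat.{u}} {F G H : TopCat.Sheaf AddCommGrpCat.{u} X}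

/-- Exactness means that the map to the kernel is an epimorphism, and for sheaves this is local
surjectivity. -/
lemma exact_of_locally_exact (f : F ⟶ G) (g : G ⟶ H) (w : f ≫ g = 0)
    (h : ∀ (V : Opens X) (s : Sec G V), secMap g V s = 0 → ∀ x ∈ V,
      ∃ (W : Opens X) (i : W ≤ V) (t : Sec F W), x ∈ W ∧ secMap f W t = secRes G i s) :
    (ShortComplex.mk f g w).Exact := by
  rw [ShortComplex.exact_iff_epi_kernel_lift, epi_iff_locally_surjective]
  intro V s x hx
  obtain ⟨W, i, t, hxW, ht⟩ := h V (secMap (kernel.ι g) V s) (by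
    rw [← secMap_comp, kernel.condition]; rfl) x hx
  refine ⟨W, i, t, hxW, injective_of_mono (kernel.ι g) W ?_⟩
  rw [← secMap_comp, kernel.lift_ι]
  exact ht.trans (secMap_secRes ..).symm

lemma exists_secMap_kernel_ι (g : G ⟶ H) {V : Opens X} (s : Sec G V) (hs : secMap g V s = 0) :
    ∃ t, secMap (kernel.ι g) V t = s := by
  have : Mono (ShortComplex.mk (kernel.ι g) g (kernel.condition g)).f := inferInstance
  exact exact_sections (ShortComplex.exact_kernel g) s hs

end Exactness

/-! ### Resolution of ℤ(p) and vanishing of its cohomology -/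

section ConstantSheaf

open Filter Topology

variable {X : Type u} [TopologicalSpace X] (p : ℕ)

/-- The group `ℤ(p)`. -/
abbrev ZGroup : Type := AddSubgroup.zmultiples ((2 * Real.pi * Complex.I : ℂ) ^ p)

/-- A constant Alexander–Spanier function. -/
def asConst {G : Type} [AddCommGroup G] (a : G) : ASFun X G 0 :=
  ⟨fun _ => a, fun _ i => i.elim0⟩

variable {p}

/-- A locally constant function as an Alexander–Spanier cochain. -/
def ZFun.toAS {V : Opens X} : ZFun p V →+ ASSec X (ZGroup p) 0 V where
  toFun f := ⟨fun x => asGerm x.1 (asConst ⟨f.1 x, f.2.2 x⟩), fun x => by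
    obtain ⟨O, hO, hx, hc⟩ := (IsLocallyConstant.iff_exists_open _).1 f.2.1 x
    obtain ⟨W, hW, rfl⟩ := isOpen_induced_iff.1 hO
    refine ⟨⟨W, hW⟩, asConst ⟨f.1 x, f.2.2 x⟩, hx, fun y hy => ?_⟩
    exact congrArg (fun a => asGerm y.1 (asConst a)) (Subtype.ext (hc y hy))⟩
  map_zero' := rfl
  map_add' _ _ := rfl

variable (X p) in
/-- The inclusion of the constant sheaf into the sheaf of Alexander–Spanier `0`-cochains. -/
def zToAS : zSheaf p X ⟶ asSheaf X (ZGroup p) 0 :=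
  ObjectProperty.homMk
    { app := fun _ => AddCommGrpCat.ofHom ZFun.toAS
      naturality := fun _ _ _ => by ext; rfl }

lemma ZFun.d_toAS {V : Opens X} (f : ZFun p V) : ASSec.d (ZFun.toAS f) = 0 := by
  refine Subtype.ext (funext fun x => asGerm_eq_zero.2 ⟨Set.univ, univ_mem, fun z _ => ?_⟩)
  change asDelta (asConst _).1 z = 0
  rw [asDelta, Fin.sum_univ_two]
  simp [asConst]

lemma zToAS_asHom : zToAS X p ≫ asHom X (ZGroup p) 0 = 0 :=
  sheafHom_ext _ _ fun _ f => ZFun.d_toAS (X := X) f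

/-- Evaluating a germ at its base point recovers the value of the function. -/
instance : Mono (zToAS X p) := mono_of_injective _ fun V f g h => by
  refine Subtype.ext (funext fun x => ?_)
  obtain ⟨N, hN, h⟩ := asGerm_eq.1 (congrFun (congrArg Subtype.val h) x)
  exact congrArg Subtype.val (h (fun _ => x.1) fun _ => mem_of_mem_nhds hN)

/-- If δf vanishes near (x, x), then f(z) = f(x) for z near `x`, so a 0-cocycle is locally constant.
-/
lemma zToAS_exact : (ShortComplex.mk (zToAS X p) (asHom X (ZGroup p) 0) zToAS_asHom).Exact := by
  refine exact_of_locally_exact _ _ _ fun V s hs x hx => ?_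
  change ASSec X (ZGroup p) 0 V at s
  obtain ⟨W, f, hxW, hf⟩ := s.2 ⟨x, hx⟩
  have h1 : asGerm x (ASFun.d f) = 0 := by
    have := congrFun (congrArg Subtype.val hs) (⟨x, hx⟩ : V)
    rw [← asStalkD_germ, ← hf ⟨x, hx⟩ hxW]
    exact this
  obtain ⟨N, hN, h⟩ := asGerm_eq_zero.1 h1
  refine ⟨V ⊓ (W ⊓ ⟨interior N, isOpen_interior⟩), inf_le_left,
    ⟨fun _ => (f.1 fun _ => x).1, IsLocallyConstant.const _, fun _ => (f.1 fun _ => x).2⟩,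
    ⟨hx, hxW, mem_interior_iff_mem_nhds.2 hN⟩, Subtype.ext (funext fun y => ?_)⟩
  refine Eq.trans ?_ (hf ⟨y.1, y.2.1⟩ y.2.2.1).symm
  refine asGerm_eq.2 ⟨N, mem_interior_iff_mem_nhds.1 y.2.2.2, fun z hz => ?_⟩
  have h2 := h ![x, z 0] fun i => by
    fin_cases i
    · exact mem_of_mem_nhds hN
    · exact hz 0
  have h3 : f.1 (![x, z 0] ∘ Fin.succAbove 0) + (-1 : ℤ) • f.1 (![x, z 0] ∘ Fin.succAbove 1) = 0 := by
    rw [← h2]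
    change _ = asDelta f.1 _
    rw [asDelta, Fin.sum_univ_two]
    simp
  have e0 : ![x, z 0] ∘ Fin.succAbove 0 = z := by ext i; fin_cases i; rfl
  have e1 : ![x, z 0] ∘ Fin.succAbove 1 = fun _ => x := by ext i; fin_cases i; rfl
  rw [e0, e1, neg_one_smul, ← sub_eq_add_neg, sub_eq_zero] at h3
  exact h3.symm

lemma asHom_exact (G : Type) [AddCommGroup G] (p : ℕ) :
    (ShortComplex.mk (asHom X G p) (asHom X G (p + 1)) (asHom_asHom p)).Exact :=
  exact_of_locally_exact _ _ _ fun _ s hs x hx => asHom_locally_exact (X := X) s hs x hx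

lemma zToAS_shortExact : (kernelSequence (zToAS X p) (asHom X (ZGroup p) 0) (asHom X (ZGroup p) 1)
    zToAS_asHom (asHom_asHom 0)).ShortExact :=
  kernelSequence_shortExact (zToAS_exact (X := X)) (asHom_exact (X := X) _ 0)

lemma asHom_shortExact (G : Type) [AddCommGroup G] (p : ℕ) :
    (kernelSequence (kernel.ι (asHom X G p)) (asHom X G p) (asHom X G (p + 1))
      (kernel.condition _) (asHom_asHom p)).ShortExact :=
  kernelSequence_shortExact (ShortComplex.exact_kernel _) (asHom_exact (X := X) G p)

variable [T2Space X] [LocallyCompactSpace X] (V : Opens X) [SecondCountableTopology V]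
  [ParacompactSpace V] [ContractibleSpace V]

/-- The sheaf of p-cocycles is the kernel of the surjection from p-cochains to (p+1)-cocycles. The
cochains have no H¹, and on sections over `V` the surjection persists because cocycles bound on a
contractible set. -/
lemma vanishes_kernel_asHom {G : Type} [AddCommGroup G] {p : ℕ}
    (P : ∀ f : ASFun V G (p + 1), Nonempty (Prism f)) :
    Vanishes (X := TopCat.of X) (kernel (asHom X G p)) V 1 := by
  refine vanishes_one_of_surjective (asHom_shortExact (X := X) G p) (fun s => ?_)
    ((asSheaf_cechAcyclic V).vanishes 0)
  obtain ⟨t, ht⟩ := exists_asd_eq V P (secMap (X := TopCat.of X) (kernel.ι (asHom X G (p + 1))) V s)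
    ((secMap_comp (X := TopCat.of X) (kernel.ι (asHom X G (p + 1))) (asHom X G (p + 1)) V s).symm.trans
      (congrArg (fun φ => secMap (X := TopCat.of X) φ V s) (kernel.condition (asHom X G (p + 1)))))
  refine ⟨t, injective_of_mono (kernel.ι (asHom X G (p + 1))) V ?_⟩
  refine Eq.trans ?_ ht
  exact congrArg (fun φ => secMap (X := TopCat.of X) φ V t)
    (kernel.lift_ι (asHom X G (p + 1)) (asHom X G p) (asHom_asHom p))

/-- Dimension shift along ℤ(p) → 0-cochains → 1-cocycles: H² of ℤ(p) is controlled by H¹ of the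
sheaf of 1-cocycles. -/
lemma zSheaf_vanishes_two : Vanishes (X := TopCat.of X) (zSheaf p X) V 2 :=
  Vanishes.X₁ (zToAS_shortExact (X := X) (p := p)) (vanishes_kernel_asHom V fun f => ⟨prismOne f⟩)
    ((asSheaf_cechAcyclic (X := X) V).vanishes 1)

/-- One more dimension shift leads to H¹ of the sheaf of 2-cocycles, so prism operators are needed
in cochain degrees 2 and 3 only. -/
lemma zSheaf_vanishes_three : Vanishes (X := TopCat.of X) (zSheaf p X) V 3 :=
  Vanishes.X₁ (zToAS_shortExact (X := X) (p := p))
    (Vanishes.X₁ (asHom_shortExact (X := X) (ZGroup p) 1) (vanishes_kernel_asHom V fun f => ⟨prismTwo f⟩)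
      ((asSheaf_cechAcyclic (X := X) V).vanishes 1))
    ((asSheaf_cechAcyclic (X := X) V).vanishes 2)

end ConstantSheaf

/-! ### Second countability of connected open subsets -/

section SigmaCompact

variable {X : Type u} [TopologicalSpace X]

/-- In a paracompact locally compact space every point has a clopen σ-compact neighbourhood. -/
lemma exists_isClopen_isSigmaCompact [T2Space X] [ParacompactSpace X] [LocallyCompactSpace X]
    (x : X) : ∃ L : Set X, IsClopen L ∧ IsSigmaCompact L ∧ x ∈ L := by
  choose O hO hOx using fun y : X => exists_compact_mem_nhds y
  obtain ⟨W, hWo, hWc, hWf, hWs⟩ := precise_refinement (fun y => interior (O y))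
    (fun y => isOpen_interior) (Set.iUnion_eq_univ_iff.2 fun y => ⟨y, mem_interior_iff_mem_nhds.2 (hOx y)⟩)
  have hcl : ∀ i, IsCompact (closure (W i)) := fun i =>
    (hO i).of_isClosed_subset isClosed_closure
      (closure_minimal ((hWs i).trans interior_subset) (hO i).isClosed)
  -- Enlarge a compact set by the closures of the members of the cover that meet it; local
  -- finiteness keeps it compact. A member that meets the union of the iterates lies inside it, so
  -- the union is both open and closed.
  let next : Set X → Set X := fun K => ⋃ i ∈ {i | (W i ∩ K).Nonempty}, closure (W i)
  let K : ℕ → Set X := fun n => next^[n] {x}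
  have hK1 : ∀ n, K (n + 1) = next (K n) := fun n => Function.iterate_succ_apply' next n {x}
  have hK : ∀ n, IsCompact (K n) := fun n => by
    induction n with
    | zero => exact isCompact_singleton
    | succ n ih =>
      rw [hK1]
      exact (hWf.finite_nonempty_inter_compact ih).isCompact_biUnion fun i _ => hcl i
  have hstep : ∀ n i, (W i ∩ K n).Nonempty → W i ⊆ K (n + 1) := fun n i h => by
    rw [hK1]
    exact subset_closure.trans (Set.subset_biUnion_of_mem (u := fun i => closure (W i)) h)
  have hW : ∀ y, ∃ i, y ∈ W i := Set.iUnion_eq_univ_iff.1 hWc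
  refine ⟨⋃ n, K n, ⟨?_, ?_⟩, isSigmaCompact_iUnion_of_isCompact _ hK,
    Set.mem_iUnion.2 ⟨0, rfl⟩⟩
  · rw [← isOpen_compl_iff, isOpen_iff_forall_mem_open]
    intro y hy
    obtain ⟨i, hi⟩ := hW y
    refine ⟨W i, fun z hz hzL => hy ?_, hWo i, hi⟩
    obtain ⟨n, hn⟩ := Set.mem_iUnion.1 hzL
    exact Set.mem_iUnion.2 ⟨n + 1, hstep n i ⟨z, hz, hn⟩ hi⟩
  · rw [isOpen_iff_forall_mem_open]
    intro y hy
    obtain ⟨n, hn⟩ := Set.mem_iUnion.1 hy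
    obtain ⟨i, hi⟩ := hW y
    exact ⟨W i, (hstep n i ⟨y, hi, hn⟩).trans (Set.subset_iUnion K (n + 1)), hWo i, hi⟩

/-- A connected open subset of a paracompact manifold is second countable. -/
lemma secondCountable_of_connected (H : Type w) [TopologicalSpace H] [SecondCountableTopology H]
    [T2Space X] [ParacompactSpace X] [LocallyCompactSpace X] [ChartedSpace H X] (V : Opens X)
    [ConnectedSpace V] : SecondCountableTopology V := by
  obtain ⟨⟨x, hx⟩⟩ : Nonempty V := inferInstance
  obtain ⟨L, hL, hLs, hxL⟩ := exists_isClopen_isSigmaCompact x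
  let L' : Opens X := ⟨L, hL.isOpen⟩
  have hVL : V ≤ L' := (isPreconnected_iff_preconnectedSpace.2 inferInstance :
    IsPreconnected (V : Set X)).subset_isClopen hL ⟨x, hx, hxL⟩
  have : SigmaCompactSpace L' := isSigmaCompact_iff_sigmaCompactSpace.1 hLs
  have : SecondCountableTopology L' := ChartedSpace.secondCountable_of_sigmaCompact H L'
  exact (Opens.isOpenEmbedding_of_le hVL).isInducing.secondCountableTopology

end SigmaCompact

/-! ### The exponential sequence and vanishing for ℂˣ -/

section Exponential

variable {m : ℕ} {M : Type u} [TopologicalSpace M] [ChartedSpace (Euc m) M]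
  [IsManifold 𝓘(ℝ, Euc m) ∞ M]

lemma Form.exp_apply {V : Opens M} (a : ℂ) (θ : Form m 0 V) (x : V) :
    ((Form.exp a θ).1 x : ℂ) = Complex.exp (a * formFn θ x) := rfl

lemma exists_formFn_eq {V : Opens M} (f : V → ℂ) (hf : ContMDiff 𝓘(ℝ, Euc m) 𝓘(ℝ, ℂ) ∞ f) :
    ∃ θ : Form m 0 V, formFn θ = f :=
  ⟨⟨zeroForm f, (isSmoothForm_zeroForm f).2 hf⟩, rfl⟩

variable {p : ℕ} {a : ℂ}

/-- The values lie in the discrete group ℤ(p), whose elements are at least the norm of the generator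
apart, so a continuous function with these values is locally constant. -/
lemma exists_toForm_eq (h : a * (2 * Real.pi * Complex.I) ^ p = 2 * Real.pi * Complex.I)
    {V : Opens M} (θ : Form m 0 V) (hθ : Form.exp a θ = 1) : ∃ f, ZFun.toForm m M (p := p) f = θ := by
  have ha : a ≠ 0 := by
    rintro rfl
    rw [zero_mul] at h
    exact Complex.two_pi_I_ne_zero h.symm
  set b : ℂ := (2 * Real.pi * Complex.I) ^ p with hb
  have hb0 : b ≠ 0 := pow_ne_zero _ Complex.two_pi_I_ne_zero
  have h1 : ∀ x : V, ∃ n : ℤ, formFn θ x = n * b := fun x => by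
    have h2 : Complex.exp (a * formFn θ x) = 1 := by
      rw [← Form.exp_apply, hθ]; rfl
    obtain ⟨n, hn⟩ := Complex.exp_eq_one_iff.1 h2
    refine ⟨n, mul_left_cancel₀ ha ?_⟩
    rw [hn, ← h]; ring
  have hc : Continuous (formFn θ) := (formFn_smooth θ).continuous
  refine ⟨⟨formFn θ, (IsLocallyConstant.iff_eventually_eq _).2 fun x => ?_, fun x => ?_⟩,
    Subtype.ext (zeroForm_formFn θ)⟩
  · filter_upwards [hc.continuousAt.eventually (Metric.ball_mem_nhds (formFn θ x)
      (norm_pos_iff.2 hb0))] with y hy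
    obtain ⟨n, hn⟩ := h1 x
    obtain ⟨k, hk⟩ := h1 y
    rw [dist_eq_norm, hn, hk, ← sub_mul, norm_mul] at hy
    have h3 : ‖((k - n : ℤ) : ℂ)‖ < 1 := by
      push_cast
      nlinarith [norm_pos_iff.2 hb0]
    rw [Complex.norm_intCast, ← Int.cast_abs, ← Int.cast_one, Int.cast_lt, Int.abs_lt_one_iff,
      sub_eq_zero] at h3
    rw [hn, hk, h3]
  · obtain ⟨n, hn⟩ := h1 x
    exact AddSubgroup.mem_zmultiples_iff.2 ⟨n, by rw [hn, zsmul_eq_mul]⟩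

/-- Where f/f(x) avoids the negative real axis, log(f/f(x)) + log f(x) is a smooth logarithm of f.
-/
lemma exists_exp_eq (ha : a ≠ 0) {V : Opens M} (f : CxFun m V) (x : M) (hx : x ∈ V) :
    ∃ (W : Opens M) (i : W ≤ V) (θ : Form m 0 W), x ∈ W ∧ Form.exp a θ = CxFun.res i f := by
  have hf : Continuous (cxVal f) := (show ContMDiff _ _ _ (cxVal f) from f.2).continuous
  have hopen : IsOpen {y : V | cxVal f y / cxVal f ⟨x, hx⟩ ∈ Complex.slitPlane} :=
    Complex.isOpen_slitPlane.preimage (hf.div_const _)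
  have hx0 : cxVal f ⟨x, hx⟩ ≠ 0 := (f.1 _).ne_zero
  let W : Opens M := ⟨_, V.isOpen.isOpenMap_subtype_val _ hopen⟩
  have hW : W ≤ V := by rintro _ ⟨y, -, rfl⟩; exact y.2
  have hslit : ∀ y : W, cxVal f ⟨y, hW y.2⟩ / cxVal f ⟨x, hx⟩ ∈ Complex.slitPlane := by
    rintro ⟨_, y, hy, rfl⟩; exact hy
  obtain ⟨θ, hθ⟩ := exists_formFn_eq (m := m) (V := W) (fun y =>
    a⁻¹ * (Complex.log (cxVal f ⟨y, hW y.2⟩ / cxVal f ⟨x, hx⟩) + Complex.log (cxVal f ⟨x, hx⟩)))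
    fun y => by
      have h1 : ContDiffAt ℝ ∞ (fun z : ℂ => a⁻¹ * (Complex.log (z / cxVal f ⟨x, hx⟩) +
          Complex.log (cxVal f ⟨x, hx⟩))) (cxVal f ⟨y, hW y.2⟩) := by
        refine contDiffAt_const.mul (ContDiffAt.add ?_ contDiffAt_const)
        have h2 : ContDiffAt ℝ ∞ Complex.log (cxVal f ⟨y, hW y.2⟩ / cxVal f ⟨x, hx⟩) :=
          (Complex.contDiffAt_log (hslit y)).restrict_scalars ℝ
        refine ContDiffAt.comp (g := Complex.log) (f := fun z => z / cxVal f ⟨x, hx⟩)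
          (cxVal f ⟨y, hW y.2⟩) h2 ?_
        simp only [div_eq_mul_inv]
        exact contDiffAt_id.mul contDiffAt_const
      exact ContMDiffAt.comp (g := fun z : ℂ => a⁻¹ * (Complex.log (z / cxVal f ⟨x, hx⟩) +
        Complex.log (cxVal f ⟨x, hx⟩))) y h1.contMDiffAt ((CxFun.res hW f).2 y)
  refine ⟨W, hW, θ, ⟨⟨x, hx⟩, by simp [div_self hx0], rfl⟩, Subtype.ext (funext fun y =>
    Units.ext ?_)⟩
  rw [Form.exp_apply, hθ]
  have hy0 : cxVal f ⟨y, hW y.2⟩ ≠ 0 := (f.1 _).ne_zero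
  change _ = cxVal f ⟨y, hW y.2⟩
  rw [mul_inv_cancel_left₀ ha, Complex.exp_add, Complex.exp_log (div_ne_zero hy0 hx0),
    Complex.exp_log hx0, div_mul_cancel₀ _ hx0]

lemma exp_shortExact (h : a * (2 * Real.pi * Complex.I) ^ p = 2 * Real.pi * Complex.I) :
    (ShortComplex.mk (inclHom m M p) (expHom m M a) (inclHom_expHom m M p a h)).ShortExact where
  exact := exact_of_locally_exact _ _ _ fun V θ hθ x hx => by
    obtain ⟨f, hf⟩ := exists_toForm_eq h (V := V) θ hθ
    exact ⟨V, le_rfl, f, hx, hf⟩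
  mono_f := mono_of_injective _ fun V f g hfg => by
    refine Subtype.ext (funext fun x => ?_)
    exact congrArg (fun θ => formFn (m := m) (M := M) θ x) hfg
  epi_g := (epi_iff_locally_surjective _).2 fun V f x hx => by
    have ha : a ≠ 0 := by
      rintro rfl
      rw [zero_mul] at h
      exact Complex.two_pi_I_ne_zero h.symm
    obtain ⟨W, i, θ, hxW, hθ⟩ := exists_exp_eq (M := M) ha (V := V) (Additive.toMul
      (α := CxFun m (M := M) V) f) x hx
    exact ⟨W, i, θ, hxW, hθ⟩

variable [T2Space M] [ParacompactSpace M] (V : Opens M) [ContractibleSpace V]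

include m in
lemma secondCountable_of_contractible : SecondCountableTopology V := by
  have : LocallyCompactSpace M := ChartedSpace.locallyCompactSpace (Euc m) M
  exact secondCountable_of_connected (Euc m) V

lemma formSheaf_vanishes (k n : ℕ) : Vanishes (X := TopCat.of M) (formSheaf m M k) V (n + 1) := by
  have := secondCountable_of_contractible (m := m) V
  exact (formSheaf_cechAcyclic k V).vanishes n

include m in
lemma zSheaf_vanishes : Vanishes (X := TopCat.of M) (zSheaf p M) V 2 ∧
    Vanishes (X := TopCat.of M) (zSheaf p M) V 3 := by
  have := secondCountable_of_contractible (m := m) V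
  have : LocallyCompactSpace M := ChartedSpace.locallyCompactSpace (Euc m) M
  have : LocallyCompactSpace V := V.isOpen.locallyCompactSpace
  exact ⟨zSheaf_vanishes_two V, zSheaf_vanishes_three V⟩

/-- In the long exact sequence H^k of ℂˣ lies between H^k of `A^0` and H^(k+1) of ℤ(3), both zero
here. -/
lemma cxSheaf_vanishes : Vanishes (X := TopCat.of M) (cxSheaf m M) V 1 ∧
    Vanishes (X := TopCat.of M) (cxSheaf m M) V 2 :=
  ⟨Vanishes.X₃ (exp_shortExact (p := 3) twoPiI) (formSheaf_vanishes V 0 0)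
    (zSheaf_vanishes (m := m) V).1,
  Vanishes.X₃ (exp_shortExact (p := 3) twoPiI) (formSheaf_vanishes V 0 1)
    (zSheaf_vanishes (m := m) V).2⟩

end Exponential

/-! ### Exactness of the mapping cone of a quasi-isomorphism -/

section Cone

variable {C : Type*} [Category C] [Abelian C] {K T : CochainComplex C ℤ} (φ : K ⟶ T)

/-- The differential `(y, x) ↦ (-dy, φ y + dx)` of the mapping cone of `φ`. -/
def coneD (q : ℤ) : K.X (q + 1) ⊞ T.X q ⟶ K.X (q + 1 + 1) ⊞ T.X (q + 1) :=
  biprod.lift (-(biprod.fst ≫ K.d (q + 1) (q + 1 + 1)))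
    (biprod.fst ≫ φ.f (q + 1) + biprod.snd ≫ T.d q (q + 1))

lemma coneD_coneD (q : ℤ) : coneD φ q ≫ coneD φ (q + 1) = 0 := by
  refine biprod.hom_ext _ _ ?_ ?_
  · simp [coneD]
  · simp [coneD]

/-- For a cone cocycle (y, x), y is a cocycle whose image under φ bounds, so injectivity on homology
gives y = dk. Then x + φk is a cocycle, and surjectivity on homology writes it as φx' + dy', so that
(x' - k, y') is a preimage. All this holds after passing to epimorphic refinements. -/
lemma coneD_exact [QuasiIso φ] (q : ℤ) :
    (ShortComplex.mk (coneD φ q) (coneD φ (q + 1)) (coneD_coneD φ q)).Exact := by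
  rw [ShortComplex.exact_iff_exact_up_to_refinements]
  intro A z hz
  change A ⟶ K.X (q + 1 + 1) ⊞ T.X (q + 1) at z
  change z ≫ coneD φ (q + 1) = 0 at hz
  have hmono : Mono (HomologicalComplex.homologyMap φ (q + 1 + 1)) := inferInstance
  have hepi : Epi (HomologicalComplex.homologyMap φ (q + 1)) := inferInstance
  rw [HomologicalComplex.mono_homologyMap_iff_up_to_refinements φ (q + 1) (q + 1 + 1) (q + 1 + 1 + 1)
    (by simp) (by simp)] at hmono
  rw [HomologicalComplex.epi_homologyMap_iff_up_to_refinements φ q (q + 1) (q + 1 + 1)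
    (by simp) (by simp)] at hepi
  have h1 : (z ≫ biprod.fst) ≫ K.d (q + 1 + 1) (q + 1 + 1 + 1) = 0 := by
    have := hz =≫ biprod.fst
    simpa [coneD] using this
  have h2 : z ≫ biprod.fst ≫ φ.f (q + 1 + 1) + z ≫ biprod.snd ≫ T.d (q + 1) (q + 1 + 1) = 0 := by
    have := hz =≫ biprod.snd
    simpa [coneD] using this
  obtain ⟨A', π, hπ, k, hk⟩ := hmono (z ≫ biprod.fst) h1 (-(z ≫ biprod.snd)) (by
    rw [Category.assoc, Preadditive.neg_comp, Category.assoc]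
    exact eq_neg_of_add_eq_zero_left h2)
  obtain ⟨A'', π', hπ', x, hx, y, hy⟩ := hepi (π ≫ z ≫ biprod.snd + k ≫ φ.f (q + 1)) (by
    have h3 : k ≫ K.d (q + 1) (q + 1 + 1) ≫ φ.f (q + 1 + 1) =
        π ≫ z ≫ biprod.fst ≫ φ.f (q + 1 + 1) := by
      rw [← Category.assoc k, ← hk, Category.assoc, Category.assoc]
    simp only [Preadditive.add_comp, Category.assoc, φ.comm, h3]
    rw [← Preadditive.comp_add]
    exact (congrArg (π ≫ ·) ((add_comm _ _).trans h2)).trans comp_zero)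
  refine ⟨A'', π' ≫ π, inferInstance, biprod.lift (x - π' ≫ k) y, ?_⟩
  change (π' ≫ π) ≫ z = _ ≫ coneD φ q
  refine biprod.hom_ext _ _ ?_ ?_
  · simp [coneD, hx, hk]
  · simp only [coneD, Category.assoc, biprod.lift_snd, Preadditive.comp_add, biprod.lift_fst_assoc,
      biprod.lift_snd_assoc, Preadditive.sub_comp]
    rw [Preadditive.comp_add] at hy
    rw [eq_sub_of_add_eq hy]
    abel

end Cone

/-! ### Exactness of the cone on sections -/

section ConeSections

variable {X : TopCat.{u}} {K T : CochainComplex (TopCat.Sheaf AddCommGrpCat.{u} X) ℤ} (φ : K ⟶ T)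
  [QuasiIso φ] {V : Opens X}

lemma coneD_shortExact (q : ℤ) : (kernelSequence (kernel.ι (coneD φ q)) (coneD φ q)
    (coneD φ (q + 1)) (kernel.condition _) (coneD_coneD φ q)).ShortExact :=
  kernelSequence_shortExact (ShortComplex.exact_kernel _) (coneD_exact φ q)

/-- Induction from the left end of the cone, which is zero for q ≤ -2. Going from the cocycles in
one degree to those in the next costs one degree of cohomology, so q + k is preserved, and vanishing
is needed only for i + k ≤ n, with k ≥ 1 the cohomological degree. The number `j` merely bounds the
length of the induction. -/
lemma kernel_coneD_vanishes [K.IsStrictlyGE 0] [T.IsStrictlyGE 0] [∀ q, Injective (T.X q)] {n : ℤ}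
    (hK : ∀ (i : ℤ) (k : ℕ), i + (k + 1 : ℕ) ≤ n → Vanishes (K.X i) V (k + 1)) (j : ℕ) (q : ℤ)
    (hq : q + 2 ≤ j) (k : ℕ) (hk : q + (k + 1 : ℕ) ≤ n) :
    Vanishes (kernel (coneD φ q)) V (k + 1) := by
  induction j generalizing q k with
  | zero =>
    refine vanishes_of_isZero ?_ V _
    have h : IsZero (K.X (q + 1) ⊞ T.X q) := (biprod_isZero_iff _ _).2
      ⟨K.isZero_of_isStrictlyGE 0 _ (by push_cast at hq; omega), T.isZero_of_isStrictlyGE 0 _ (by push_cast at hq; omega)⟩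
    exact h.of_mono (kernel.ι (coneD φ q))
  | succ j ih =>
    obtain ⟨q, rfl⟩ : ∃ q', q = q' + 1 := ⟨q - 1, by omega⟩
    refine Vanishes.X₃ (coneD_shortExact φ q) ?_ (ih q (by push_cast at hq; omega) (k + 1)
      (by push_cast at hk ⊢; omega))
    exact vanishes_biprod (hK _ _ hk) (vanishes_of_injective _ _ _)

lemma biprod_sec_ext {F G : TopCat.Sheaf AddCommGrpCat.{u} X} {z z' : Sec (F ⊞ G) V}
    (h1 : secMap (biprod.fst : F ⊞ G ⟶ F) V z = secMap (biprod.fst : F ⊞ G ⟶ F) V z')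
    (h2 : secMap (biprod.snd : F ⊞ G ⟶ G) V z = secMap (biprod.snd : F ⊞ G ⟶ G) V z') : z = z' := by
  have split (z : Sec (F ⊞ G) V) :
      z = secMap (biprod.inl : F ⟶ F ⊞ G) V (secMap (biprod.fst : F ⊞ G ⟶ F) V z) +
        secMap (biprod.inr : G ⟶ F ⊞ G) V (secMap (biprod.snd : F ⊞ G ⟶ G) V z) := by
    rw [← secMap_comp, ← secMap_comp, ← secMap_add, biprod.total, secMap_id]
  rw [split z, split z', h1, h2]

lemma exists_biprod_sec {F G : TopCat.Sheaf AddCommGrpCat.{u} X} (y : Sec F V) (x : Sec G V) :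
    ∃ z, secMap (biprod.fst : F ⊞ G ⟶ F) V z = y ∧ secMap (biprod.snd : F ⊞ G ⟶ G) V z = x := by
  refine ⟨secMap (biprod.inl : F ⟶ F ⊞ G) V y + secMap (biprod.inr : G ⟶ F ⊞ G) V x, ?_, ?_⟩
  · rw [map_add, ← secMap_comp, ← secMap_comp, biprod.inr_fst, biprod.inl_fst, secMap_id,
      secMap_zero, add_zero]
  · rw [map_add, ← secMap_comp, ← secMap_comp, biprod.inr_snd, biprod.inl_snd, secMap_id,
      secMap_zero, zero_add]

lemma fst_coneD (p : ℤ) (z : Sec (K.X (p + 1) ⊞ T.X p) V) :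
    secMap (biprod.fst : K.X (p + 1 + 1) ⊞ T.X (p + 1) ⟶ _) V (secMap (coneD φ p) V z) =
      -secMap (K.d (p + 1) (p + 1 + 1)) V (secMap (biprod.fst : K.X (p + 1) ⊞ T.X p ⟶ _) V z) := by
  rw [← secMap_comp, coneD, biprod.lift_fst, secMap_neg, secMap_comp]

lemma snd_coneD (p : ℤ) (z : Sec (K.X (p + 1) ⊞ T.X p) V) :
    secMap (biprod.snd : K.X (p + 1 + 1) ⊞ T.X (p + 1) ⟶ _) V (secMap (coneD φ p) V z) =
      secMap (φ.f (p + 1)) V (secMap (biprod.fst : K.X (p + 1) ⊞ T.X p ⟶ _) V z) +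
        secMap (T.d p (p + 1)) V (secMap (biprod.snd : K.X (p + 1) ⊞ T.X p ⟶ _) V z) := by
  rw [← secMap_comp, coneD, biprod.lift_snd, secMap_add, secMap_comp, secMap_comp]

variable {φ} in
-- The pair (-y, x) is a section of the cocycles of the cone. It lifts to a section of the preceding
-- term because H¹ of the cocycles there vanishes.
lemma exists_of_kernel_coneD_vanishes {q : ℤ} (h : Vanishes (kernel (coneD φ q)) V 1)
    (x : Sec (T.X (q + 1)) V) (y : Sec (K.X (q + 1 + 1)) V)
    (hxy : secMap (T.d (q + 1) (q + 1 + 1)) V x = secMap (φ.f (q + 1 + 1)) V y)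
    (hy : secMap (K.d (q + 1 + 1) (q + 1 + 1 + 1)) V y = 0) :
    ∃ (k : Sec (K.X (q + 1)) V) (s : Sec (T.X q) V),
      x = secMap (φ.f (q + 1)) V k + secMap (T.d q (q + 1)) V s ∧
      y = secMap (K.d (q + 1) (q + 1 + 1)) V k := by
  obtain ⟨z, hz1, hz2⟩ := exists_biprod_sec (-y) x
  have hz : secMap (coneD φ (q + 1)) V z = 0 := by
    refine biprod_sec_ext ?_ ?_
    · rw [fst_coneD, hz1, map_neg, hy, neg_zero, neg_zero, map_zero]
    · rw [snd_coneD, hz1, hz2, hxy, map_neg, neg_add_cancel, map_zero]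
  obtain ⟨t, ht⟩ := exists_secMap_kernel_ι (coneD φ (q + 1)) z hz
  obtain ⟨r, rfl⟩ := h.surjective (coneD_shortExact φ q) t
  have hr : secMap (coneD φ q) V r = z := by
    rw [← ht]
    exact congrArg (fun ψ => secMap ψ V r) (kernel.lift_ι (coneD φ (q + 1)) _ (coneD_coneD φ q)).symm
  refine ⟨secMap (biprod.fst : K.X (q + 1) ⊞ T.X q ⟶ _) V r,
    secMap (biprod.snd : K.X (q + 1) ⊞ T.X q ⟶ _) V r, ?_, ?_⟩
  · exact hz2.symm.trans ((congrArg (secMap _ V) hr.symm).trans (snd_coneD φ q r))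
  · exact neg_inj.1 (hz1.symm.trans ((congrArg (secMap _ V) hr.symm).trans (fst_coneD φ q r)))

/-- Exactness of the sections over `V` of the mapping cone of `φ` in degree `q`. -/
def ConeExact {K T : CochainComplex (TopCat.Sheaf AddCommGrpCat.{u} X) ℤ} (φ : K ⟶ T)
    (V : Opens X) (q : ℤ) : Prop :=
  ∀ (i j : ℤ) (_ : i + 1 = q) (_ : q + 1 = j) (x : Sec (T.X q) V) (y : Sec (K.X j) V),
    secMap (T.d q j) V x = secMap (φ.f j) V y → secMap (K.d j (j + 1)) V y = 0 →
    ∃ (k : Sec (K.X q) V) (s : Sec (T.X i) V),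
      x = secMap (φ.f q) V k + secMap (T.d i q) V s ∧ y = secMap (K.d q j) V k

lemma coneExact_of_vanishes [K.IsStrictlyGE 0] [T.IsStrictlyGE 0] [∀ q, Injective (T.X q)] {n : ℤ}
    (hK : ∀ (i : ℤ) (k : ℕ), i + (k + 1 : ℕ) ≤ n → Vanishes (K.X i) V (k + 1)) {q : ℤ}
    (hq : q ≤ n) : ConeExact φ V q := by
  rintro i _ rfl rfl x y hxy hy
  exact exists_of_kernel_coneD_vanishes (kernel_coneD_vanishes φ hK (i + 2).toNat i
    (Int.self_le_toNat _) 0 (by push_cast; omega)) x y hxy hy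

lemma sec_subsingleton (F : TopCat.Sheaf AddCommGrpCat.{u} X) (hV : (V : Set X) = ∅) :
    Subsingleton (Sec F V) :=
  ⟨fun s t => TopCat.Presheaf.section_ext F V s t fun x hx => by
    have : x ∈ (V : Set X) := hx
    simp [hV] at this⟩

lemma coneExact_of_eq_empty {K T : CochainComplex (TopCat.Sheaf AddCommGrpCat.{u} X) ℤ}
    (φ : K ⟶ T) (hV : (V : Set X) = ∅) (q : ℤ) : ConeExact φ V q := fun _ _ _ _ _ _ _ _ =>
  ⟨0, 0, (sec_subsingleton _ hV).elim _ _, (sec_subsingleton _ hV).elim _ _⟩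

end ConeSections

/-! ### The total Čech complex of a complex of sheaves -/

section TotalComplex

variable {X : TopCat.{u}} {ι : Type v} (U : ι → Opens X)
  {K T : CochainComplex (TopCat.Sheaf AddCommGrpCat.{u} X) ℤ}

variable {U} in
lemma totalD_apply (c : CechFamily U K) (p : ℕ) {q q' : ℤ} (h : q' + 1 = q)
    (σ : Fin (p + 1) → ι) : totalD U K c p q σ = secMap (K.d q' q) _ (c p q' σ) +
      (q.negOnePow : ℤ) • cechDeltaPart U K c p q σ := by
  obtain rfl : q' = q - 1 := by omega
  rfl

variable {U} in
lemma totalD_zero_apply (c : CechFamily U K) {q q' : ℤ} (h : q' + 1 = q) (σ : Fin 1 → ι) :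
    totalD U K c 0 q σ = secMap (K.d q' q) _ (c 0 q' σ) := by
  rw [totalD_apply c 0 h]
  exact (congrArg _ (smul_zero _)).trans (add_zero _)

variable {U} in
lemma totalD_succ_apply (c : CechFamily U K) (p : ℕ) {q q' : ℤ} (h : q' + 1 = q)
    (σ : Fin (p + 2) → ι) : totalD U K c (p + 1) q σ = secMap (K.d q' q) _ (c (p + 1) q' σ) +
      (q.negOnePow : ℤ) • cechDelta U (K.X q) (c p q) σ :=
  totalD_apply c (p + 1) h σ

lemma secMap_d_d (i j k : ℤ) {V : Opens X} (s : Sec (K.X i) V) :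
    secMap (K.d j k) V (secMap (K.d i j) V s) = 0 := by
  rw [← secMap_comp, K.d_comp_d]; rfl

lemma secMap_comm (φ : K ⟶ T) (i j : ℤ) {V : Opens X} (s : Sec (K.X i) V) :
    secMap (T.d i j) V (secMap (φ.f i) V s) = secMap (φ.f j) V (secMap (K.d i j) V s) := by
  rw [← secMap_comp, ← secMap_comp, φ.comm]

variable {U} in
lemma cechFamily_ext {c c' : CechFamily U K} (h : ∀ p q σ, c p q σ = c' p q σ) : c = c' :=
  funext fun p => funext fun q => funext fun σ => h p q σ

lemma cechDelta_smul {F : TopCat.Sheaf AddCommGrpCat.{u} X} {p : ℕ} (n : ℤ)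
    (c : ∀ σ : Fin (p + 1) → ι, Sec F (cechOpen U σ)) :
    cechDelta U F (n • c) = n • cechDelta U F c := by
  funext σ
  simp only [cechDelta, Pi.smul_apply, map_zsmul, Finset.smul_sum]
  exact Finset.sum_congr rfl fun _ _ => smul_comm _ _ _

lemma totalD_totalD (c : CechFamily U K) : totalD U K (totalD U K c) = 0 := by
  refine cechFamily_ext fun p q σ => ?_
  have hq : q - 1 - 1 + 1 = q - 1 := by omega
  have hq' : q - 1 + 1 = q := by omega
  cases p with
  | zero =>
    rw [totalD_zero_apply _ hq', totalD_zero_apply _ hq, secMap_d_d]; rfl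
  | succ p =>
    rw [totalD_succ_apply _ p hq', totalD_succ_apply _ p hq, map_add, secMap_d_d, zero_add, map_zsmul]
    -- The sign change between neighbouring degrees makes the two mixed terms cancel.
    have hs : ((q - 1).negOnePow : ℤ) = -(q.negOnePow : ℤ) := by
      rw [Int.negOnePow_sub]; simp
    have h1 : totalD U K c p q = (fun σ => secMap (K.d (q - 1) q) _ (c p (q - 1) σ)) +
        (q.negOnePow : ℤ) • cechDeltaPart U K c p q := by
      funext σ; exact totalD_apply c p hq' σ
    rw [h1, cechDelta_add, cechDelta_secMap, cechDelta_smul]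
    have h2 : cechDelta U (K.X q) (cechDeltaPart U K c p q) = 0 := by
      cases p with
      | zero => exact cechDelta_zero U
      | succ p => exact cechDelta_cechDelta U _
    rw [h2, smul_zero, add_zero, hs, neg_smul]
    exact neg_add_cancel _

variable {U} in
lemma totalD_mem_cochains {c : CechFamily U K} {i j : ℤ} (hc : c ∈ cechCochains U K i)
    (hij : i + 1 = j) : totalD U K c ∈ cechCochains U K j := by
  intro p q hpq
  funext σ
  rw [totalD_apply c p (sub_add_cancel q 1), hc p (q - 1) (by omega)]
  have h : cechDeltaPart U K c p q = 0 := by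
    cases p with
    | zero => rfl
    | succ p =>
      change cechDelta U (K.X q) (c p q) = 0
      rw [hc p q (by push_cast at hpq; omega), cechDelta_zero]
  rw [h]
  simp

/-- A cochain of bidegree `(p, q)`. -/
def cechSingle (p : ℕ) (q : ℤ) (b : ∀ σ : Fin (p + 1) → ι, Sec (K.X q) (cechOpen U σ)) :
    CechFamily U K := Pi.single (M := fun p => ∀ (q : ℤ) (σ : Fin (p + 1) → ι),
      Sec (K.X q) (cechOpen U σ)) p (Pi.single q b)

section Single

variable {p : ℕ} {q : ℤ} (b : ∀ σ : Fin (p + 1) → ι, Sec (K.X q) (cechOpen U σ))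

lemma cechSingle_same : cechSingle U p q b p q = b := by
  rw [cechSingle, Pi.single_eq_same, Pi.single_eq_same]

lemma cechSingle_of_ne {p' : ℕ} (h : p' ≠ p) (q' : ℤ) : cechSingle U p q b p' q' = 0 := by
  rw [cechSingle, Pi.single_eq_of_ne h]; rfl

lemma cechSingle_of_ne' (p' : ℕ) {q' : ℤ} (h : q' ≠ q) : cechSingle U p q b p' q' = 0 := by
  by_cases hp : p' = p
  · subst hp
    rw [cechSingle, Pi.single_eq_same, Pi.single_eq_of_ne h]
  · exact cechSingle_of_ne U b hp q'

lemma cechSingle_mem {n : ℤ} (h : (p : ℤ) + q = n) : cechSingle U p q b ∈ cechCochains U K n := by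
  intro p' q' hne
  by_cases hp : p' = p
  · exact cechSingle_of_ne' U b p' (by rintro rfl; exact hne (by rw [hp, h]))
  · exact cechSingle_of_ne U b hp q'

end Single

variable {U} in
lemma cechMap_totalD (φ : K ⟶ T) (c : CechFamily U K) :
    cechMap U φ (totalD U K c) = totalD U T (cechMap U φ c) := by
  refine cechFamily_ext fun p q σ => ?_
  rw [totalD_apply _ p (sub_add_cancel q 1)]
  change secMap (φ.f q) _ (totalD U K c p q σ) = _
  rw [totalD_apply _ p (sub_add_cancel q 1), map_add, map_zsmul]
  congr 1
  · exact (secMap_comm φ _ _ _).symm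
  · congr 1
    cases p with
    | zero => exact map_zero _
    | succ p => exact (congrFun (cechDelta_secMap U (φ.f q) (c p q)) σ).symm

variable {U} in
lemma cechMap_add (φ : K ⟶ T) (c c' : CechFamily U K) :
    cechMap U φ (c + c') = cechMap U φ c + cechMap U φ c' :=
  cechFamily_ext fun _ _ _ => map_add _ _ _

variable {U} in
lemma cechMap_sub (φ : K ⟶ T) (c c' : CechFamily U K) :
    cechMap U φ (c - c') = cechMap U φ c - cechMap U φ c' :=
  cechFamily_ext fun _ _ _ => map_sub _ _ _

variable {U} in
lemma cechMap_zero (φ : K ⟶ T) : cechMap U φ (0 : CechFamily U K) = 0 :=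
  cechFamily_ext fun _ _ _ => map_zero _

variable {U} in
lemma cechMap_mem (φ : K ⟶ T) {c : CechFamily U K} {n : ℤ} (hc : c ∈ cechCochains U K n) :
    cechMap U φ c ∈ cechCochains U T n := fun p q h => by
  funext σ
  change secMap (φ.f q) _ (c p q σ) = 0
  rw [hc p q h]
  exact map_zero _

section Aug

lemma cechAug_self {n : ℤ} (t : Sec (T.X n) ⊤) (σ : Fin 1 → ι) :
    cechAug U T t 0 n σ = secRes (T.X n) le_top t := by
  rw [cechAug, if_pos rfl, Pi.single_eq_same]

lemma cechAug_succ {n : ℤ} (t : Sec (T.X n) ⊤) (p : ℕ) (q : ℤ) :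
    cechAug U T t (p + 1) q = 0 := rfl

lemma cechAug_of_ne {n : ℤ} (t : Sec (T.X n) ⊤) (p : ℕ) {q : ℤ} (h : q ≠ n) :
    cechAug U T t p q = 0 := by
  funext σ
  rw [cechAug]
  split_ifs
  · rw [Pi.single_eq_of_ne h, map_zero]; rfl
  · rfl

lemma cechAug_mem {n : ℤ} (t : Sec (T.X n) ⊤) : cechAug U T t ∈ cechCochains U T n := by
  intro p q h
  cases p with
  | zero => exact cechAug_of_ne U t 0 (by simpa using h)
  | succ p => rfl

lemma cechAug_add {n : ℤ} (t t' : Sec (T.X n) ⊤) :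
    cechAug U T (t + t') = cechAug U T t + cechAug U T t' := by
  refine cechFamily_ext fun p q σ => ?_
  simp only [Pi.add_apply, cechAug, Pi.single_add]
  split_ifs
  · exact map_add _ _ _
  · exact (add_zero _).symm

lemma cechAug_zero {n : ℤ} : cechAug U T (0 : Sec (T.X n) ⊤) = 0 := by
  have h := cechAug_add U (0 : Sec (T.X n) ⊤) 0
  rw [add_zero] at h
  exact left_eq_add.1 h

lemma cechAug_neg {n : ℤ} (t : Sec (T.X n) ⊤) : cechAug U T (-t) = -cechAug U T t := by
  rw [eq_neg_iff_add_eq_zero, ← cechAug_add, neg_add_cancel, cechAug_zero]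

lemma totalD_cechAug {i j : ℤ} (h : i + 1 = j) (t : Sec (T.X i) ⊤) :
    totalD U T (cechAug U T t) = cechAug U T (secMap (T.d i j) ⊤ t) := by
  have hm := totalD_mem_cochains (cechAug_mem U t) h
  refine cechFamily_ext fun p q σ => ?_
  by_cases hpq : (p : ℤ) + q = j
  · match p, hpq, σ with
    | 0, hpq, σ =>
      obtain rfl : q = j := by simpa using hpq
      rw [totalD_zero_apply _ h, cechAug_self, cechAug_self, secMap_secRes]
    | 1, hpq, σ =>
      obtain rfl : q = i := by push_cast at hpq; omega
      refine (totalD_succ_apply _ 0 (sub_add_cancel q 1) σ).trans ?_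
      have h0 : cechDelta U (T.X q) (cechAug U T t 0 q) σ = 0 := by
        rw [cechDelta, Fin.sum_univ_two, cechAug_self, cechAug_self, secRes_secRes, secRes_secRes]
        simp
      rw [h0, cechAug_succ, smul_zero, add_zero]
      exact map_zero _
    | p + 2, hpq, σ =>
      refine (totalD_succ_apply _ (p + 1) (sub_add_cancel q 1) σ).trans ?_
      rw [cechAug_succ, cechAug_succ, cechAug_succ, cechDelta_zero]
      simp
  · rw [hm p q hpq, cechAug_mem U _ p q hpq]

end Aug

end TotalComplex

/-! ### Exactness properties of the Čech double complex -/

section Comparison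

variable {X : TopCat.{u}} {ι : Type v} (U : ι → Opens X)
  {K T : CochainComplex (TopCat.Sheaf AddCommGrpCat.{u} X) ℤ}

variable {U} in
lemma sec_ext_of_cover {F : TopCat.Sheaf AddCommGrpCat.{u} X} (hU : ⨆ i, U i = ⊤)
    {s t : Sec F ⊤} (h : ∀ σ : Fin 1 → ι, secRes F (W := cechOpen U σ) le_top s = secRes F le_top t) :
    s = t := by
  refine sec_ext fun x _ => ?_
  obtain ⟨i, hi⟩ := Opens.mem_iSup.1 (hU.ge trivial : x ∈ ⨆ i, U i)
  exact ⟨_, le_top, (le_iInf fun _ => le_rfl : U i ≤ cechOpen U fun _ : Fin 1 => i) hi, h _⟩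

lemma mem_cochains_eq_zero [T.IsStrictlyGE 0] {c : CechFamily U T} {i : ℤ}
    (hc : c ∈ cechCochains U T i) (p : ℕ) (q : ℤ) (hp : i < p) : c p q = 0 := by
  by_cases h : (p : ℤ) + q = i
  · have h0 := T.isZero_of_isStrictlyGE 0 q (by omega)
    funext σ
    rw [← secMap_id _ (c p q σ), h0.eq_of_src (𝟙 (T.X q)) 0]
    rfl
  · exact hc p q h

/-- The augmented Čech complex of a complex of injective sheaves is acyclic. -/
lemma exists_aug_add_totalD [∀ n, Injective (T.X n)] [T.IsStrictlyGE 0] (hU : ⨆ i, U i = ⊤)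
    {i j : ℤ} (hij : i + 1 = j) (t' : Sec (T.X j) ⊤) (N : ℕ) (c : CechFamily U T)
    (hc : c ∈ cechCochains U T i) (hN : ∀ p q, N < p → c p q = 0)
    (hD : totalD U T c = cechAug U T t') :
    ∃ (t : Sec (T.X i) ⊤), ∃ b ∈ cechCochains U T (i - 1),
      c = cechAug U T t + totalD U T b ∧ secMap (T.d i j) ⊤ t = t' := by
  induction N generalizing c with
  | zero =>
    -- Only the column p = 0 is left, and the equation in bidegree (1, i) says that it is a Čech
    -- cocycle, so it glues to a global section.
    have h1 : cechDelta U (T.X i) (c 0 i) = 0 := by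
      funext σ
      have h2 := congrFun (congrFun (congrFun hD 1) i) σ
      rw [cechAug_succ] at h2
      rw [totalD_succ_apply _ 0 (sub_add_cancel i 1), hN 1 _ one_pos] at h2
      have h3 : (i.negOnePow : ℤ) • cechDelta U (T.X i) (c 0 i) σ = 0 := by
        exact ((congrArg (· + _) (map_zero _)).trans (zero_add _)).symm.trans h2
      rw [← one_smul ℤ (cechDelta U (T.X i) (c 0 i) σ), ← Int.units_coe_mul_self i.negOnePow,
        mul_smul, h3, smul_zero]
      rfl
    obtain ⟨t, ht⟩ := exists_glue_of_cechDelta_eq_zero U (c 0 i) h1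
    have hle : (⊤ : Opens X) ≤ ⨆ i, U i := hU.ge
    have ht' : ∀ σ : Fin 1 → ι, secRes (T.X i) le_top (secRes (T.X i) hle t) = c 0 i σ := fun σ => by
      rw [secRes_secRes, ← ht]
    refine ⟨secRes (T.X i) hle t, 0, zero_mem _, ?_, sec_ext_of_cover hU fun σ => ?_⟩
    · rw [map_zero, add_zero]
      refine cechFamily_ext fun p q σ => ?_
      cases p with
      | zero =>
        by_cases hq : q = i
        · subst hq
          rw [cechAug_self, ht']
        · rw [hc 0 q (by simpa using hq), cechAug_of_ne U _ _ hq]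
      | succ p => rw [hN (p + 1) q (Nat.succ_pos p), cechAug_succ]
    · have h2 := congrFun (congrFun (congrFun hD 0) j) σ
      rw [cechAug_self, totalD_zero_apply _ hij, ← ht', secMap_secRes] at h2
      exact h2
  | succ N ih =>
    set q : ℤ := i - (N + 1) with hq
    -- Nothing lies beyond column N + 1, so the equation in bidegree (N + 2, q) involves this
    -- component alone.
    have h1 : cechDelta U (T.X q) (c (N + 1) q) = 0 := by
      funext σ
      have h2 := congrFun (congrFun (congrFun hD (N + 2)) q) σ
      rw [cechAug_succ] at h2
      rw [totalD_succ_apply _ (N + 1) (sub_add_cancel q 1), hN (N + 2) _ (Nat.lt_succ_self _)] at h2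
      have h3 : (q.negOnePow : ℤ) • cechDelta U (T.X q) (c (N + 1) q) σ = 0 := by
        exact ((congrArg (· + _) (map_zero _)).trans (zero_add _)).symm.trans h2
      rw [← one_smul ℤ (cechDelta U (T.X q) (c (N + 1) q) σ), ← Int.units_coe_mul_self q.negOnePow,
        mul_smul, h3, smul_zero]
      rfl
    obtain ⟨b, hb⟩ := (injectiveSplitting (T.X q) U).exact U _ h1
    -- The sign cancels the factor (-1)^q of δ in the total differential, so subtracting the
    -- differential of `s` removes column N + 1.
    set s : CechFamily U T := cechSingle U N q ((q.negOnePow : ℤ) • b) with hs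
    have hsm : s ∈ cechCochains U T (i - 1) := cechSingle_mem U _ (by omega)
    have hDs := totalD_mem_cochains hsm (sub_add_cancel i 1)
    have hvan : ∀ p q', N < p → (c - totalD U T s) p q' = 0 := fun p q' hp => by
      by_cases hpq : (p : ℤ) + q' = i
      · obtain ⟨p, rfl⟩ : ∃ p', p = p' + 1 := ⟨p - 1, by omega⟩
        funext σ
        have h2 : totalD U T s (p + 1) q' σ = (q'.negOnePow : ℤ) • cechDelta U (T.X q') (s p q') σ := by
          have h3 : s (p + 1) (q' - 1) = 0 := cechSingle_of_ne U _ (by omega) _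
          rw [totalD_succ_apply _ p (sub_add_cancel q' 1), h3]
          exact (congrArg (· + _) (map_zero _)).trans (zero_add _)
        change c (p + 1) q' σ - totalD U T s (p + 1) q' σ = 0
        rw [h2]
        by_cases hpN : p = N
        · subst hpN
          obtain rfl : q' = q := by push_cast at hpq; omega
          rw [hs, cechSingle_same, cechDelta_smul, hb, Pi.smul_apply, ← mul_smul,
            Int.units_coe_mul_self, one_smul, sub_self]
        · rw [hs, cechSingle_of_ne U _ hpN, cechDelta_zero, hN (p + 1) q' (by omega)]
          exact (congrArg (_ - ·) (smul_zero _)).trans (sub_zero _)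
      · exact (sub_mem hc hDs) p q' hpq
    obtain ⟨t, b', hb', hcb, ht⟩ := ih (c - totalD U T s) (sub_mem hc hDs) hvan
      (by rw [map_sub, totalD_totalD, sub_zero, hD])
    refine ⟨t, b' + s, add_mem hb' hsm, ?_, ht⟩
    rw [map_add, ← add_assoc, ← hcb, sub_add_cancel]

/-- Exactness of the total Čech complex of the mapping cone of `φ`. -/
lemma exists_of_cone_cocycle (φ : K ⟶ T) [K.IsStrictlyGE 0] [T.IsStrictlyGE 0] {n : ℤ}
    (hE : ∀ (p : ℕ) (σ : Fin (p + 1) → ι) (q : ℤ), q ≤ n → ConeExact φ (cechOpen U σ) q)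
    (j N : ℕ) (hj : n + 2 ≤ N + j) (x : CechFamily U T) (y : CechFamily U K)
    (hx : x ∈ cechCochains U T n) (hy : y ∈ cechCochains U K (n + 1))
    (hxN : ∀ p q, p < N → x p q = 0) (hyN : ∀ p q, p < N → y p q = 0)
    (hDx : totalD U T x = cechMap U φ y) (hDy : totalD U K y = 0) :
    ∃ k ∈ cechCochains U K n, ∃ s ∈ cechCochains U T (n - 1),
      x = cechMap U φ k + totalD U T s ∧ y = totalD U K k := by
  induction j generalizing N x y with
  | zero =>
    -- Components of nonnegative degree have p ≤ n for `x` and p ≤ n + 1 for `y`, and all columns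
    -- with p < N are zero already.
    have hx0 : x = 0 := by
      funext p q
      by_cases hp : p < N
      · exact hxN p q hp
      · exact mem_cochains_eq_zero U hx p q (by push_cast at hj; omega)
    have hy0 : y = 0 := by
      funext p q
      by_cases hp : p < N
      · exact hyN p q hp
      · exact mem_cochains_eq_zero U hy p q (by push_cast at hj; omega)
    refine ⟨0, zero_mem _, 0, zero_mem _, ?_, ?_⟩
    · rw [hx0, cechMap_zero, map_zero, add_zero]
    · rw [hy0, map_zero]
  | succ j ih =>
    set q : ℤ := n - N with hq
    -- In the first column that may be nonzero δ contributes nothing, so there the total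
    -- differential is the sheaf differential.
    have hδ {L : CochainComplex (TopCat.Sheaf AddCommGrpCat.{u} X) ℤ} (z : CechFamily U L)
        (hz : ∀ p q, p < N → z p q = 0) {i k : ℤ} (hik : i + 1 = k) (σ : Fin (N + 1) → ι) :
        totalD U L z N k σ = secMap (L.d i k) _ (z N i σ) := by
      rw [totalD_apply _ N hik]
      have : cechDeltaPart U L z N k = 0 := by
        cases N with
        | zero => rfl
        | succ N =>
          change cechDelta U (L.X k) (z N k) = 0
          rw [hz N k (Nat.lt_succ_self N), cechDelta_zero]
      rw [this]
      exact (congrArg _ (smul_zero _)).trans (add_zero _)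
    -- On each intersection the entries of column N therefore satisfy the cocycle condition of the
    -- cone, and exactness of its sections solves for them.
    have h1 : ∀ σ : Fin (N + 1) → ι, ∃ (k : Sec (K.X q) (cechOpen U σ))
        (s : Sec (T.X (q - 1)) (cechOpen U σ)), x N q σ = secMap (φ.f q) _ k +
          secMap (T.d (q - 1) q) _ s ∧ y N (q + 1) σ = secMap (K.d q (q + 1)) _ k := fun σ => by
      refine hE N σ q (by omega) (q - 1) (q + 1) (by omega) rfl _ _ ?_ ?_
      · rw [← hδ x hxN rfl, hDx]; rfl
      · rw [← hδ y hyN rfl, hDy]; rfl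
    choose k s hk hs using h1
    set k' : CechFamily U K := cechSingle U N q k with hk'
    set s' : CechFamily U T := cechSingle U N (q - 1) s with hs'
    have hkm : k' ∈ cechCochains U K n := cechSingle_mem U _ (by omega)
    have hsm : s' ∈ cechCochains U T (n - 1) := cechSingle_mem U _ (by omega)
    have hk0 : ∀ p q, p < N → k' p q = 0 := fun p q hp => cechSingle_of_ne U _ hp.ne q
    have hs0 : ∀ p q, p < N → s' p q = 0 := fun p q hp => cechSingle_of_ne U _ hp.ne q
    have hD0 {L : CochainComplex (TopCat.Sheaf AddCommGrpCat.{u} X) ℤ} (z : CechFamily U L)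
        (hz : ∀ p q, p < N → z p q = 0) (p : ℕ) (q : ℤ) (hp : p < N) : totalD U L z p q = 0 := by
      funext σ
      rw [totalD_apply _ p (sub_add_cancel q 1), hz p _ hp]
      have : cechDeltaPart U L z p q = 0 := by
        cases p with
        | zero => rfl
        | succ p =>
          change cechDelta U (L.X q) (z p q) = 0
          rw [hz p q (by omega), cechDelta_zero]
      rw [this]
      simp
    have hxv : ∀ p q', p < N + 1 → (x - cechMap U φ k' - totalD U T s') p q' = 0 := fun p q' hp => by
      obtain hp | rfl := Nat.lt_succ_iff_lt_or_eq.1 hp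
      · funext σ
        change x p q' σ - secMap (φ.f q') _ (k' p q' σ) - totalD U T s' p q' σ = 0
        rw [hxN p q' hp, hk0 p q' hp, hD0 s' hs0 p q' hp]
        simp
      · by_cases hqq : q' = q
        · subst hqq
          funext σ
          change x p q σ - secMap (φ.f q) _ (k' p q σ) - totalD U T s' p q σ = 0
          rw [hδ s' hs0 (sub_add_cancel q 1), hk', hs', cechSingle_same, cechSingle_same, hk]
          abel
        · exact (sub_mem (sub_mem hx (cechMap_mem φ hkm)) (totalD_mem_cochains hsm (by omega)))
            p q' (by omega)
    have hyv : ∀ p q', p < N + 1 → (y - totalD U K k') p q' = 0 := fun p q' hp => by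
      obtain hp | rfl := Nat.lt_succ_iff_lt_or_eq.1 hp
      · funext σ
        change y p q' σ - totalD U K k' p q' σ = 0
        rw [hyN p q' hp, hD0 k' hk0 p q' hp]
        simp
      · by_cases hqq : q' = q + 1
        · subst hqq
          funext σ
          change y p (q + 1) σ - totalD U K k' p (q + 1) σ = 0
          rw [hδ k' hk0 rfl, hk', cechSingle_same, hs, sub_self]
        · exact (sub_mem hy (totalD_mem_cochains hkm rfl)) p q' (by omega)
    obtain ⟨k₂, hk₂, s₂, hs₂, hxk, hyk⟩ := ih (N + 1) (by push_cast at hj ⊢; omega)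
      (x - cechMap U φ k' - totalD U T s') (y - totalD U K k')
      (sub_mem (sub_mem hx (cechMap_mem φ hkm)) (totalD_mem_cochains hsm (by omega)))
      (sub_mem hy (totalD_mem_cochains hkm rfl)) hxv hyv
      (by rw [map_sub, map_sub, totalD_totalD, sub_zero, hDx, cechMap_sub, cechMap_totalD])
      (by rw [map_sub, totalD_totalD, hDy, sub_zero])
    refine ⟨k₂ + k', add_mem hk₂ hkm, s₂ + s', add_mem hs₂ hsm, ?_, ?_⟩
    · rw [cechMap_add, map_add]
      have h2 := sub_eq_iff_eq_add.1 (sub_eq_iff_eq_add.1 hxk)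
      rw [h2]
      abel
    · rw [map_add, ← hyk, sub_add_cancel]

end Comparison

/-! ### Isomorphisms of quotients from additive correspondences -/

section Correspondence

/-- The isomorphism of quotients given by a correspondence. -/
lemma exists_addEquiv_of_correspondence {A : Type u} {B : Type v} [AddCommGroup A] [AddCommGroup B]
    (A₀ : AddSubgroup A) (B₀ : AddSubgroup B) (R : AddSubgroup (A × B))
    (h1 : ∀ a, ∃ b, (a, b) ∈ R) (h2 : ∀ b, ∃ a, (a, b) ∈ R)
    (h3 : ∀ a b, (a, b) ∈ R → (a ∈ A₀ ↔ b ∈ B₀)) (h4 : ∀ b ∈ B₀, (0, b) ∈ R) :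
    ∃ e : A ⧸ A₀ ≃+ B ⧸ B₀, ∀ a b,
      e (QuotientAddGroup.mk a) = QuotientAddGroup.mk b ↔ (a, b) ∈ R := by
  choose f hf using h1
  have hf' : ∀ a b, (a, b) ∈ R → (QuotientAddGroup.mk (f a) : B ⧸ B₀) = QuotientAddGroup.mk b := by
    intro a b hab
    rw [QuotientAddGroup.eq]
    refine (h3 0 _ ?_).1 (zero_mem _)
    have := R.add_mem (R.neg_mem (hf a)) hab
    simpa using this
  let F : A →+ B ⧸ B₀ := AddMonoidHom.mk' (fun a => QuotientAddGroup.mk (f a)) fun a a' =>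
    hf' _ _ (R.add_mem (hf a) (hf a'))
  have hker : A₀ = F.ker := by
    ext a
    rw [h3 a (f a) (hf a)]
    exact (QuotientAddGroup.eq_zero_iff _).symm
  have hsurj : Function.Surjective F := by
    intro b
    obtain ⟨b, rfl⟩ := QuotientAddGroup.mk_surjective b
    obtain ⟨a, ha⟩ := h2 b
    exact ⟨a, hf' a b ha⟩
  refine ⟨(QuotientAddGroup.quotientAddEquivOfEq hker).trans
    (QuotientAddGroup.quotientKerEquivOfSurjective F hsurj), fun a b => ⟨fun h => ?_, fun h => hf' a b h⟩⟩
  have h5 : (QuotientAddGroup.mk (f a) : B ⧸ B₀) = QuotientAddGroup.mk b := h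
  rw [QuotientAddGroup.eq] at h5
  have := R.add_mem (hf a) (h4 _ h5)
  simpa using this

end Correspondence

/-! ### The comparison isomorphism κ -/

section Kappa

variable {X : TopCat.{u}} {ι : Type v} (U : ι → Opens X)
  {K : CochainComplex (TopCat.Sheaf AddCommGrpCat.{u} X) ℤ} [K.IsStrictlyGE 0]

/-- The comparison isomorphism from Čech to sheaf hypercohomology. -/
lemma exists_cech_comparison (hU : ⨆ i, U i = ⊤) (n : ℤ)
    (hE : ∀ (p : ℕ) (σ : Fin (p + 1) → ι) (q : ℤ), q ≤ n →
      ConeExact (injRes K).aug (cechOpen U σ) q) :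
    ∃ κ : CechCohomology U K n ≃+ Hypercohomology K n, IsCechComparison U K n κ := by
  have hinj := (injRes K).injective
  have hb := (injRes K).bounded
  set T := (injRes K).T
  set φ : K ⟶ T := (injRes K).aug
  refine exists_addEquiv_of_correspondence
    ((cechCoboundaries U K n).addSubgroupOf (cechCocycles U K n))
    ((globalCoboundaries T n).addSubgroupOf (globalCocycles T n))
    { carrier := {z | cechMap U φ z.1.1 - cechAug U T z.2.1 ∈ cechCoboundaries U T n}
      zero_mem' := by
        change cechMap U φ 0 - cechAug U T 0 ∈ cechCoboundaries U T n
        rw [cechMap_zero, cechAug_zero, sub_zero]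
        exact zero_mem _
      add_mem' := fun {a b} ha hb => by
        change cechMap U φ (a.1.1 + b.1.1) - cechAug U T (a.2.1 + b.2.1) ∈ cechCoboundaries U T n
        rw [cechMap_add, cechAug_add, add_sub_add_comm]
        exact add_mem ha hb
      neg_mem' := fun {a} ha => by
        change cechMap U φ (-a.1.1) - cechAug U T (-a.2.1) ∈ cechCoboundaries U T n
        have h : cechMap U φ (-a.1.1) = -cechMap U φ a.1.1 :=
          cechFamily_ext fun _ _ _ => map_neg _ _
        rw [h, cechAug_neg, ← neg_sub']
        exact neg_mem ha } ?_ ?_ ?_ ?_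
  · rintro ⟨c, hc, hDc⟩
    -- A Čech cocycle with values in T is cohomologous to a global section.
    obtain ⟨t, b, hb, h, ht⟩ := exists_aug_add_totalD U hU (i := n) rfl 0 n.toNat (cechMap U φ c)
      (cechMap_mem φ hc) (fun p q hp => mem_cochains_eq_zero U (cechMap_mem φ hc) p q
        (by omega)) (by
          rw [← cechMap_totalD, cechAug_zero]
          exact (congrArg _ hDc).trans (cechMap_zero φ))
    refine ⟨⟨t, ht⟩, b, hb, ?_⟩
    change _ = cechMap U φ c - cechAug U T t
    rw [h, add_sub_cancel_left]
  · rintro ⟨t, ht⟩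
    -- Cone exactness for the pair (t, 0) makes the global cocycle t cohomologous to the image of a
    -- Čech cocycle of K.
    obtain ⟨k, hk, s, hs, h, h0⟩ := exists_of_cone_cocycle U φ hE (n + 2).toNat 0
      (by push_cast; omega) (cechAug U T t) 0 (cechAug_mem U t) (zero_mem _)
      (fun p q hp => (Nat.not_lt_zero p hp).elim) (fun p q hp => (Nat.not_lt_zero p hp).elim)
      (by rw [totalD_cechAug U rfl, cechMap_zero]; exact (congrArg _ ht).trans (cechAug_zero U))
      (map_zero _)
    refine ⟨⟨k, hk, h0.symm⟩, -s, neg_mem hs, ?_⟩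
    change _ = cechMap U φ k - cechAug U T t
    rw [h, map_neg]
    abel
  · rintro ⟨c, hc, hDc⟩ ⟨t, ht⟩ ⟨b, hb, hbc⟩
    change totalD U T b = cechMap U φ c - cechAug U T t at hbc
    constructor
    · rintro ⟨k, hk, hkc⟩
      change totalD U K k = c at hkc
      -- The cochain φk - b has differential t, so t bounds already among the global sections.
      obtain ⟨t₀, b₀, hb₀, -, ht₀⟩ := exists_aug_add_totalD U hU (sub_add_cancel n 1) t
        (n - 1).toNat (cechMap U φ k - b) (sub_mem (cechMap_mem φ hk) hb)
        (fun p q hp => mem_cochains_eq_zero U (sub_mem (cechMap_mem φ hk) hb) p q (by omega))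
        (by rw [map_sub, ← cechMap_totalD, hkc, hbc, sub_sub_cancel])
      exact ⟨t₀, ht₀⟩
    · rintro ⟨t₀, ht₀⟩
      change secMap (T.d (n - 1) n) ⊤ t₀ = t at ht₀
      -- The cochain b + t₀ bounds the image of c in Č(U, T), and cone exactness one degree lower
      -- yields a primitive of c in Č(U, K).
      obtain ⟨k, hk, s, hs, h, h0⟩ := exists_of_cone_cocycle U φ (n := n - 1)
        (fun p σ q hq => hE p σ q (by omega)) (n + 2).toNat 0
        (by push_cast; omega) (b + cechAug U T t₀) c (add_mem hb (cechAug_mem U t₀))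
        (by rwa [sub_add_cancel])
        (fun p q hp => (Nat.not_lt_zero p hp).elim) (fun p q hp => (Nat.not_lt_zero p hp).elim)
        (by rw [map_add, hbc, totalD_cechAug U (sub_add_cancel n 1), ht₀, sub_add_cancel]) hDc
      exact ⟨k, hk, h0.symm⟩
  · rintro ⟨t, ht⟩ ⟨t₀, ht₀⟩
    change secMap (T.d (n - 1) n) ⊤ t₀ = t at ht₀
    refine ⟨-cechAug U T t₀, neg_mem (cechAug_mem U t₀), ?_⟩
    change totalD U T (-cechAug U T t₀) = cechMap U φ 0 - cechAug U T t
    rw [map_neg, totalD_cechAug U (sub_add_cancel n 1), ht₀, cechMap_zero, zero_sub]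

end Kappa

/-! ### Čech differential on pairs, triples and quadruples of indices -/

section Faces

variable {X : TopCat.{u}} {ι : Type v} (U : ι → Opens X)

lemma cechOpen_le_cechOpen {p q : ℕ} {σ : Fin (p + 1) → ι} {τ : Fin (q + 1) → ι}
    (h : ∀ j, ∃ i, σ i = τ j) : cechOpen U σ ≤ cechOpen U τ := le_iInf fun j => by
  obtain ⟨i, hi⟩ := h j
  exact hi ▸ cechOpen_le U σ i

lemma cechOpen_pair_face₀ (α β : ι) : cechOpen U ![α, β] ≤ cechOpen U ![β] :=
  cechOpen_le_cechOpen U fun j => by fin_cases j; exact ⟨1, rfl⟩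

lemma cechOpen_pair_face₁ (α β : ι) : cechOpen U ![α, β] ≤ cechOpen U ![α] :=
  cechOpen_le_cechOpen U fun j => by fin_cases j; exact ⟨0, rfl⟩

lemma cechOpen_triple_face₀ (α β γ : ι) : cechOpen U ![α, β, γ] ≤ cechOpen U ![β, γ] :=
  cechOpen_le_cechOpen U fun j => by fin_cases j; exacts [⟨1, rfl⟩, ⟨2, rfl⟩]

lemma cechOpen_triple_face₁ (α β γ : ι) : cechOpen U ![α, β, γ] ≤ cechOpen U ![α, γ] :=
  cechOpen_le_cechOpen U fun j => by fin_cases j; exacts [⟨0, rfl⟩, ⟨2, rfl⟩]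

lemma cechOpen_triple_face₂ (α β γ : ι) : cechOpen U ![α, β, γ] ≤ cechOpen U ![α, β] :=
  cechOpen_le_cechOpen U fun j => by fin_cases j; exacts [⟨0, rfl⟩, ⟨1, rfl⟩]

lemma cechOpen_quad_face₀ (α β γ ν : ι) : cechOpen U ![α, β, γ, ν] ≤ cechOpen U ![β, γ, ν] :=
  cechOpen_le_cechOpen U fun j => by fin_cases j; exacts [⟨1, rfl⟩, ⟨2, rfl⟩, ⟨3, rfl⟩]

lemma cechOpen_quad_face₁ (α β γ ν : ι) : cechOpen U ![α, β, γ, ν] ≤ cechOpen U ![α, γ, ν] :=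
  cechOpen_le_cechOpen U fun j => by fin_cases j; exacts [⟨0, rfl⟩, ⟨2, rfl⟩, ⟨3, rfl⟩]

lemma cechOpen_quad_face₂ (α β γ ν : ι) : cechOpen U ![α, β, γ, ν] ≤ cechOpen U ![α, β, ν] :=
  cechOpen_le_cechOpen U fun j => by fin_cases j; exacts [⟨0, rfl⟩, ⟨1, rfl⟩, ⟨3, rfl⟩]

lemma cechOpen_quad_face₃ (α β γ ν : ι) : cechOpen U ![α, β, γ, ν] ≤ cechOpen U ![α, β, γ] :=
  cechOpen_le_cechOpen U fun j => by fin_cases j; exacts [⟨0, rfl⟩, ⟨1, rfl⟩, ⟨2, rfl⟩]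

lemma le_cechOpen_single (α : ι) : U α ≤ cechOpen U ![α] :=
  le_iInf fun j => by fin_cases j; exact le_rfl

lemma le_cechOpen_pair (α β : ι) : U α ⊓ U β ≤ cechOpen U ![α, β] :=
  le_iInf fun j => by fin_cases j; exacts [inf_le_left, inf_le_right]

lemma le_cechOpen_triple (α β γ : ι) : U α ⊓ U β ⊓ U γ ≤ cechOpen U ![α, β, γ] :=
  le_iInf fun j => by
    fin_cases j
    exacts [inf_le_left.trans inf_le_left, inf_le_left.trans inf_le_right, inf_le_right]

lemma le_cechOpen_quad (α β γ ν : ι) : U α ⊓ U β ⊓ U γ ⊓ U ν ≤ cechOpen U ![α, β, γ, ν] :=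
  le_iInf fun j => by
    fin_cases j
    exacts [(inf_le_left.trans inf_le_left).trans inf_le_left,
      (inf_le_left.trans inf_le_left).trans inf_le_right, inf_le_left.trans inf_le_right,
      inf_le_right]

lemma cechOpen_quad_le (α β γ ν : ι) : cechOpen U ![α, β, γ, ν] ≤ U α ⊓ U β ⊓ U γ ⊓ U ν :=
  le_inf (le_inf (le_inf (cechOpen_le U ![α, β, γ, ν] 0) (cechOpen_le U ![α, β, γ, ν] 1))
    (cechOpen_le U ![α, β, γ, ν] 2)) (cechOpen_le U ![α, β, γ, ν] 3)

variable {F : TopCat.Sheaf AddCommGrpCat.{u} X}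

lemma cechDelta_pair (c : ∀ σ : Fin 1 → ι, Sec F (cechOpen U σ)) (α β : ι) :
    cechDelta U F c ![α, β] = secRes F (cechOpen_pair_face₀ U α β) (c ![β]) -
      secRes F (cechOpen_pair_face₁ U α β) (c ![α]) := by
  have h0 : ![α, β] ∘ Fin.succAbove (0 : Fin 2) = ![β] := by ext i; fin_cases i; rfl
  have h1 : ![α, β] ∘ Fin.succAbove (1 : Fin 2) = ![α] := by ext i; fin_cases i; rfl
  rw [cechDelta, Fin.sum_univ_two, cech_congr U c h0 _ (cechOpen_pair_face₀ U α β),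
    cech_congr U c h1 _ (cechOpen_pair_face₁ U α β)]
  simp [sub_eq_add_neg]

lemma cechDelta_triple (c : ∀ σ : Fin 2 → ι, Sec F (cechOpen U σ)) (α β γ : ι) :
    cechDelta U F c ![α, β, γ] = secRes F (cechOpen_triple_face₀ U α β γ) (c ![β, γ]) -
      secRes F (cechOpen_triple_face₁ U α β γ) (c ![α, γ]) +
      secRes F (cechOpen_triple_face₂ U α β γ) (c ![α, β]) := by
  have h0 : ![α, β, γ] ∘ Fin.succAbove (0 : Fin 3) = ![β, γ] := by ext i; fin_cases i <;> rfl
  have h1 : ![α, β, γ] ∘ Fin.succAbove (1 : Fin 3) = ![α, γ] := by ext i; fin_cases i <;> rfl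
  have h2 : ![α, β, γ] ∘ Fin.succAbove (2 : Fin 3) = ![α, β] := by ext i; fin_cases i <;> rfl
  rw [cechDelta, Fin.sum_univ_three, cech_congr U c h0 _ (cechOpen_triple_face₀ U α β γ),
    cech_congr U c h1 _ (cechOpen_triple_face₁ U α β γ),
    cech_congr U c h2 _ (cechOpen_triple_face₂ U α β γ)]
  simp [sub_eq_add_neg]

lemma cechDelta_quad (c : ∀ σ : Fin 3 → ι, Sec F (cechOpen U σ)) (α β γ ν : ι) :
    cechDelta U F c ![α, β, γ, ν] = secRes F (cechOpen_quad_face₀ U α β γ ν) (c ![β, γ, ν]) -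
      secRes F (cechOpen_quad_face₁ U α β γ ν) (c ![α, γ, ν]) +
      secRes F (cechOpen_quad_face₂ U α β γ ν) (c ![α, β, ν]) -
      secRes F (cechOpen_quad_face₃ U α β γ ν) (c ![α, β, γ]) := by
  have h0 : ![α, β, γ, ν] ∘ Fin.succAbove (0 : Fin 4) = ![β, γ, ν] := by
    ext i; fin_cases i <;> rfl
  have h1 : ![α, β, γ, ν] ∘ Fin.succAbove (1 : Fin 4) = ![α, γ, ν] := by
    ext i; fin_cases i <;> rfl
  have h2 : ![α, β, γ, ν] ∘ Fin.succAbove (2 : Fin 4) = ![α, β, ν] := by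
    ext i; fin_cases i <;> rfl
  have h3 : ![α, β, γ, ν] ∘ Fin.succAbove (3 : Fin 4) = ![α, β, γ] := by
    ext i; fin_cases i <;> rfl
  rw [cechDelta, Fin.sum_univ_four, cech_congr U c h0 _ (cechOpen_quad_face₀ U α β γ ν),
    cech_congr U c h1 _ (cechOpen_quad_face₁ U α β γ ν),
    cech_congr U c h2 _ (cechOpen_quad_face₂ U α β γ ν),
    cech_congr U c h3 _ (cechOpen_quad_face₃ U α β γ ν)]
  simp [sub_eq_add_neg, pow_succ]

end Faces

/-! ### Total differential of `ℂˣ → A¹ → A²` in components -/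

section Components

variable {m : ℕ} {M : Type u} [TopologicalSpace M] [ChartedSpace (Euc m) M]
  [IsManifold 𝓘(ℝ, Euc m) ∞ M] {ι : Type v} {U : ι → Opens M}

lemma cxSec_ext {V : Opens M} {s t : Sec (X := TopCat.of M) ((cxComplex m M).X 0) V}
    (h : cxSec V s = cxSec V t) : s = t := h

lemma oneSec_ext {V : Opens M} {s t : Sec (X := TopCat.of M) ((cxComplex m M).X 1) V}
    (h : oneSec V s = oneSec V t) : s = t := h

lemma twoSec_ext {V : Opens M} {s t : Sec (X := TopCat.of M) ((cxComplex m M).X 2) V}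
    (h : twoSec V s = twoSec V t) : s = t := h

lemma oneSec_d {V : Opens M} (s : Sec (X := TopCat.of M) ((cxComplex m M).X 0) V) :
    oneSec V (secMap (X := TopCat.of M) ((cxComplex m M).d 0 1) V s) = dlog (cxSec V s) := by
  have h : (cxComplex m M).d 0 1 = dlogHom m M := CochainComplex.of_d (cxX m M) (cxD m M) (j := 0)
  rw [h]; rfl

lemma twoSec_d {V : Opens M} (s : Sec (X := TopCat.of M) ((cxComplex m M).X 1) V) :
    twoSec V (secMap (X := TopCat.of M) ((cxComplex m M).d 1 2) V s) = Form.d (oneSec V s) := by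
  have h : (cxComplex m M).d 1 2 = dHom m M 1 := CochainComplex.of_d (cxX m M) (cxD m M) (j := 1)
  rw [h]; rfl

variable (m M) in
lemma isZero_cxComplex {q : ℤ} (hq : q < 0 ∨ 2 < q) : IsZero ((cxComplex m M).X q) := by
  obtain hq | hq := hq
  · exact (cxComplex m M).isZero_of_isStrictlyGE 0 q hq
  · match q, hq with
    | .ofNat (n + 3), _ => exact isZero_zero _

lemma cxComplex_sec_eq {q : ℤ} (hq : q < 0 ∨ 2 < q) {V : Opens M}
    (s t : Sec (X := TopCat.of M) ((cxComplex m M).X q) V) : s = t := by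
  rw [← secMap_id (X := TopCat.of M) V s, ← secMap_id (X := TopCat.of M) V t,
    (isZero_cxComplex m M hq).eq_of_src (𝟙 _) 0]
  rfl

variable (c : CechFamily (X := TopCat.of M) U (cxComplex m M))

lemma totalD_zero_two (α : ι) : twoSec _ (totalD (X := TopCat.of M) U (cxComplex m M) c 0 2 ![α]) =
    Form.d (oneSec _ (c 0 1 ![α])) := by
  have h := totalD_zero_apply (X := TopCat.of M) c (q := 2) (q' := 1) rfl ![α]
  rw [h, twoSec_d]

lemma totalD_one_one (α β : ι) :
    oneSec _ (totalD (X := TopCat.of M) U (cxComplex m M) c 1 1 ![α, β]) =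
      dlog (cxSec _ (c 1 0 ![α, β])) +
        Form.res (cechOpen_pair_face₁ (X := TopCat.of M) U α β) (oneSec _ (c 0 1 ![α])) -
        Form.res (cechOpen_pair_face₀ (X := TopCat.of M) U α β) (oneSec _ (c 0 1 ![β])) := by
  have h := totalD_succ_apply (X := TopCat.of M) c 0 (q := 1) (q' := 0) rfl ![α, β]
  rw [cechDelta_pair, Int.negOnePow_one] at h
  simp only [Units.val_neg, Units.val_one, neg_smul, one_smul, neg_sub] at h
  refine (congrArg (oneSec _) h).trans ?_
  rw [← oneSec_d, add_sub_assoc]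
  rfl

lemma totalD_two_zero (α β γ : ι) :
    cxSec _ (totalD (X := TopCat.of M) U (cxComplex m M) c 2 0 ![α, β, γ]) =
      CxFun.res (cechOpen_triple_face₀ (X := TopCat.of M) U α β γ) (cxSec _ (c 1 0 ![β, γ])) *
        (CxFun.res (cechOpen_triple_face₁ (X := TopCat.of M) U α β γ) (cxSec _ (c 1 0 ![α, γ])))⁻¹ *
        CxFun.res (cechOpen_triple_face₂ (X := TopCat.of M) U α β γ) (cxSec _ (c 1 0 ![α, β])) := by
  have h := totalD_succ_apply (X := TopCat.of M) c 1 (q := 0) (q' := -1) rfl ![α, β, γ]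
  rw [cechDelta_triple, Int.negOnePow_zero, cxComplex_sec_eq (by decide) (c (1 + 1) (-1) ![α, β, γ]) 0,
    map_zero, zero_add, Units.val_one, one_smul, sub_eq_add_neg] at h
  exact congrArg (cxSec _) h

lemma totalD_one_two (α β : ι) :
    twoSec _ (totalD (X := TopCat.of M) U (cxComplex m M) c 1 2 ![α, β]) =
      Form.d (oneSec _ (c 1 1 ![α, β])) +
        Form.res (cechOpen_pair_face₀ (X := TopCat.of M) U α β) (twoSec _ (c 0 2 ![β])) -
        Form.res (cechOpen_pair_face₁ (X := TopCat.of M) U α β) (twoSec _ (c 0 2 ![α])) := by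
  have h := totalD_succ_apply (X := TopCat.of M) c 0 (q := 2) (q' := 1) rfl ![α, β]
  have h2 : Int.negOnePow 2 = 1 := by decide
  rw [cechDelta_pair, h2] at h
  simp only [Units.val_one, one_smul] at h
  refine (congrArg (twoSec _) h).trans ?_
  rw [← twoSec_d, add_sub_assoc]
  rfl

lemma totalD_two_one (α β γ : ι) :
    oneSec _ (totalD (X := TopCat.of M) U (cxComplex m M) c 2 1 ![α, β, γ]) =
      dlog (cxSec _ (c 2 0 ![α, β, γ])) -
        (Form.res (cechOpen_triple_face₀ (X := TopCat.of M) U α β γ) (oneSec _ (c 1 1 ![β, γ])) -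
        Form.res (cechOpen_triple_face₁ (X := TopCat.of M) U α β γ) (oneSec _ (c 1 1 ![α, γ])) +
        Form.res (cechOpen_triple_face₂ (X := TopCat.of M) U α β γ) (oneSec _ (c 1 1 ![α, β]))) := by
  have h := totalD_succ_apply (X := TopCat.of M) c 1 (q := 1) (q' := 0) rfl ![α, β, γ]
  rw [cechDelta_triple, Int.negOnePow_one] at h
  simp only [Units.val_neg, Units.val_one, neg_smul, one_smul] at h
  refine (congrArg (oneSec _) h).trans ?_
  rw [← oneSec_d, sub_eq_add_neg]
  rfl

lemma totalD_three_zero (α β γ ν : ι) :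
    cxSec _ (totalD (X := TopCat.of M) U (cxComplex m M) c 3 0 ![α, β, γ, ν]) =
      CxFun.res (cechOpen_quad_face₀ (X := TopCat.of M) U α β γ ν) (cxSec _ (c 2 0 ![β, γ, ν])) *
        (CxFun.res (cechOpen_quad_face₁ (X := TopCat.of M) U α β γ ν)
          (cxSec _ (c 2 0 ![α, γ, ν])))⁻¹ *
        CxFun.res (cechOpen_quad_face₂ (X := TopCat.of M) U α β γ ν) (cxSec _ (c 2 0 ![α, β, ν])) *
        (CxFun.res (cechOpen_quad_face₃ (X := TopCat.of M) U α β γ ν)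
          (cxSec _ (c 2 0 ![α, β, γ])))⁻¹ := by
  have h := totalD_succ_apply (X := TopCat.of M) c 2 (q := 0) (q' := -1) rfl ![α, β, γ, ν]
  rw [cechDelta_quad, Int.negOnePow_zero,
    cxComplex_sec_eq (by decide) (c (2 + 1) (-1) ![α, β, γ, ν]) 0, map_zero, zero_add,
    Units.val_one, one_smul] at h
  refine (congrArg (cxSec _) h).trans ?_
  rw [sub_eq_add_neg, sub_eq_add_neg]
  rfl

variable {c} {c' : CechFamily (X := TopCat.of M) U (cxComplex m M)}

/-- The terms of the complex vanish outside degrees 0, 1, 2, which leaves three bidegrees. -/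
lemma cechCochains_two_ext (hc : c ∈ cechCochains (X := TopCat.of M) U (cxComplex m M) 2)
    (hc' : c' ∈ cechCochains (X := TopCat.of M) U (cxComplex m M) 2)
    (h0 : ∀ α β γ, cxSec _ (c 2 0 ![α, β, γ]) = cxSec _ (c' 2 0 ![α, β, γ]))
    (h1 : ∀ α β, oneSec _ (c 1 1 ![α, β]) = oneSec _ (c' 1 1 ![α, β]))
    (h2 : ∀ α, twoSec _ (c 0 2 ![α]) = twoSec _ (c' 0 2 ![α])) : c = c' := by
  refine cechFamily_ext (X := TopCat.of M) fun p q σ => ?_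
  by_cases hpq : (p : ℤ) + q = 2
  · match p, σ with
    | 0, σ =>
      obtain rfl : q = 2 := by push_cast at hpq; omega
      obtain ⟨α, rfl⟩ : ∃ α, σ = ![α] := ⟨σ 0, by ext i; fin_cases i; rfl⟩
      exact twoSec_ext (h2 _)
    | 1, σ =>
      obtain rfl : q = 1 := by push_cast at hpq; omega
      obtain ⟨α, β, rfl⟩ : ∃ α β, σ = ![α, β] := ⟨σ 0, σ 1, by ext i; fin_cases i <;> rfl⟩
      exact oneSec_ext (h1 _ _)
    | 2, σ =>
      obtain rfl : q = 0 := by push_cast at hpq; omega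
      obtain ⟨α, β, γ, rfl⟩ : ∃ α β γ, σ = ![α, β, γ] :=
        ⟨σ 0, σ 1, σ 2, by ext i; fin_cases i <;> rfl⟩
      exact cxSec_ext (h0 _ _ _)
    | p + 3, σ => exact cxComplex_sec_eq (Or.inl (by push_cast at hpq; omega)) _ _
  · rw [hc p q hpq, hc' p q hpq]

/-- The bidegree (0, 3) drops out since the complex has no term in degree 3, so the three conditions
match the three equations of a B-field. -/
lemma cechCochains_three_ext (hc : c ∈ cechCochains (X := TopCat.of M) U (cxComplex m M) 3)
    (h0 : ∀ α β γ ν, cxSec _ (c 3 0 ![α, β, γ, ν]) = 1)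
    (h1 : ∀ α β γ, oneSec _ (c 2 1 ![α, β, γ]) = 0)
    (h2 : ∀ α β, twoSec _ (c 1 2 ![α, β]) = 0) : c = 0 := by
  refine cechFamily_ext (X := TopCat.of M) fun p q σ => ?_
  by_cases hpq : (p : ℤ) + q = 3
  · match p, σ with
    | 0, σ => exact cxComplex_sec_eq (Or.inr (by push_cast at hpq; omega)) _ _
    | 1, σ =>
      obtain rfl : q = 2 := by push_cast at hpq; omega
      obtain ⟨α, β, rfl⟩ : ∃ α β, σ = ![α, β] := ⟨σ 0, σ 1, by ext i; fin_cases i <;> rfl⟩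
      exact twoSec_ext (h2 _ _)
    | 2, σ =>
      obtain rfl : q = 1 := by push_cast at hpq; omega
      obtain ⟨α, β, γ, rfl⟩ : ∃ α β γ, σ = ![α, β, γ] :=
        ⟨σ 0, σ 1, σ 2, by ext i; fin_cases i <;> rfl⟩
      exact oneSec_ext (h1 _ _ _)
    | 3, σ =>
      obtain rfl : q = 0 := by push_cast at hpq; omega
      obtain ⟨α, β, γ, ν, rfl⟩ : ∃ α β γ ν, σ = ![α, β, γ, ν] :=
        ⟨σ 0, σ 1, σ 2, σ 3, by ext i; fin_cases i <;> rfl⟩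
      exact cxSec_ext (h0 _ _ _ _)
    | p + 4, σ => exact cxComplex_sec_eq (Or.inl (by push_cast at hpq; omega)) _ _
  · rw [hc p q hpq]; rfl

end Components

/-! ### Cochains with prescribed components -/

section CochainExistence

variable {X : TopCat.{u}} {ι : Type v} {U : ι → Opens X}
  {K : CochainComplex (TopCat.Sheaf AddCommGrpCat.{u} X) ℤ}

lemma exists_mem_cechCochains_one (F : ∀ σ : Fin 2 → ι, Sec (K.X 0) (cechOpen U σ))
    (a : ∀ σ : Fin 1 → ι, Sec (K.X 1) (cechOpen U σ)) :
    ∃ c ∈ cechCochains U K 1, c 1 0 = F ∧ c 0 1 = a := by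
  refine ⟨cechSingle U 1 0 F + cechSingle U 0 1 a,
    add_mem (cechSingle_mem U _ rfl) (cechSingle_mem U _ rfl), ?_, ?_⟩
  · rw [Pi.add_apply, Pi.add_apply, cechSingle_same, cechSingle_of_ne U _ (by decide), add_zero]
  · rw [Pi.add_apply, Pi.add_apply, cechSingle_same, cechSingle_of_ne U _ (by decide)]
    exact zero_add a

lemma exists_mem_cechCochains_two (H : ∀ σ : Fin 3 → ι, Sec (K.X 0) (cechOpen U σ))
    (A : ∀ σ : Fin 2 → ι, Sec (K.X 1) (cechOpen U σ))
    (B : ∀ σ : Fin 1 → ι, Sec (K.X 2) (cechOpen U σ)) :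
    ∃ c ∈ cechCochains U K 2, c 2 0 = H ∧ c 1 1 = A ∧ c 0 2 = B := by
  refine ⟨cechSingle U 2 0 H + cechSingle U 1 1 A + cechSingle U 0 2 B,
    add_mem (add_mem (cechSingle_mem U _ rfl) (cechSingle_mem U _ rfl)) (cechSingle_mem U _ rfl),
    ?_, ?_, ?_⟩
  · rw [Pi.add_apply, Pi.add_apply, Pi.add_apply, Pi.add_apply, cechSingle_same,
      cechSingle_of_ne U _ (by decide), cechSingle_of_ne U _ (by decide), add_zero, add_zero]
  · rw [Pi.add_apply, Pi.add_apply, Pi.add_apply, Pi.add_apply, cechSingle_same,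
      cechSingle_of_ne U _ (by decide), cechSingle_of_ne U _ (by decide), add_zero, zero_add]
  · rw [Pi.add_apply, Pi.add_apply, Pi.add_apply, Pi.add_apply, cechSingle_same,
      cechSingle_of_ne U _ (by decide), cechSingle_of_ne U _ (by decide), add_zero]
    exact zero_add B

end CochainExistence

/-! ### Rearrangements in commutative groups -/

section GroupIdentities

variable {G : Type*}

lemma eq_sub_of_zero_eq [AddCommGroup G] {a b c : G} (h : 0 = a + b - c) : c - b = a := by
  rw [sub_eq_iff_eq_add, ← sub_eq_zero, ← neg_sub, ← h, neg_zero]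

lemma add_sub_eq_of_zero_eq [AddCommGroup G] {a b c d : G} (h : 0 = a - (b - c + d)) :
    d + b - c = a := by
  rw [eq_comm, sub_eq_zero] at h
  rw [h]; abel

lemma mul_eq_one_of_one_eq [CommGroup G] {a b c d : G} (h : 1 = a * b⁻¹ * c * d⁻¹) :
    d⁻¹ * c * b⁻¹ * a = 1 := by
  rw [h]; ac_rfl

lemma add_sub_eq_sub_of_eq [AddCommGroup G] {a b p q r : G} (h : b = a + p + q - r) :
    p + q - r = b - a := by
  rw [h]; abel

end GroupIdentities

/-! ### B-fields as Čech cocycles, isomorphisms as coboundaries -/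

section BFieldCocycles

variable {m : ℕ} {M : Type u} [TopologicalSpace M] [ChartedSpace (Euc m) M]
  [IsManifold 𝓘(ℝ, Euc m) ∞ M] {ι : Type v} {U : ι → Opens M}

/-- Used to pass between `cechOpen` and the binary intersections in `BField`, which are equal as
open sets but not by definition. -/
lemma CxFun.res_injective {V W : Opens M} (h : W ≤ V) (h' : V ≤ W) :
    Function.Injective (CxFun.res (m := m) h) := fun _ _ hfg => congrArg (CxFun.res h') hfg

lemma Form.res_injective {k : ℕ} {V W : Opens M} (h : W ≤ V) (h' : V ≤ W) :
    Function.Injective (Form.res (m := m) (k := k) h) := fun _ _ hfg => congrArg (Form.res h') hfg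

lemma exists_cochain_two
    (H : ∀ σ : Fin 3 → ι, CxFun m (cechOpen (X := TopCat.of M) U σ))
    (A : ∀ σ : Fin 2 → ι, Form m 1 (cechOpen (X := TopCat.of M) U σ))
    (B : ∀ σ : Fin 1 → ι, Form m 2 (cechOpen (X := TopCat.of M) U σ)) :
    ∃ c ∈ cechCochains (X := TopCat.of M) U (cxComplex m M) 2, (∀ σ, cxSec _ (c 2 0 σ) = H σ) ∧
      (∀ σ, oneSec _ (c 1 1 σ) = A σ) ∧ ∀ σ, twoSec _ (c 0 2 σ) = B σ := by
  obtain ⟨c, hc, h0, h1, h2⟩ := exists_mem_cechCochains_two (X := TopCat.of M) (ι := ι) (U := U)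
    (K := cxComplex m M) (fun σ => Additive.ofMul (H σ)) (fun σ => A σ) (fun σ => B σ)
  exact ⟨c, hc, fun σ => congrFun h0 σ, fun σ => congrFun h1 σ, fun σ => congrFun h2 σ⟩

lemma exists_cochain_one (F : ∀ σ : Fin 2 → ι, CxFun m (cechOpen (X := TopCat.of M) U σ))
    (a : ∀ σ : Fin 1 → ι, Form m 1 (cechOpen (X := TopCat.of M) U σ)) :
    ∃ c ∈ cechCochains (X := TopCat.of M) U (cxComplex m M) 1, (∀ σ, cxSec _ (c 1 0 σ) = F σ) ∧
      ∀ σ, oneSec _ (c 0 1 σ) = a σ := by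
  obtain ⟨c, hc, h0, h1⟩ := exists_mem_cechCochains_one (X := TopCat.of M) (ι := ι) (U := U)
    (K := cxComplex m M) (fun σ => Additive.ofMul (F σ)) (fun σ => a σ)
  exact ⟨c, hc, fun σ => congrFun h0 σ, fun σ => congrFun h1 σ⟩

lemma BField.exists_hasComponents (b : BField m U) :
    ∃ c ∈ cechCochains (X := TopCat.of M) U (cxComplex m M) 2, b.HasComponents c := by
  have h3 (σ : Fin 3 → ι) : cechOpen (X := TopCat.of M) U σ ≤ U (σ 0) ⊓ U (σ 1) ⊓ U (σ 2) :=
    le_inf (le_inf (cechOpen_le (X := TopCat.of M) U σ 0) (cechOpen_le (X := TopCat.of M) U σ 1))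
      (cechOpen_le (X := TopCat.of M) U σ 2)
  have h2 (σ : Fin 2 → ι) : cechOpen (X := TopCat.of M) U σ ≤ U (σ 0) ⊓ U (σ 1) :=
    le_inf (cechOpen_le (X := TopCat.of M) U σ 0) (cechOpen_le (X := TopCat.of M) U σ 1)
  obtain ⟨c, hc, hH, hA, hB⟩ := exists_cochain_two (U := U)
    (fun σ => CxFun.res (h3 σ) (b.h (σ 0) (σ 1) (σ 2))) (fun σ => Form.res (h2 σ) (b.A (σ 0) (σ 1)))
    (fun σ => Form.res (cechOpen_le (X := TopCat.of M) U σ 0) (b.B (σ 0)))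
  exact ⟨c, hc, fun α β γ => hH ![α, β, γ], fun α β => hA ![α, β], fun α => hB ![α]⟩

variable {b b' : BField m U} {c c' : CechFamily (X := TopCat.of M) U (cxComplex m M)}

lemma BField.HasComponents.unique (h : b.HasComponents c) (h' : b.HasComponents c')
    (hc : c ∈ cechCochains (X := TopCat.of M) U (cxComplex m M) 2)
    (hc' : c' ∈ cechCochains (X := TopCat.of M) U (cxComplex m M) 2) : c = c' :=
  cechCochains_two_ext hc hc' (fun α β γ => (h.1 α β γ).trans (h'.1 α β γ).symm)
    (fun α β => (h.2.1 α β).trans (h'.2.1 α β).symm) fun α => (h.2.2 α).trans (h'.2.2 α).symm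

lemma BField.HasComponents.injective (h : b.HasComponents c) (h' : b'.HasComponents c) :
    b = b' := by
  refine BField.ext ?_ ?_ ?_
  · funext α β γ
    exact CxFun.res_injective _ (le_cechOpen_triple (X := TopCat.of M) U α β γ)
      ((h.1 α β γ).symm.trans (h'.1 α β γ))
  · funext α β
    exact Form.res_injective _ (le_cechOpen_pair (X := TopCat.of M) U α β)
      ((h.2.1 α β).symm.trans (h'.2.1 α β))
  · funext α
    exact Form.res_injective _ (le_cechOpen_single (X := TopCat.of M) U α)
      ((h.2.2 α).symm.trans (h'.2.2 α))

/-- In bidegrees (3, 0), (2, 1) and (1, 2) the total differential is, up to order and sign, the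
difference of the two sides of the equation on h, on A and on B respectively. -/
lemma BField.HasComponents.totalD_eq_zero (h : b.HasComponents c)
    (hc : c ∈ cechCochains (X := TopCat.of M) U (cxComplex m M) 2) :
    totalD (X := TopCat.of M) U (cxComplex m M) c = 0 := by
  refine cechCochains_three_ext (totalD_mem_cochains (X := TopCat.of M) hc rfl)
    (fun α β γ ν => ?_) (fun α β γ => ?_) fun α β => ?_
  · rw [totalD_three_zero, h.1, h.1, h.1, h.1]
    have e := congrArg (CxFun.res (cechOpen_quad_le (X := TopCat.of M) U α β γ ν)) (b.cocycle α β γ ν)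
    refine Eq.trans ?_ e
    rw [map_mul, map_mul, map_mul, map_inv, map_inv]
    rw [mul_comm, mul_assoc, mul_comm (CxFun.res _ _)]
    rw [mul_assoc, mul_assoc, mul_assoc, mul_left_comm (CxFun.res _ (CxFun.res _ (b.h α γ ν)))⁻¹]
    rfl
  · rw [totalD_two_one, h.1, h.2.1, h.2.1, h.2.1, dlog_res]
    have e := congrArg (Form.res (cechOpen_triple_le (X := TopCat.of M) U α β γ))
      (b.connection α β γ)
    rw [← e, sub_eq_zero, map_sub, map_add]
    have aux (x y z : Form m 1 (cechOpen (X := TopCat.of M) U ![α, β, γ])) :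
        x + y - z = y - z + x := by abel
    exact aux _ _ _
  · rw [totalD_one_two, h.2.1, h.2.2, h.2.2, Form.d_res]
    have e := congrArg (Form.res (cechOpen_pair_le (X := TopCat.of M) U α β)) (b.curving α β)
    rw [← e, map_sub, sub_eq_zero]
    exact sub_add_cancel _ _

lemma exists_bfield (hc : c ∈ cechCocycles (X := TopCat.of M) U (cxComplex m M) 2) :
    ∃ b : BField m U, b.HasComponents c := by
  have hD : totalD (X := TopCat.of M) U (cxComplex m M) c = 0 := hc.2
  refine ⟨
    { h := fun α β γ => CxFun.res (le_cechOpen_triple (X := TopCat.of M) U α β γ)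
        (cxSec _ (c 2 0 ![α, β, γ]))
      A := fun α β => Form.res (le_cechOpen_pair (X := TopCat.of M) U α β)
        (oneSec _ (c 1 1 ![α, β]))
      B := fun α => Form.res (le_cechOpen_single (X := TopCat.of M) U α) (twoSec _ (c 0 2 ![α]))
      curving := fun α β => ?_
      connection := fun α β γ => ?_
      cocycle := fun α β γ ν => ?_ }, fun α β γ => rfl, fun α β => rfl, fun α => rfl⟩
  · have e := totalD_one_two c α β
    rw [hD] at e
    have e' := congrArg (Form.res (le_cechOpen_pair (X := TopCat.of M) U α β)) e
    rw [map_sub, map_add, ← Form.d_res] at e'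
    exact eq_sub_of_zero_eq e'
  · have e := totalD_two_one c α β γ
    rw [hD] at e
    have e' := congrArg (Form.res (le_cechOpen_triple (X := TopCat.of M) U α β γ)) e
    rw [map_sub, map_add, map_sub, ← dlog_res] at e'
    exact add_sub_eq_of_zero_eq e'
  · have e := totalD_three_zero c α β γ ν
    rw [hD] at e
    have e' := congrArg (CxFun.res (le_cechOpen_quad (X := TopCat.of M) U α β γ ν)) e
    rw [map_mul, map_mul, map_mul, map_inv, map_inv] at e'
    exact mul_eq_one_of_one_eq e'

/-- An isomorphism (f, a) is a 1-cochain. Its total differential has components δf, d log f - δa and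
da, and the sign -1 in degree 1 turns δa into a_α - a_β with the orientation demanded of an
isomorphism. -/
lemma BField.HasComponents.isomorphic_iff (h : b.HasComponents c) (h' : b'.HasComponents c')
    (hc : c ∈ cechCochains (X := TopCat.of M) U (cxComplex m M) 2)
    (hc' : c' ∈ cechCochains (X := TopCat.of M) U (cxComplex m M) 2) :
    BField.Isomorphic b b' ↔
      c' - c ∈ cechCoboundaries (X := TopCat.of M) U (cxComplex m M) 2 := by
  constructor
  · rintro ⟨f, a, h1, h2, h3⟩
    have hle (σ : Fin 2 → ι) : cechOpen (X := TopCat.of M) U σ ≤ U (σ 0) ⊓ U (σ 1) :=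
      le_inf (cechOpen_le (X := TopCat.of M) U σ 0) (cechOpen_le (X := TopCat.of M) U σ 1)
    obtain ⟨g, hg, hg0, hg1⟩ := exists_cochain_one (U := U)
      (fun σ => CxFun.res (hle σ) (f (σ 0) (σ 1)))
      (fun σ => Form.res (cechOpen_le (X := TopCat.of M) U σ 0) (a (σ 0)))
    refine ⟨g, hg, cechCochains_two_ext (totalD_mem_cochains (X := TopCat.of M) hg rfl)
      (sub_mem hc' hc) (fun α β γ => ?_) (fun α β => ?_) fun α => ?_⟩
    · rw [totalD_two_zero, hg0, hg0, hg0]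
      have e := congrArg (CxFun.res (cechOpen_triple_le (X := TopCat.of M) U α β γ)) (h1 α β γ)
      rw [map_mul, ← h.1, ← h'.1] at e
      exact (eq_div_of_mul_eq' (by rw [mul_comm]; exact e.symm)).trans (div_eq_mul_inv _ _)
    · rw [totalD_one_one, hg0, hg1, hg1]
      have e := congrArg (Form.res (cechOpen_pair_le (X := TopCat.of M) U α β)) (h2 α β)
      rw [map_sub, map_add, map_add, ← h.2.1, ← h'.2.1, ← dlog_res] at e
      exact add_sub_eq_sub_of_eq e
    · rw [totalD_zero_two, hg1]
      have e := congrArg (Form.res (cechOpen_single_le (X := TopCat.of M) U α)) (h3 α)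
      rw [map_add, ← h.2.2, ← h'.2.2, ← Form.d_res] at e
      exact eq_sub_of_add_eq' e.symm
  · rintro ⟨g, -, hgc⟩
    have hgc' : c' = c + totalD (X := TopCat.of M) U (cxComplex m M) g :=
      (eq_add_of_sub_eq' hgc.symm)
    refine ⟨fun α β => CxFun.res (le_cechOpen_pair (X := TopCat.of M) U α β)
        (cxSec _ (g 1 0 ![α, β])),
      fun α => Form.res (le_cechOpen_single (X := TopCat.of M) U α) (oneSec _ (g 0 1 ![α])),
      fun α β γ => ?_, fun α β => ?_, fun α => ?_⟩
    · have e : cxSec _ (c' 2 0 ![α, β, γ]) = cxSec _ (c 2 0 ![α, β, γ]) * cxSec _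
          (totalD (X := TopCat.of M) U (cxComplex m M) g 2 0 ![α, β, γ]) := by rw [hgc']; rfl
      rw [totalD_two_zero, h.1, h'.1] at e
      exact congrArg (CxFun.res (le_cechOpen_triple (X := TopCat.of M) U α β γ)) e
    · have e : oneSec _ (c' 1 1 ![α, β]) = oneSec _ (c 1 1 ![α, β]) + oneSec _
          (totalD (X := TopCat.of M) U (cxComplex m M) g 1 1 ![α, β]) := by rw [hgc']; rfl
      rw [totalD_one_one, h.2.1, h'.2.1] at e
      have e' := congrArg (Form.res (le_cechOpen_pair (X := TopCat.of M) U α β)) e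
      rw [← add_sub_assoc, ← add_assoc, map_sub, map_add, map_add, ← dlog_res] at e'
      exact e'
    · have e : twoSec _ (c' 0 2 ![α]) = twoSec _ (c 0 2 ![α]) + twoSec _
          (totalD (X := TopCat.of M) U (cxComplex m M) g 0 2 ![α]) := by rw [hgc']; rfl
      rw [totalD_zero_two, h.2.2, h'.2.2] at e
      have e' := congrArg (Form.res (le_cechOpen_single (X := TopCat.of M) U α)) e
      rw [map_add, ← Form.d_res] at e'
      exact e'

variable (m U) in
/-- `B`-fields are the `2`-cocycles of the Čech complex. -/
lemma exists_bfield_equiv :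
    ∃ e : BField m U ≃ cechCocycles (X := TopCat.of M) U (cxComplex m M) 2,
      ∀ b : BField m U, b.HasComponents (e b).1 := by
  choose c hc hb using fun b : BField m U => b.exists_hasComponents
  refine ⟨Equiv.ofBijective (fun b => ⟨c b, hc b, (hb b).totalD_eq_zero (hc b)⟩)
    ⟨fun b b' h => ?_, fun z => ?_⟩, hb⟩
  · have h' : c b = c b' := congrArg Subtype.val h
    exact (hb b).injective (h' ▸ hb b')
  · obtain ⟨b, h⟩ := exists_bfield z.2
    exact ⟨b, Subtype.ext ((hb b).unique h (hc b) z.2.1)⟩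

variable (m U) in
lemma exists_isoClass_equiv (e : BField m U ≃ cechCocycles (X := TopCat.of M) U (cxComplex m M) 2)
    (he : ∀ b : BField m U, b.HasComponents (e b).1) :
    ∃ Φ : BField.IsoClass m U ≃ CechCohomology (X := TopCat.of M) U (cxComplex m M) 2,
      ∀ b, Φ (Quotient.mk _ b) = QuotientAddGroup.mk (e b) := by
  refine ⟨Quotient.congr e fun b b' => ?_, fun b => rfl⟩
  refine ((he b).isomorphic_iff (he b') (e b).2.1 (e b').2.1).trans ?_
  rw [QuotientAddGroup.leftRel_apply, AddSubgroup.mem_addSubgroupOf, ← sub_eq_neg_add]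
  rfl

end BFieldCocycles

/-! ### Comparison isomorphism for Leray covers -/

section LerayCovers

variable {m : ℕ} {M : Type u} [TopologicalSpace M] [T2Space M] [ParacompactSpace M]
  [ChartedSpace (Euc m) M] [IsManifold 𝓘(ℝ, Euc m) ∞ M] {ι : Type v} {U : ι → Opens M}

/-- The bound leaves only H¹ and H² of ℂˣ and H¹ of `A¹`; negative degrees are zero sheaves. -/
lemma cxComplex_vanishes (V : Opens M) [ContractibleSpace V] (i : ℤ) (k : ℕ)
    (h : i + (k + 1 : ℕ) ≤ 2) : Vanishes (X := TopCat.of M) ((cxComplex m M).X i) V (k + 1) := by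
  match i, k, h with
  | .negSucc i, k, _ => exact vanishes_of_isZero (X := TopCat.of M) (isZero_zero _) V _
  | 0, 0, _ => exact (cxSheaf_vanishes V).1
  | 0, 1, _ => exact (cxSheaf_vanishes V).2
  | .ofNat 1, 0, _ => exact formSheaf_vanishes V 1 0
  | .ofNat 0, k + 2, h | .ofNat 1, k + 1, h => exact absurd h (by simp; omega)
  | .ofNat (i + 2), k, h => exact absurd h (by simp; omega)

lemma IsLerayCover.coneExact (hU : IsLerayCover (X := TopCat.of M) U) (p : ℕ) (σ : Fin (p + 1) → ι)
    (q : ℤ) (hq : q ≤ 2) :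
    ConeExact (injRes (cxComplex m M)).aug (cechOpen (X := TopCat.of M) U σ) q := by
  have := (injRes (cxComplex m M)).injective
  have := (injRes (cxComplex m M)).bounded
  have := (injRes (cxComplex m M)).quasiIso
  by_cases h : (cechOpen (X := TopCat.of M) U σ : Set M).Nonempty
  · have : ContractibleSpace (cechOpen (X := TopCat.of M) U σ) := hU.contractible p σ h
    exact coneExact_of_vanishes _ (cxComplex_vanishes _) hq
  · exact coneExact_of_eq_empty _ (Set.not_nonempty_iff_eq_empty.1 h) q

lemma IsLerayCover.exists_comparison (hU : IsLerayCover (X := TopCat.of M) U) :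
    ∃ κ : CechCohomology (X := TopCat.of M) U (cxComplex m M) 2 ≃+
      Hypercohomology (cxComplex m M) 2,
      IsCechComparison (X := TopCat.of M) U (cxComplex m M) 2 κ :=
  exists_cech_comparison (X := TopCat.of M) U hU.iSup_eq_top 2 hU.coneExact

end LerayCovers

/-! ### Quasi-isomorphisms and lifts to K-injective complexes -/

section QuasiIsomorphisms

variable {C : Type u} [Category.{v} C] [Abelian C]

instance quasiIso_reindexMap {K L : CochainComplex C ℤ} (φ : K ⟶ L) [QuasiIso φ] (a : ℤ) :
    QuasiIso (reindexMap φ a) where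
  quasiIsoAt n := by
    rw [quasiIsoAt_iff' _ (n - 1) n (n + 1) (by simp) (by simp)]
    exact (quasiIsoAt_iff' φ (n - 1 + a) (n + a) (n + 1 + a) (by simp; omega) (by simp; omega)).1
      inferInstance

lemma reindex_isStrictlyGE {K : CochainComplex C ℤ} [K.IsStrictlyGE 0] (a : ℤ) :
    (reindex K a).IsStrictlyGE (-a) := by
  rw [CochainComplex.isStrictlyGE_iff]
  intro i hi
  exact K.isZero_of_isStrictlyGE 0 _ (by omega)

/-- An epimorphism of complexes with acyclic kernel is a quasi-isomorphism. -/
lemma quasiIso_of_epi_of_acyclic_kernel {K L : CochainComplex C ℤ} (φ : K ⟶ L) [∀ n, Epi (φ.f n)]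
    (h : ∀ (n : ℤ) ⦃A : C⦄ (x : A ⟶ K.X n), x ≫ φ.f n = 0 → x ≫ K.d n (n + 1) = 0 →
      ∃ (A' : C) (π : A' ⟶ A) (_ : Epi π) (z : A' ⟶ K.X (n - 1)), z ≫ φ.f (n - 1) = 0 ∧
        π ≫ x = z ≫ K.d (n - 1) n) : QuasiIso φ where
  quasiIsoAt n := by
    rw [quasiIsoAt_iff_isIso_homologyMap]
    have : Mono (HomologicalComplex.homologyMap φ n) := by
      rw [HomologicalComplex.mono_homologyMap_iff_up_to_refinements φ (n - 1) n (n + 1) (by simp)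
        (by simp)]
      intro A x hx y hxy
      obtain ⟨A₁, π₁, hπ₁, x₁, h₁⟩ := surjective_up_to_refinements_of_epi (φ.f (n - 1)) y
      obtain ⟨A₂, π₂, hπ₂, z, -, h₂⟩ := h n (π₁ ≫ x - x₁ ≫ K.d (n - 1) n)
        (by rw [Preadditive.sub_comp, Category.assoc, Category.assoc, hxy, ← φ.comm,
          reassoc_of% h₁, sub_self])
        (by rw [Preadditive.sub_comp, Category.assoc, Category.assoc, hx, K.d_comp_d, comp_zero,
          comp_zero, sub_zero])
      refine ⟨A₂, π₂ ≫ π₁, inferInstance, π₂ ≫ x₁ + z, ?_⟩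
      rw [Preadditive.add_comp, ← h₂, Preadditive.comp_sub, Category.assoc, Category.assoc,
        add_sub_cancel]
    have : Epi (HomologicalComplex.homologyMap φ n) := by
      rw [HomologicalComplex.epi_homologyMap_iff_up_to_refinements φ (n - 1) n (n + 1) (by simp)
        (by simp)]
      intro A y hy
      obtain ⟨A₁, π₁, hπ₁, x, h₁⟩ := surjective_up_to_refinements_of_epi (φ.f n) y
      obtain ⟨A₂, π₂, hπ₂, z, hz, h₂⟩ := h (n + 1) (x ≫ K.d n (n + 1))
        (by rw [Category.assoc, ← φ.comm, ← reassoc_of% h₁, hy, comp_zero])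
        (by rw [Category.assoc, K.d_comp_d, comp_zero])
      -- Transport of `z` along n + 1 - 1 = n, an equality that does not hold by definition.
      obtain ⟨z, rfl⟩ : ∃ z' : A₂ ⟶ K.X n, z = z' ≫ eqToHom (by rw [add_sub_cancel_right]) :=
        ⟨z ≫ eqToHom (by rw [add_sub_cancel_right]), by simp⟩
      have hz' : z ≫ φ.f n = 0 := by
        have key : ∀ (k : ℤ) (e : n = k), (z ≫ eqToHom (by rw [e])) ≫ φ.f k = 0 →
          z ≫ φ.f n = 0 := by rintro k rfl; simp
        exact key _ (by omega) hz
      have hd : π₂ ≫ x ≫ K.d n (n + 1) = z ≫ K.d n (n + 1) := by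
        have key : ∀ (k : ℤ) (e : n = k), π₂ ≫ x ≫ K.d n (n + 1) =
          (z ≫ eqToHom (by rw [e])) ≫ K.d k (n + 1) →
          π₂ ≫ x ≫ K.d n (n + 1) = z ≫ K.d n (n + 1) := by rintro k rfl; simp
        exact key _ (by omega) h₂
      refine ⟨A₂, π₂ ≫ π₁, inferInstance, π₂ ≫ x - z, ?_, 0, ?_⟩
      · rw [Preadditive.sub_comp, Category.assoc, hd, sub_self]
      · rw [Preadditive.sub_comp, Category.assoc, Category.assoc, hz', sub_zero, zero_comp,
          add_zero, h₁]
    exact isIso_of_mono_of_epi _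

open DerivedCategory in
attribute [local instance] HasDerivedCategory.standard in
-- In the derived category `f` is invertible, and morphisms into a K-injective complex are the same
-- there as in the homotopy category.
lemma exists_homotopy_lift {K T T' : CochainComplex C ℤ} (f : K ⟶ T) [QuasiIso f]
    [T'.IsKInjective] (ψ : K ⟶ T') : ∃ g : T ⟶ T', Nonempty (Homotopy (f ≫ g) ψ) := by
  obtain ⟨g, hg⟩ := (CochainComplex.IsKInjective.Qh_map_bijective _ T').surjective
    ((quotientCompQhIso C).hom.app T ≫ inv (Q.map f) ≫ Q.map ψ ≫ (quotientCompQhIso C).inv.app T')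
  obtain ⟨g, rfl⟩ := (HomotopyCategory.quotient C (ComplexShape.up ℤ)).map_surjective g
  refine ⟨g, ⟨HomotopyCategory.homotopyOfEq _ _
    ((CochainComplex.IsKInjective.Qh_map_bijective _ T').injective ?_)⟩⟩
  rw [Functor.map_comp, Functor.map_comp, hg]
  simp only [← Category.assoc, quotientCompQhIso_hom_naturality]
  simp only [Category.assoc, IsIso.hom_inv_id_assoc]
  rw [quotientCompQhIso_inv_naturality, Iso.hom_inv_id_app_assoc]

/-- The lift is a quasi-isomorphism by two-out-of-three, and a quasi-isomorphism between K-injective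
complexes is a homotopy equivalence. -/
lemma exists_homotopyEquiv_lift {K T T' : CochainComplex C ℤ} (f : K ⟶ T) [QuasiIso f]
    [T.IsKInjective] [T'.IsKInjective] (ψ : K ⟶ T') [QuasiIso ψ] :
    ∃ e : HomotopyEquiv T T', Nonempty (Homotopy (f ≫ e.hom) ψ) := by
  obtain ⟨g, ⟨h⟩⟩ := exists_homotopy_lift f ψ
  have : QuasiIso (f ≫ g) := by
    refine ⟨fun n => ?_⟩
    rw [quasiIsoAt_iff_isIso_homologyMap, h.homologyMap_eq]
    infer_instance
  have : QuasiIso g := quasiIso_of_comp_left f g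
  obtain ⟨e, rfl⟩ := (CochainComplex.IsKInjective.quasiIso_iff g).1 inferInstance
  exact ⟨e, ⟨h⟩⟩

end QuasiIsomorphisms

/-! ### Homotopy invariance of the cohomology of global sections -/

section GlobalSections

variable {X : TopCat.{u}} {T T' : CochainComplex (TopCat.Sheaf AddCommGrpCat.{u} X) ℤ} {n : ℤ}

lemma secMap_mem_globalCocycles (f : T ⟶ T') {t : Sec (T.X n) ⊤} (ht : t ∈ globalCocycles T n) :
    secMap (f.f n) ⊤ t ∈ globalCocycles T' n := by
  change secMap _ _ _ = 0
  have ht' : secMap (T.d n (n + 1)) ⊤ t = 0 := ht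
  rw [secMap_comm, ht', map_zero]

lemma secMap_mem_globalCoboundaries (f : T ⟶ T') {t : Sec (T.X n) ⊤}
    (ht : t ∈ globalCoboundaries T n) : secMap (f.f n) ⊤ t ∈ globalCoboundaries T' n := by
  obtain ⟨s, rfl⟩ := ht
  exact ⟨secMap (f.f (n - 1)) ⊤ s, secMap_comm f _ _ s⟩

lemma homotopy_sub_mem {f g : T ⟶ T'} (H : Homotopy f g) {t : Sec (T.X n) ⊤}
    (ht : t ∈ globalCocycles T n) :
    secMap (f.f n) ⊤ t - secMap (g.f n) ⊤ t ∈ globalCoboundaries T' n := by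
  have ht' : secMap (T.d n (n + 1)) ⊤ t = 0 := ht
  have h := H.comm n
  rw [dNext_eq H.hom (show (ComplexShape.up ℤ).Rel n (n + 1) from rfl),
    prevD_eq H.hom (show (ComplexShape.up ℤ).Rel (n - 1) n from sub_add_cancel n 1)] at h
  refine ⟨secMap (H.hom n (n - 1)) ⊤ t, ?_⟩
  rw [h, secMap_add, secMap_add, secMap_comp, secMap_comp, ht', map_zero, zero_add,
    add_sub_cancel_right]

lemma exists_globalCohomology_equiv (e : HomotopyEquiv T T') (n : ℤ) :
    ∃ θ : GlobalCohomology T n ≃+ GlobalCohomology T' n,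
      ∀ (t : globalCocycles T n) (t' : globalCocycles T' n), secMap (e.hom.f n) ⊤ t.1 = t'.1 →
        θ (QuotientAddGroup.mk t) = QuotientAddGroup.mk t' := by
  refine (exists_addEquiv_of_correspondence
    ((globalCoboundaries T n).addSubgroupOf (globalCocycles T n))
    ((globalCoboundaries T' n).addSubgroupOf (globalCocycles T' n))
    { carrier := {z | secMap (e.hom.f n) ⊤ z.1.1 - z.2.1 ∈ globalCoboundaries T' n}
      zero_mem' := by
        change secMap (e.hom.f n) ⊤ 0 - 0 ∈ globalCoboundaries T' n
        rw [map_zero, sub_zero]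
        exact zero_mem _
      add_mem' := fun {a b} ha hb => by
        change secMap (e.hom.f n) ⊤ (a.1.1 + b.1.1) - (a.2.1 + b.2.1) ∈ globalCoboundaries T' n
        rw [map_add, add_sub_add_comm]
        exact add_mem ha hb
      neg_mem' := fun {a} ha => by
        change secMap (e.hom.f n) ⊤ (-a.1.1) - -a.2.1 ∈ globalCoboundaries T' n
        rw [map_neg, ← neg_sub']
        exact neg_mem ha } ?_ ?_ ?_ ?_).imp fun θ hθ t t' h => (hθ t t').2 ?_
  rotate_left 4
  · change secMap (e.hom.f n) ⊤ t.1 - t'.1 ∈ globalCoboundaries T' n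
    rw [h, sub_self]
    exact zero_mem _
  · rintro ⟨t, ht⟩
    refine ⟨⟨_, secMap_mem_globalCocycles e.hom ht⟩, ?_⟩
    change secMap (e.hom.f n) ⊤ t - secMap (e.hom.f n) ⊤ t ∈ globalCoboundaries T' n
    rw [sub_self]
    exact zero_mem _
  · rintro ⟨t, ht⟩
    refine ⟨⟨_, secMap_mem_globalCocycles e.inv ht⟩, ?_⟩
    have h := homotopy_sub_mem e.homotopyInvHomId ht
    rw [HomologicalComplex.comp_f, secMap_comp, HomologicalComplex.id_f, secMap_id] at h
    exact h
  · rintro ⟨t, ht⟩ ⟨t', ht'⟩ h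
    change secMap (e.hom.f n) ⊤ t - t' ∈ globalCoboundaries T' n at h
    change t ∈ globalCoboundaries T n ↔ t' ∈ globalCoboundaries T' n
    have h' := homotopy_sub_mem e.homotopyHomInvId ht
    rw [HomologicalComplex.comp_f, secMap_comp, HomologicalComplex.id_f, secMap_id] at h'
    refine ⟨fun hc => ?_, fun hc => ?_⟩
    · have := sub_mem (secMap_mem_globalCoboundaries e.hom hc) h
      rwa [sub_sub_cancel] at this
    · have h1 := add_mem h hc
      rw [sub_add_cancel] at h1
      have := sub_mem (secMap_mem_globalCoboundaries e.inv h1) h'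
      rwa [sub_sub_cancel] at this
  · rintro ⟨t, ht⟩ hc
    change t ∈ globalCoboundaries T' n at hc
    change secMap (e.hom.f n) ⊤ 0 - t ∈ globalCoboundaries T' n
    rw [map_zero, zero_sub]
    exact neg_mem hc

end GlobalSections

/-! ### Extension of quasi-isomorphisms to injective resolutions -/

section InducedMaps

variable {X : TopCat.{u}} {K L : CochainComplex (TopCat.Sheaf AddCommGrpCat.{u} X) ℤ}
  [K.IsStrictlyGE 0] [L.IsStrictlyGE 0]

lemma exists_injRes_lift {a : ℤ} (φ : K ⟶ reindex L a) [QuasiIso φ] :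
    ∃ e : HomotopyEquiv (injRes K).T (reindex (injRes L).T a),
      Nonempty (Homotopy ((injRes K).aug ≫ e.hom) (φ ≫ reindexMap (injRes L).aug a)) := by
  have := (injRes K).injective
  have := (injRes K).bounded
  have := (injRes K).quasiIso
  have := (injRes L).bounded
  have := (injRes L).quasiIso
  have : ∀ n, Injective ((reindex (injRes L).T a).X n) := fun n => (injRes L).injective (n + a)
  have := CochainComplex.isKInjective_of_injective (injRes K).T 0
  have := reindex_isStrictlyGE (K := (injRes L).T) a
  have := CochainComplex.isKInjective_of_injective (reindex (injRes L).T a) (-a)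
  exact exists_homotopyEquiv_lift _ _

end InducedMaps

/-! ### The exponential morphism is a quasi-isomorphism -/

section ExpQuasiIso

variable (m : ℕ) (M : Type u) [TopologicalSpace M] [ChartedSpace (Euc m) M]
  [IsManifold 𝓘(ℝ, Euc m) ∞ M]

lemma isIso_scaleHom {a : ℂ} (ha : a ≠ 0) (k : ℕ) : IsIso (scaleHom m M a k) := by
  refine ⟨scaleHom m M a⁻¹ k, sheafHom_ext _ _ fun V θ => ?_, sheafHom_ext _ _ fun V θ => ?_⟩
  · exact Subtype.ext (inv_smul_smul₀ ha _)
  · exact Subtype.ext (smul_inv_smul₀ ha _)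

lemma twoPiI_zpow_ne_zero : (2 * Real.pi * Complex.I : ℂ) ^ (-2 : ℤ) ≠ 0 :=
  zpow_ne_zero _ Complex.two_pi_I_ne_zero

/-- Local logarithms settle degree 1, scaling by a nonzero constant is invertible in degrees 2 and
3, and elsewhere the target is zero. -/
instance epi_expMap (n : ℤ) : Epi ((expMap m M).f n) := by
  match n with
  | .negSucc n => exact (isZero_cxComplex m M (q := .negSucc n + -1) (Or.inl (by omega))).epi _
  | 0 => exact (isZero_cxComplex m M (q := 0 + -1) (Or.inl (by decide))).epi _
  | .ofNat 1 => exact (exp_shortExact (m := m) (M := M) (p := 3) twoPiI).epi_g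
  | .ofNat 2 =>
    have := isIso_scaleHom m M twoPiI_zpow_ne_zero 1
    exact inferInstanceAs (Epi (scaleHom m M ((2 * Real.pi * Complex.I) ^ (-2 : ℤ)) 1))
  | .ofNat 3 =>
    have := isIso_scaleHom m M twoPiI_zpow_ne_zero 2
    exact inferInstanceAs (Epi (scaleHom m M ((2 * Real.pi * Complex.I) ^ (-2 : ℤ)) 2))
  | .ofNat (n + 4) =>
    exact (isZero_cxComplex m M (q := ((n + 4 : ℕ) : ℤ) + -1) (Or.inr (by push_cast; omega))).epi _

/-- The kernel is ℤ(3) in degree 0, where the target vanishes, and again ℤ(3) in degree 1 by the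
exponential sequence, with the identity between them. -/
instance quasiIso_expMap : QuasiIso (expMap m M) := by
  have hS := exp_shortExact (m := m) (M := M) (p := 3) twoPiI
  have := hS.mono_f
  refine quasiIso_of_epi_of_acyclic_kernel _ fun n A x hx hd => ?_
  have key (h : x = 0) : ∃ (A' : TopCat.Sheaf AddCommGrpCat.{u} (TopCat.of M)) (π : A' ⟶ A)
      (_ : Epi π) (z : A' ⟶ (deligneComplex m M).X (n - 1)),
      z ≫ (expMap m M).f (n - 1) = 0 ∧ π ≫ x = z ≫ (deligneComplex m M).d (n - 1) n :=
    ⟨A, 𝟙 A, inferInstance, 0, zero_comp, by rw [h, comp_zero, zero_comp]⟩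
  match n, x, hx, hd, key with
  | .negSucc n, x, hx, hd, key => exact key (IsZero.eq_of_tgt (isZero_zero _) _ _)
  | 0, x, hx, hd, key =>
    have h : (deligneComplex m M).d 0 1 = inclHom m M 3 :=
      CochainComplex.of_d (deligneX m M) (deligneD m M) (j := 0)
    refine key ((cancel_mono (inclHom m M 3)).1 ?_)
    exact ((congrArg (x ≫ ·) h.symm).trans hd).trans zero_comp.symm
  | .ofNat 1, x, hx, hd, key =>
    have h : (deligneComplex m M).d 0 1 = inclHom m M 3 :=
      CochainComplex.of_d (deligneX m M) (deligneD m M) (j := 0)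
    -- An element of the kernel of the exponential factors through ℤ(3), and this factorization is
    -- its primitive; no refinement is needed.
    refine ⟨A, 𝟙 A, inferInstance, hS.exact.lift x hx, IsZero.eq_of_tgt (isZero_zero _) _ _, ?_⟩
    refine (Category.id_comp x).trans ((hS.exact.lift_f x hx).symm.trans ?_)
    exact congrArg (hS.exact.lift x hx ≫ ·) h.symm
  | .ofNat 2, x, hx, hd, key =>
    have := isIso_scaleHom m M twoPiI_zpow_ne_zero 1
    exact key ((cancel_mono (scaleHom m M ((2 * Real.pi * Complex.I) ^ (-2 : ℤ)) 1)).1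
      (hx.trans zero_comp.symm))
  | .ofNat 3, x, hx, hd, key =>
    have := isIso_scaleHom m M twoPiI_zpow_ne_zero 2
    exact key ((cancel_mono (scaleHom m M ((2 * Real.pi * Complex.I) ^ (-2 : ℤ)) 2)).1
      (hx.trans zero_comp.symm))
  | .ofNat (n + 4), x, hx, hd, key => exact key (IsZero.eq_of_tgt (isZero_zero _) _ _)

lemma exists_hypercohomology_equiv_expMap :
    ∃ θ : Hypercohomology (deligneComplex m M) 3 ≃+ Hypercohomology (cxComplex m M) 2,
      IsInducedBy (expMap m M) 3 θ := by
  obtain ⟨e, he⟩ := exists_injRes_lift (expMap m M)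
  obtain ⟨θ, hθ⟩ := exists_globalCohomology_equiv e 3
  exact ⟨θ, e.hom, he, hθ⟩

end ExpQuasiIso

end BFieldClassification

end

theorem mainTheorem4 {m : ℕ} (M : Type u) [TopologicalSpace M] [T2Space M] [ParacompactSpace M]
    [ChartedSpace (Euc m) M] [IsManifold 𝓘(ℝ, Euc m) ∞ M] {ι : Type v}
    (U : ι → Opens M) (hU : IsLerayCover (X := TopCat.of M) U) :
    ∃ (e : BField m U ≃ cechCocycles (X := TopCat.of M) U (cxComplex m M) 2)
      (κ : CechCohomology (X := TopCat.of M) U (cxComplex m M) 2 ≃+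
        Hypercohomology (cxComplex m M) 2)
      (Φ : BField.IsoClass m U ≃ Hypercohomology (cxComplex m M) 2)
      (θ : Hypercohomology (deligneComplex m M) 3 ≃+ Hypercohomology (cxComplex m M) 2)
      (Ψ : BField.IsoClass m U ≃ Hypercohomology (deligneComplex m M) 3),
      (∀ b : BField m U, b.HasComponents (e b).1) ∧
      IsCechComparison (X := TopCat.of M) U (cxComplex m M) 2 κ ∧
      (∀ b, Φ (Quotient.mk _ b) = κ (QuotientAddGroup.mk (e b))) ∧
      IsInducedBy (expMap m M) 3 θ ∧
      (∀ b, θ (Ψ (Quotient.mk _ b)) = Φ (Quotient.mk _ b)) := by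
  obtain ⟨e, he⟩ := exists_bfield_equiv m U
  obtain ⟨Φ₀, hΦ₀⟩ := exists_isoClass_equiv m U e he
  obtain ⟨κ, hκ⟩ := hU.exists_comparison (m := m)
  obtain ⟨θ, hθ⟩ := exists_hypercohomology_equiv_expMap m M
  exact ⟨e, κ, Φ₀.trans κ.toEquiv, θ, (Φ₀.trans κ.toEquiv).trans θ.symm.toEquiv, he, hκ,
    fun b => congrArg κ (hΦ₀ b), hθ, fun b => θ.apply_symm_apply _⟩
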